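/- Let $p$ be an odd prime. A $\sigma$-pro-$p$-group is a pro-$p$-group with a continuous action of a group $\{1,\sigma\}$ of order $2$; its odd part is $G^-=\{a\in G\mid {}^\sigma a=a^{-1}\}$; $\sigma$-homomorphisms are continuous and $\sigma$-equivariant, and $\operatorname{Aut}_\sigma(G)$ is the group of $\sigma$-equivariant topological automorphisms. All subgroups are closed, and generation is topological. Let $F_n$ be the free pro-$p$-group on $n$ generators, with $\sigma$ inverting each generator. For $r=(r_1,\dots,r_n)\in(F_n^-)^n$ let $N_r$ be the normal subgroup generated by all conjugates of the $r_i$, and $G_r=F_n/N_r$. A weak Schur $\sigma$-group is a $\sigma$-pro-$p$-group that is $\sigma$-isomorphic to some $G_r$ (for some $n\ge0$ and $r\in(F_n^-)^n$); $d_G$ denotes its minimal number of generators. Let $\mathrm{Sch}$ be the set of weak Schur $\sigma$-groups up to $\sigma$-isomorphism, with the topology having as a basis the sets $\{[H]\mid H/D_i(H)\cong G/D_i(G)\}$ for $i\ge2$ and $[G]\in\mathrm{Sch}$, where $D_i$ is the Zassenhaus filtration. The Haar measure on $F_n^-$ is the Borel probability measure for which, for every $\sigma$-invariant open normal subgroup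 $M$ of $F_n$, all fibres of $F_n^-\to(F_n/M)^-$ have the same measure. Let $\mu_n$ be the pushforward of the product of these measures under $(F_n^-)^n\to\mathrm{Sch}$, $r\mapsto[G_r]$, and let $\mu_\infty$ be the limit of the $\mu_n$ for $n\to\infty$ (on every Borel set). Put $C_k=\prod_{i=1}^k(1-p^{-i})$ for $0\le k\le\infty$. Fix $n\ge0$ and a closed normal subgroup $D$ of $F_n$ that is $\sigma$-invariant, contained in the Frattini subgroup of $F_n$, and invariant under $\operatorname{Aut}_\sigma(F_n)$; it need not be open. For a weak Schur $\sigma$-group $G$ with $d_G=n$ choose a surjective $\sigma$-homomorphism $\pi\colon F_n\to G$ with kernel $N$, and put $G_D:=G/\pi(D)$; up to $\sigma$-isomorphism this does not depend on $\pi$. Let $m_{D,G}$ be the minimal number of generators of $ND/D$ as a normal subgroup of $F_n/D$, and $$U_{D,G}:=\{[H]\in\mathrm{Sch}\mid d_H=n\text{ and }H_D\cong G_D\text{ as }\sigma\text{-groups}\}.$$ If $G_D$ is finite, then $U_{D,G}$ is an open and closed subset of $\mathrm{Sch}$, one has $m_{D,G}\le n$, and $$\mu_\infty(U_{D,G})=\frac{C_\infty}{C_{n-m_{D,G}}}\cdot\frac1{|\operatorname{Aut}_\sigma(G_D)|}.$$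 If moreover $D\subset[F_n,F_n]$ (the closed commutator subgroup), then $$\mu_\infty(U_{D,G})=\frac{C_\infty}{|\operatorname{Aut}_\sigma(G_D)|}.$$ -/

import Mathlib

open MeasureTheory Filter Topology

namespace SchurSigma

universe u v w

/-! ### Groups with an involution -/

/-- A topological group with a continuous action of the group `{1, σ}` of order two. -/
class SigmaGroup (G : Type u) [Group G] [TopologicalSpace G] where
  /-- the automorphism by which the nontrivial element `σ` acts -/
  sigma : G →ₜ* G
  sigma_sigma : ∀ g, sigma (sigma g) = g

open SigmaGroup (sigma sigma_sigma)

/-- Surjective continuous `σ`-equivariant homomorphisms. -/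
structure SigmaEpi (G : Type u) (H : Type v) [Group G] [TopologicalSpace G] [SigmaGroup G]
    [Group H] [TopologicalSpace H] [SigmaGroup H] extends G →ₜ* H where
  map_sigma : ∀ g, toFun (sigma g) = sigma (toFun g)
  surjective : Function.Surjective toFun

/-- `σ`-isomorphisms: `σ`-equivariant topological isomorphisms. -/
structure SigmaIso (G : Type u) (H : Type v) [Group G] [TopologicalSpace G] [SigmaGroup G]
    [Group H] [TopologicalSpace H] [SigmaGroup H] extends G ≃ₜ* H where
  map_sigma : ∀ g, toFun (sigma g) = sigma (toFun g)

namespace SigmaIso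

variable {G : Type u} {H : Type v} {K : Type w} [Group G] [TopologicalSpace G] [SigmaGroup G]
  [Group H] [TopologicalSpace H] [SigmaGroup H] [Group K] [TopologicalSpace K] [SigmaGroup K]

def refl (G : Type u) [Group G] [TopologicalSpace G] [SigmaGroup G] : SigmaIso G G where
  toContinuousMulEquiv := ContinuousMulEquiv.refl G
  map_sigma _ := rfl

def symm (e : SigmaIso G H) : SigmaIso H G where
  toContinuousMulEquiv := e.toContinuousMulEquiv.symm
  map_sigma h := by
    have key := e.map_sigma (e.toContinuousMulEquiv.symm h)
    change e.toContinuousMulEquiv.symm (sigma h) = sigma (e.toContinuousMulEquiv.symm h)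
    rw [ContinuousMulEquiv.symm_apply_eq]
    refine Eq.trans ?_ key.symm
    exact congrArg sigma (e.toContinuousMulEquiv.apply_symm_apply h).symm

def trans (e : SigmaIso G H) (f : SigmaIso H K) : SigmaIso G K where
  toContinuousMulEquiv := e.toContinuousMulEquiv.trans f.toContinuousMulEquiv
  map_sigma g := by
    change f.toFun (e.toFun (sigma g)) = sigma (f.toFun (e.toFun g))
    rw [e.map_sigma, f.map_sigma]

end SigmaIso

/-- The group `Aut_σ(G)` of `σ`-automorphisms. -/
abbrev SigmaAut (G : Type u) [Group G] [TopologicalSpace G] [SigmaGroup G] := SigmaIso G G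

/-- The odd part `G⁻ = {a ∈ G | σ a = a⁻¹}`. -/
abbrev OddPart (G : Type u) [Group G] [TopologicalSpace G] [SigmaGroup G] : Type u :=
  {a : G // sigma a = a⁻¹}

/-- `σ`-invariant subgroups. -/
class IsSigmaInvariant {G : Type u} [Group G] [TopologicalSpace G] [SigmaGroup G]
    (N : Subgroup G) : Prop where
  sigma_mem : ∀ g ∈ N, sigma g ∈ N

section Quotient

variable {G : Type u} [Group G] [TopologicalSpace G] [SigmaGroup G]

/-- The involution induced on the quotient by a `σ`-invariant normal subgroup. -/
instance quotientSigmaGroup (N : Subgroup G) [N.Normal] [hN : IsSigmaInvariant N] :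
    SigmaGroup (G ⧸ N) where
  sigma :=
    { toMonoidHom := QuotientGroup.map N N (sigma (G := G)).toMonoidHom
        (fun g hg => hN.sigma_mem g hg)
      continuous_toFun := by
        refine continuous_quot_lift _ ?_
        exact QuotientGroup.continuous_mk.comp (sigma (G := G)).continuous_toFun }
  sigma_sigma := by
    rintro ⟨g⟩
    exact congrArg (QuotientGroup.mk (s := N)) (sigma_sigma g)

variable {H : Type v} [Group H] [TopologicalSpace H] [SigmaGroup H]

/-- The image of a subgroup under a surjective `σ`-homomorphism. -/
def SigmaEpi.image (π : SigmaEpi G H) (D : Subgroup G) : Subgroup H :=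
  D.map π.toMonoidHom

instance (π : SigmaEpi G H) (D : Subgroup G) [hD : D.Normal] : (π.image D).Normal :=
  hD.map _ π.surjective

instance (π : SigmaEpi G H) (D : Subgroup G) [hD : IsSigmaInvariant D] :
    IsSigmaInvariant (π.image D) where
  sigma_mem := by
    rintro _ ⟨d, hd, rfl⟩
    exact ⟨sigma d, hD.sigma_mem d hd, π.map_sigma d⟩

end Quotient

/-! ### Generation, Frattini subgroup and Zassenhaus filtration of topological groups -/

section Filtrations

variable (p : ℕ) (G : Type u) [Group G] [TopologicalSpace G] [IsTopologicalGroup G]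

/-- `d_G`: the minimal number of topological generators of `G`. -/
noncomputable def minGens : ℕ :=
  sInf {k | ∃ s : Fin k → G, (Subgroup.closure (Set.range s)).topologicalClosure = ⊤}

/-- The minimal number of elements that generate `N` topologically as a normal subgroup. -/
noncomputable def minNormalGens {G : Type u} [Group G] [TopologicalSpace G]
    [IsTopologicalGroup G] (N : Subgroup G) : ℕ :=
  sInf {k | ∃ s : Fin k → G, (Subgroup.normalClosure (Set.range s)).topologicalClosure = N}

/-- The closed commutator subgroup `[G, G]`. -/
def closedCommutator : Subgroup G := (commutator G).topologicalClosure

/-- The Frattini subgroup of a pro-`p`-group: the smallest closed normal subgroup whose quotient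
is an `𝔽_p`-vector space, i.e. the closed subgroup generated by `p`-th powers and commutators. -/
def proFrattini : Subgroup G :=
  (Subgroup.closure ({g | ∃ x : G, g = x ^ p} ∪ {g | ∃ x y : G, g = x * y * x⁻¹ * y⁻¹})).topologicalClosure

/-- The Zassenhaus filtration (dimension subgroups in characteristic `p`), with closed subgroups:
`D_1 = G`, and `D_i` for `i ≥ 2` is generated by the `p`-th powers of elements of `D_k` with
`p * k ≥ i` and by the commutators `[D_j, D_{i-j}]` for `0 < j < i`. As the filtration is
decreasing, only the least such `k`, which is `⌈i / p⌉`, matters. (Also `D_0 = G`.) -/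
def zassenhaus (i : ℕ) : Subgroup G :=
  if i ≤ 1 then ⊤ else
    (Subgroup.closure
      ({g | ∃ (k : ℕ) (_ : k < i) (_ : i ≤ p * k), ∃ x ∈ zassenhaus k, g = x ^ p} ∪
       {g | ∃ (j : ℕ) (_ : 0 < j) (_ : j < i),
          ∃ x ∈ zassenhaus j, ∃ y ∈ zassenhaus (i - j), g = x * y * x⁻¹ * y⁻¹})).topologicalClosure
termination_by i

variable {G}

theorem zassenhaus_map_mem (f : G →ₜ* G) (i : ℕ) : ∀ x ∈ zassenhaus p G i,
    f x ∈ zassenhaus p G i := by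
  induction i using Nat.strong_induction_on with
  | _ i ih =>
    by_cases hi : i ≤ 1
    · intro x _
      rw [zassenhaus, if_pos hi]
      exact Subgroup.mem_top _
    · suffices h : zassenhaus p G i ≤ (zassenhaus p G i).comap f.toMonoidHom from
        fun x hx => h hx
      conv_lhs => rw [zassenhaus, if_neg hi]
      have hcl : IsClosed ((zassenhaus p G i : Subgroup G) : Set G) := by
        rw [zassenhaus, if_neg hi]
        exact Subgroup.isClosed_topologicalClosure _
      refine Subgroup.topologicalClosure_minimal _ ?_ (hcl.preimage f.continuous_toFun)
      rw [Subgroup.closure_le]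
      have hsub : ∀ g ∈
          ({g | ∃ (k : ℕ) (_ : k < i) (_ : i ≤ p * k), ∃ x ∈ zassenhaus p G k, g = x ^ p} ∪
           {g | ∃ (j : ℕ) (_ : 0 < j) (_ : j < i),
            ∃ x ∈ zassenhaus p G j, ∃ y ∈ zassenhaus p G (i - j), g = x * y * x⁻¹ * y⁻¹} : Set G),
          g ∈ zassenhaus p G i := by
        intro g hg
        rw [zassenhaus, if_neg hi]
        exact Subgroup.le_topologicalClosure _ (Subgroup.subset_closure hg)
      rintro g (⟨k, hk, hik, x, hx, rfl⟩ | ⟨j, hj0, hji, x, hx, y, hy, rfl⟩)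
      · refine hsub _ (Or.inl ⟨k, hk, hik, f x, ih k hk x hx, ?_⟩)
        exact map_pow f x p
      · refine hsub _ (Or.inr ⟨j, hj0, hji, f x, ih j hji x hx, f y,
          ih (i - j) (by omega) y hy, ?_⟩)
        simp only [map_mul, map_inv]
        rfl

instance zassenhaus_normal (i : ℕ) : (zassenhaus p G i).Normal where
  conj_mem x hx g :=
    zassenhaus_map_mem p
      { toMonoidHom := (MulAut.conj g).toMonoidHom
        continuous_toFun := by
          change Continuous fun x => g * x * g⁻¹
          fun_prop } i x hx

instance zassenhaus_sigmaInvariant [SigmaGroup G] (i : ℕ) :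
    IsSigmaInvariant (zassenhaus p G i) where
  sigma_mem := zassenhaus_map_mem p sigma i

end Filtrations

/-! ### The free pro-`p`-group `F_n` on `n` odd generators -/

/-- The normal subgroups of `p`-power index of the abstract free group on `n` generators. -/
abbrev PowIndex (p n : ℕ) : Type :=
  {N : Subgroup (FreeGroup (Fin n)) // N.Normal ∧ ∃ k, N.index = p ^ k}

instance (p n : ℕ) (N : PowIndex p n) : N.1.Normal := N.2.1

/-- The finite `p`-group `FreeGroup / N`, with the discrete topology. -/
def Stage {p n : ℕ} (N : PowIndex p n) : Type := FreeGroup (Fin n) ⧸ N.1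

instance {p n : ℕ} (N : PowIndex p n) : Group (Stage N) :=
  inferInstanceAs (Group (FreeGroup (Fin n) ⧸ N.1))

instance {p n : ℕ} (N : PowIndex p n) : TopologicalSpace (Stage N) := ⊥

instance {p n : ℕ} (N : PowIndex p n) : DiscreteTopology (Stage N) := ⟨rfl⟩

/-- The transition map `FreeGroup / M → FreeGroup / N` for `M ≤ N`. -/
def Stage.trans {p n : ℕ} {M N : PowIndex p n} (h : M.1 ≤ N.1) : Stage M →* Stage N :=
  QuotientGroup.map M.1 N.1 (MonoidHom.id _) h

/-- The inverse limit of all `p`-power quotients of the free group on `n` generators. -/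
def limitSubgroup (p n : ℕ) : Subgroup (∀ N : PowIndex p n, Stage N) where
  carrier := {x | ∀ (M N : PowIndex p n) (h : M.1 ≤ N.1), Stage.trans h (x M) = x N}
  mul_mem' {x y} hx hy M N h := by
    change Stage.trans h (x M * y M) = x N * y N
    rw [map_mul, hx M N h, hy M N h]
  one_mem' M N h := map_one (Stage.trans h)
  inv_mem' {x} hx M N h := by
    change Stage.trans h (x M)⁻¹ = (x N)⁻¹
    rw [map_inv, hx M N h]

/-- The free pro-`p`-group `F_n` of rank `n`: the pro-`p`-completion of the free group of
rank `n`. -/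
def FreeProP (p n : ℕ) : Type := limitSubgroup p n

namespace FreeProP

variable {p n : ℕ}

instance : Group (FreeProP p n) := inferInstanceAs (Group (limitSubgroup p n))

instance : TopologicalSpace (FreeProP p n) :=
  inferInstanceAs (TopologicalSpace (limitSubgroup p n))

instance : IsTopologicalGroup (FreeProP p n) :=
  inferInstanceAs (IsTopologicalGroup (limitSubgroup p n))

instance : T2Space (FreeProP p n) := inferInstanceAs (T2Space (limitSubgroup p n))

instance : MeasurableSpace (FreeProP p n) := borel _

instance : BorelSpace (FreeProP p n) := ⟨rfl⟩

/-- The projection of `F_n` to one of the finite `p`-groups of which it is the limit. -/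
def proj (N : PowIndex p n) : FreeProP p n →* Stage N :=
  (Pi.evalMonoidHom _ N).comp (limitSubgroup p n).subtype

/-- The canonical homomorphism from the abstract free group. -/
def ofFree : FreeGroup (Fin n) →* FreeProP p n where
  toFun w := ⟨fun N => QuotientGroup.mk (s := N.1) w, fun _ _ _ => rfl⟩
  map_one' := rfl
  map_mul' _ _ := rfl

/-- The free generators `x_1, …, x_n` of `F_n`. -/
def gen (i : Fin n) : FreeProP p n := ofFree (FreeGroup.of i)

/-- The endomorphism of the abstract free group that inverts all generators. -/
def flip (n : ℕ) : FreeGroup (Fin n) →* FreeGroup (Fin n) :=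
  FreeGroup.lift fun i => (FreeGroup.of i)⁻¹

theorem flip_flip (w : FreeGroup (Fin n)) : flip n (flip n w) = w := by
  have h : (flip n).comp (flip n) = MonoidHom.id _ := by
    ext i
    simp [flip]
  exact DFunLike.congr_fun h w

/-- The preimage of a normal subgroup of `p`-power index under `flip`. -/
def flipIndex (N : PowIndex p n) : PowIndex p n :=
  ⟨N.1.comap (flip n), N.2.1.comap _, by
    rw [Subgroup.index_comap_of_surjective _ fun w => ⟨flip n w, flip_flip w⟩]
    exact N.2.2⟩

theorem flipIndex_flipIndex (N : PowIndex p n) : flipIndex (flipIndex N) = N := by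
  apply Subtype.ext
  ext w
  change flip n (flip n w) ∈ N.1 ↔ w ∈ N.1
  rw [flip_flip]

/-- The homomorphism between finite quotients induced by `flip`. -/
def stageFlip (N : PowIndex p n) : Stage (flipIndex N) →* Stage N :=
  QuotientGroup.map (flipIndex N).1 N.1 (flip n) le_rfl

theorem stageFlip_trans {M N : PowIndex p n} (h : M.1 ≤ N.1) (y : Stage (flipIndex M)) :
    Stage.trans h (stageFlip M y) =
      stageFlip N (Stage.trans (M := flipIndex M) (N := flipIndex N) (Subgroup.comap_mono h) y) := by
  obtain ⟨w, rfl⟩ := QuotientGroup.mk_surjective y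
  rfl

/-- The involution of `F_n` that inverts all generators. -/
def sigmaHom (p n : ℕ) : FreeProP p n →ₜ* FreeProP p n where
  toFun x := ⟨fun N => stageFlip N (x.1 (flipIndex N)), fun M N h => by
    have hx := x.2 (flipIndex M) (flipIndex N) (Subgroup.comap_mono h)
    exact (stageFlip_trans h _).trans (congrArg (stageFlip N) hx)⟩
  map_one' := Subtype.ext (funext fun N => map_one (stageFlip N))
  map_mul' x y := Subtype.ext (funext fun N =>
    map_mul (stageFlip N) (x.1 (flipIndex N)) (y.1 (flipIndex N)))
  continuous_toFun := by
    refine Continuous.subtype_mk (continuous_pi fun N => ?_) _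
    exact continuous_of_discreteTopology.comp
      ((continuous_apply (flipIndex N)).comp continuous_subtype_val)

instance : SigmaGroup (FreeProP p n) where
  sigma := sigmaHom p n
  sigma_sigma x := by
    refine Subtype.ext (funext fun N => ?_)
    change stageFlip N (stageFlip (flipIndex N) (x.1 (flipIndex (flipIndex N)))) = x.1 N
    have hle : (flipIndex (flipIndex N)).1 ≤ N.1 := by rw [flipIndex_flipIndex]
    refine Eq.trans ?_ (x.2 (flipIndex (flipIndex N)) N hle)
    obtain ⟨w, hw⟩ := QuotientGroup.mk_surjective (x.1 (flipIndex (flipIndex N)))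
    rw [← hw]
    change QuotientGroup.mk (s := N.1) (flip n (flip n w)) = QuotientGroup.mk (s := N.1) w
    rw [flip_flip]

/-- The generators of `F_n` are odd. -/
theorem sigma_gen (i : Fin n) : sigma (gen i : FreeProP p n) = (gen i)⁻¹ := by
  refine Subtype.ext (funext fun N => ?_)
  change QuotientGroup.mk (s := N.1) (flip n (FreeGroup.of i))
    = QuotientGroup.mk (s := N.1) (FreeGroup.of i)⁻¹
  simp [flip]

end FreeProP

/-! ### The Haar measure on the odd part -/

/-- The characterization of the Haar measure on `G⁻` for a `σ`-pro-`p`-group `G`: it is the Borel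
probability measure for which, for every open normal `σ`-invariant subgroup `N`, all fibres of
`G⁻ → (G/N)⁻` have the same measure. -/
def IsOddHaar {G : Type u} [Group G] [TopologicalSpace G] [SigmaGroup G] [MeasurableSpace G]
    (μ : Measure (OddPart G)) : Prop :=
  IsProbabilityMeasure μ ∧
    ∀ N : Subgroup G, N.Normal → IsSigmaInvariant N → IsOpen (N : Set G) →
      ∀ b c : OddPart G, μ {x | (b : G)⁻¹ * x ∈ N} = μ {x | (c : G)⁻¹ * x ∈ N}

namespace FreeProP

variable {p n : ℕ}

instance [hp : Fact p.Prime] (N : PowIndex p n) : Finite (Stage N) := by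
  obtain ⟨k, hk⟩ := N.2.2
  have : N.1.FiniteIndex := ⟨by rw [hk]; exact pow_ne_zero k hp.out.ne_zero⟩
  exact inferInstanceAs (Finite (FreeGroup (Fin n) ⧸ N.1))

instance [Fact p.Prime] : CompactSpace (FreeProP p n) := by
  have hc : IsClosed ((limitSubgroup p n : Subgroup _) : Set (∀ N : PowIndex p n, Stage N)) := by
    have : ((limitSubgroup p n : Subgroup _) : Set (∀ N : PowIndex p n, Stage N)) =
        ⋂ (M : PowIndex p n) (N : PowIndex p n) (h : M.1 ≤ N.1),
          {x | Stage.trans h (x M) = x N} := by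
      ext x
      simp [limitSubgroup]
    rw [this]
    refine isClosed_iInter fun M => isClosed_iInter fun N => isClosed_iInter fun h => ?_
    exact isClosed_eq (continuous_of_discreteTopology.comp (continuous_apply M))
      (continuous_apply N)
  exact isCompact_iff_compactSpace.mp hc.isCompact

/-- Every open normal subgroup of `F_n` has a quotient in which all orders are powers of `p`. -/
theorem exists_pow_mem [Fact p.Prime] (U : Subgroup (FreeProP p n))
    (hU : IsOpen (U : Set (FreeProP p n))) (x : FreeProP p n) : ∃ k, x ^ p ^ k ∈ U := by
  classical
  obtain ⟨V, hV, hVU⟩ := isOpen_induced_iff.mp hU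
  have h1 : (1 : ∀ N : PowIndex p n, Stage N) ∈ V := by
    have : (1 : FreeProP p n) ∈ (U : Set (FreeProP p n)) := U.one_mem
    rw [← hVU] at this
    exact this
  obtain ⟨I, u, hu, hsub⟩ := isOpen_pi_iff.mp hV 1 h1
  have hexp : ∀ N : PowIndex p n, ∃ k, ∀ y : Stage N, y ^ p ^ k = 1 := by
    intro N
    obtain ⟨k, hk⟩ := N.2.2
    refine ⟨k, fun y => ?_⟩
    have hcard : Nat.card (Stage N) = p ^ k := hk
    rw [← hcard]
    exact pow_card_eq_one'
  choose e he using hexp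
  refine ⟨∑ N ∈ I, e N, ?_⟩
  change x ^ p ^ (∑ N ∈ I, e N) ∈ (U : Set (FreeProP p n))
  rw [← hVU]
  apply hsub
  intro N hN
  have hpow : proj N (x ^ p ^ (∑ N ∈ I, e N)) = 1 := by
    have hsplit : ∑ M ∈ I, e M = e N + ∑ M ∈ I.erase N, e M := (Finset.add_sum_erase I e hN).symm
    rw [map_pow, hsplit, pow_add, pow_mul, he, one_pow]
  change proj N (x ^ p ^ (∑ N ∈ I, e N)) ∈ u N
  rw [hpow]
  exact (hu N hN).2

/-- Existence of the Haar measure on `F_n⁻`: the image of the Haar measure of `F_n` under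
`g ↦ g · (σ g)⁻¹` has the required property. -/
theorem exists_isOddHaar [hp : Fact p.Prime] (hp2 : p ≠ 2) :
    ∃ μ : Measure (OddPart (FreeProP p n)), IsOddHaar μ := by
  let ν : Measure (FreeProP p n) := Measure.haarMeasure ⊤
  have hν : IsProbabilityMeasure ν := ⟨Measure.haarMeasure_self (K₀ := ⊤)⟩
  let f : FreeProP p n → OddPart (FreeProP p n) := fun g => ⟨g * (sigma g)⁻¹, by
    rw [map_mul, map_inv, sigma_sigma, mul_inv_rev, inv_inv]⟩
  have hf : Measurable f := by
    have : Continuous f := by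
      refine Continuous.subtype_mk ?_ _
      exact continuous_id.mul ((sigma (G := FreeProP p n)).continuous_toFun.inv)
    exact this.measurable
  refine ⟨ν.map f, Measure.isProbabilityMeasure_map hf.aemeasurable, ?_⟩
  intro N hN hNs hNo
  have hopen : ∀ b : OddPart (FreeProP p n),
      MeasurableSet {x : OddPart (FreeProP p n) | (b : FreeProP p n)⁻¹ * x ∈ N} := by
    intro b
    have hc : Continuous fun x : OddPart (FreeProP p n) => (b : FreeProP p n)⁻¹ * x := by fun_prop
    exact (hNo.preimage hc).measurableSet
  suffices h : ∀ b : OddPart (FreeProP p n),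
      ν.map f {x | (b : FreeProP p n)⁻¹ * x ∈ N} = ν {g | g * (sigma g)⁻¹ ∈ N} from
    fun b c => (h b).trans (h c).symm
  intro b
  rw [Measure.map_apply hf (hopen b)]
  obtain ⟨k, hk⟩ := exists_pow_mem N hNo (b : FreeProP p n)
  obtain ⟨j, hj⟩ := (hp.out.odd_of_ne_two hp2).pow (n := k)
  rw [hj] at hk
  obtain ⟨b, hb⟩ := b
  dsimp only at hk
  let d : FreeProP p n := b ^ (j + 1)
  have hds : sigma d = d⁻¹ := by
    change sigma (b ^ (j + 1)) = (b ^ (j + 1))⁻¹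
    rw [map_pow, hb, inv_pow]
  have hd2 : b⁻¹ * d * d ∈ N := by
    have : b⁻¹ * d * d = b ^ (2 * j + 1) := by
      change b⁻¹ * b ^ (j + 1) * b ^ (j + 1) = _
      group
    rw [this]
    exact hk
  have hset : f ⁻¹' {x | b⁻¹ * (x : FreeProP p n) ∈ N} =
      (fun g => d⁻¹ * g) ⁻¹' {g | g * (sigma g)⁻¹ ∈ N} := by
    ext g
    change b⁻¹ * (g * (sigma g)⁻¹) ∈ N ↔ d⁻¹ * g * (sigma (d⁻¹ * g))⁻¹ ∈ N
    have h1 : d⁻¹ * g * (sigma (d⁻¹ * g))⁻¹ = d⁻¹ * (g * (sigma g)⁻¹) * d⁻¹ := by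
      rw [map_mul, map_inv, hds]
      group
    have h2 : b⁻¹ * (g * (sigma g)⁻¹) =
        (b⁻¹ * d * d) * (d⁻¹ * (d⁻¹ * (g * (sigma g)⁻¹) * d⁻¹) * d) := by group
    rw [h1, h2, Subgroup.mul_mem_cancel_left N hd2]
    constructor
    · intro h
      have := hN.conj_mem _ h d
      convert this using 1
      group
    · intro h
      have := hN.conj_mem _ h d⁻¹
      convert this using 1
      group
  rw [hset]
  exact measure_preimage_mul ν d⁻¹ _

end FreeProP

open Classical in
/-- The Haar measure on `F_n⁻`. It exists for odd primes `p`, and it is unique because the sets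
`{x | b⁻¹ * x ∈ N}` form a basis of the topology of `F_n⁻`. -/
noncomputable def oddHaar (p n : ℕ) : Measure (OddPart (FreeProP p n)) :=
  if h : ∃ μ : Measure (OddPart (FreeProP p n)), IsOddHaar μ then h.choose else 0

theorem isOddHaar_oddHaar (p n : ℕ) [Fact p.Prime] (hp : p ≠ 2) : IsOddHaar (oddHaar p n) := by
  have h : ∃ μ : Measure (OddPart (FreeProP p n)), IsOddHaar μ :=
    FreeProP.exists_isOddHaar hp
  rw [oddHaar, dif_pos h]
  exact h.choose_spec

/-! ### Weak Schur `σ`-groups and the space `Sch` -/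

/-- `N_r`: the closed normal subgroup of `F_n` generated by all conjugates of `r_1, …, r_n`. -/
def relSubgroup {p n : ℕ} (r : Fin n → OddPart (FreeProP p n)) : Subgroup (FreeProP p n) :=
  (Subgroup.normalClosure (Set.range fun i => (r i : FreeProP p n))).topologicalClosure

instance {p n : ℕ} (r : Fin n → OddPart (FreeProP p n)) : (relSubgroup r).Normal :=
  Subgroup.is_normal_topologicalClosure _

instance {p n : ℕ} (r : Fin n → OddPart (FreeProP p n)) : IsSigmaInvariant (relSubgroup r) where
  sigma_mem := by
    suffices h : relSubgroup r ≤
        (relSubgroup r).comap (sigma (G := FreeProP p n)).toMonoidHom from fun x hx => h hx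
    have hcl : IsClosed ((relSubgroup r : Subgroup _) : Set (FreeProP p n)) :=
      Subgroup.isClosed_topologicalClosure _
    refine Subgroup.topologicalClosure_minimal _ ?_
      (hcl.preimage (sigma (G := FreeProP p n)).continuous_toFun)
    refine Subgroup.normalClosure_le_normal ?_
    rintro _ ⟨i, rfl⟩
    change sigma (r i : FreeProP p n) ∈ relSubgroup r
    rw [(r i).2]
    exact inv_mem (Subgroup.le_topologicalClosure _
      (Subgroup.subset_normalClosure (Set.mem_range_self i)))

/-- `G_r = F_n / N_r`. -/
abbrev SchurGroup {p n : ℕ} (r : Fin n → OddPart (FreeProP p n)) : Type :=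
  FreeProP p n ⧸ relSubgroup r

/-- Weak Schur `σ`-groups: the groups `σ`-isomorphic to some `G_r` with `r ∈ (F_n⁻)ⁿ`. -/
def IsWeakSchur (p : ℕ) (G : Type u) [Group G] [TopologicalSpace G] [SigmaGroup G] : Prop :=
  ∃ (n : ℕ) (r : Fin n → OddPart (FreeProP p n)), Nonempty (SigmaIso G (SchurGroup r))

/-- All tuples of odd relations, for all `n`. -/
abbrev Presentation (p : ℕ) : Type := Σ n : ℕ, Fin n → OddPart (FreeProP p n)

/-- Two presentations are equivalent if they define `σ`-isomorphic groups. -/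
instance presentationSetoid (p : ℕ) : Setoid (Presentation p) where
  r a b := Nonempty (SigmaIso (SchurGroup a.2) (SchurGroup b.2))
  iseqv :=
    { refl := fun _ => ⟨SigmaIso.refl _⟩
      symm := fun ⟨e⟩ => ⟨e.symm⟩
      trans := fun ⟨e⟩ ⟨f⟩ => ⟨e.trans f⟩ }

/-- `Sch`: the set of all groups `G_r` up to `σ`-isomorphism. -/
def Sch (p : ℕ) : Type := Quotient (presentationSetoid p)

/-- The class `[G_r]` in `Sch`. -/
def Sch.mk {p : ℕ} (a : Presentation p) : Sch p := Quotient.mk _ a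

/-- `U_{i,G}` for `G = G_b`: all `[H]` with `H / D_i(H) ≅ G / D_i(G)`. -/
def basicOpen {p : ℕ} (i : ℕ) (b : Presentation p) : Set (Sch p) :=
  {q | ∃ a : Presentation p, Sch.mk a = q ∧
    Nonempty (SigmaIso (SchurGroup a.2 ⧸ zassenhaus p (SchurGroup a.2) i)
      (SchurGroup b.2 ⧸ zassenhaus p (SchurGroup b.2) i))}

/-- The topology on `Sch` with basis the sets `U_{i,G}` for `i ≥ 2`. -/
instance (p : ℕ) : TopologicalSpace (Sch p) :=
  TopologicalSpace.generateFrom {U | ∃ (i : ℕ) (_ : 2 ≤ i) (b : Presentation p), U = basicOpen i b}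

instance (p : ℕ) : MeasurableSpace (Sch p) := borel _

instance (p : ℕ) : BorelSpace (Sch p) := ⟨rfl⟩

/-- `Θ_n : (F_n⁻)ⁿ → Sch`, `r ↦ [G_r]`. -/
def theta (p n : ℕ) (r : Fin n → OddPart (FreeProP p n)) : Sch p := Sch.mk ⟨n, r⟩

/-- `μ_n`: the pushforward under `Θ_n` of the product of the Haar measures on `F_n⁻`. -/
noncomputable def schMeasure (p n : ℕ) : Measure (Sch p) :=
  (Measure.pi fun _ : Fin n => oddHaar p n).map (theta p n)

open Classical in
/-- `μ_∞`: the limit of the measures `μ_n` for `n → ∞`, in the sense of convergence on every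
Borel set; such a limit is unique. -/
noncomputable def schMeasureInf (p : ℕ) : Measure (Sch p) :=
  if h : ∃ μ : Measure (Sch p), ∀ A : Set (Sch p), MeasurableSet A →
      Tendsto (fun n => schMeasure p n A) atTop (𝓝 (μ A))
  then h.choose else 0

/-! ### The constants, and the objects attached to `D` and `G` -/

/-- `C_k = ∏_{i=1}^k (1 - p^{-i})`. -/
noncomputable def constC (p k : ℕ) : ℝ := ∏ i ∈ Finset.Icc 1 k, (1 - ((p : ℝ) ^ i)⁻¹)

/-- `C_∞ = ∏_{i=1}^∞ (1 - p^{-i})`. -/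
noncomputable def constCInf (p : ℕ) : ℝ := ∏' i : ℕ, (1 - ((p : ℝ) ^ (i + 1))⁻¹)

section Invariants

variable {p n : ℕ} (D : Subgroup (FreeProP p n)) [D.Normal]
  {G : Type u} [Group G] [TopologicalSpace G] [SigmaGroup G] (π : SigmaEpi (FreeProP p n) G)

/-- `G_D = G / π(D)`, for a surjective `σ`-homomorphism `π : F_n → G`. -/
abbrev quotD : Type u := G ⧸ π.image D

/-- `m_{D,G}`: the minimal number of generators of `ND/D` as a normal subgroup of `F_n / D`,
where `N` is the kernel of `π : F_n → G`. -/
noncomputable def relRank : ℕ :=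
  minNormalGens (π.toMonoidHom.ker.map (QuotientGroup.mk' D))

/-- `U_{D,G}`: the set of all `[H] ∈ Sch` with `d_H = n` (so that `H_D` is defined) and
`H_D ≅ G_D`. -/
def setUDG [IsSigmaInvariant D] : Set (Sch p) :=
  {q | ∃ a : Presentation p, Sch.mk a = q ∧ minGens (SchurGroup a.2) = n ∧
    ∃ ρ : SigmaEpi (FreeProP p n) (SchurGroup a.2), Nonempty (SigmaIso (quotD D ρ) (quotD D π))}

end Invariants

end SchurSigma

/-!
Everything is computed on the side of presentations. Write `F = F_n`, let `L` be the kernel of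
`F → G_D`, an open normal subgroup that contains `D`, and let `m` be the dimension of the
`𝔽_p`-vector space `V = L / D L^p [L, F]`. Nakayama's lemma for normal subgroups of a pro-`p`-group
(`FreeProP.le_of_le_sup_centralFrattini`) says that elements of `L` generate `L` modulo `D` as a
normal subgroup if and only if their images span `V`. Hence `m = m_{D,G}` (`FreeProP.relRank_eq`),
and `m ≤ n`, as `G` is presented by `n` relations.

Since `V` is spanned by images of odd relations, `σ` acts on it by inversion, and `n` random odd
elements of `L` have independent uniform images in `V`. With `h` the measure of the odd part of
`L`, counting the spanning `n`-tuples of `V` gives `h^n C_n / C_{n-m}` for the probability that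
`N_r D = L` (`FreeProP.measure_relSubgroup_sup_eq`). The group `F` is projective among groups with
involution (`FreeProP.exists_aut_comp_eq`), because odd elements lift to odd elements when `p` is
odd. So `Aut_σ(F)`, which preserves `D` and the Haar measure, acts transitively on the
epimorphisms `F → G_D`, and the probability is the same for all their kernels. The number of these
epimorphisms is `C_n / h^n`, for the preimages of their tuples of values are the generating
`n`-tuples of odd elements of `F` (`FreeProP.card_sigmaEpi_mul`), and each kernel belongs to
`|Aut_σ(G_D)|` of them. Therefore `μ_n(U_{D,G}) = C_n² / (C_{n-m} |Aut_σ(G_D)|)`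
(`FreeProP.card_sigmaAut_mul_measure`).

To pass to `μ_∞`, a relation outside the Frattini subgroup is used to eliminate a generator. This
reduces a random presentation of length `N` to one of some random length `d` with uniform relations
in the Frattini subgroup, which defines a group with exactly `d` generators. The distribution of
`d` is that of the corank of a random `N × N` matrix over `𝔽_p` (`schMeasure_eq_sum`). The limit for
`N → ∞` exists on all Borel sets by dominated convergence, and on sets of groups with `n` generators
it is `C_∞ / C_n²` times `μ_n` (`schMeasureInf_eq`).

The set `U_{D,G}` is open and closed, since the Zassenhaus filtration of `F` eventually lies in
`L^p [L, F]` for the kernels `L` of the finitely many epimorphisms `F → G_D`, and then, again by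
Nakayama's lemma, `H_D ≅ G_D` can be tested on `H / D_i(H)` (`theta_mem_setUDG_of_iso`). Finally, if
`D` lies in the commutator subgroup, then `m = n`, because fewer than `n` relations leave an
infinite abelianization (`FreeProP.le_of_le_closedCommutator`).
-/

set_option linter.unusedSectionVars false

namespace SchurSigma

universe u v w

open SigmaGroup (sigma sigma_sigma)

/-! ### Homomorphisms of groups with an involution -/

section Morphisms

variable {F : Type u} [Group F] [TopologicalSpace F] [SigmaGroup F]
  {A : Type v} [Group A] [TopologicalSpace A] [SigmaGroup A]
  {B : Type w} [Group B] [TopologicalSpace B] [SigmaGroup B]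

theorem SigmaEpi.toMonoidHom_sigma (φ : SigmaEpi F A) (x : F) :
    φ.toMonoidHom (sigma x) = sigma (φ.toMonoidHom x) := φ.map_sigma x

theorem SigmaEpi.continuous (φ : SigmaEpi F A) : Continuous φ.toMonoidHom := φ.continuous_toFun

theorem SigmaEpi.surj (φ : SigmaEpi F A) : Function.Surjective φ.toMonoidHom := φ.surjective

/-- A `σ`-isomorphism as a surjective `σ`-homomorphism. -/
def SigmaIso.toEpi (e : SigmaIso F A) : SigmaEpi F A where
  toMonoidHom := e.toContinuousMulEquiv.toMulEquiv.toMonoidHom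
  continuous_toFun := e.toContinuousMulEquiv.continuous_toFun
  map_sigma := e.map_sigma
  surjective := e.toContinuousMulEquiv.surjective

@[simp] theorem SigmaIso.toEpi_apply (e : SigmaIso F A) (x : F) :
    e.toEpi.toMonoidHom x = e.toContinuousMulEquiv x := rfl

/-- Composition of surjective `σ`-homomorphisms. -/
def SigmaEpi.comp (ψ : SigmaEpi A B) (φ : SigmaEpi F A) : SigmaEpi F B where
  toMonoidHom := ψ.toMonoidHom.comp φ.toMonoidHom
  continuous_toFun := ψ.continuous.comp φ.continuous
  map_sigma x := by
    change ψ.toMonoidHom (φ.toMonoidHom (sigma x)) = sigma (ψ.toMonoidHom (φ.toMonoidHom x))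
    rw [φ.toMonoidHom_sigma, ψ.toMonoidHom_sigma]
  surjective := ψ.surj.comp φ.surj

@[simp] theorem SigmaEpi.comp_apply (ψ : SigmaEpi A B) (φ : SigmaEpi F A) (x : F) :
    (ψ.comp φ).toMonoidHom x = ψ.toMonoidHom (φ.toMonoidHom x) := rfl

theorem SigmaEpi.ker_comp (ψ : SigmaEpi A B) (φ : SigmaEpi F A) :
    (ψ.comp φ).toMonoidHom.ker = ψ.toMonoidHom.ker.comap φ.toMonoidHom := rfl

theorem SigmaEpi.ker_iso_comp (e : SigmaIso A B) (φ : SigmaEpi F A) :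
    (e.toEpi.comp φ).toMonoidHom.ker = φ.toMonoidHom.ker := by
  ext x
  exact map_eq_one_iff e.toContinuousMulEquiv e.toContinuousMulEquiv.injective

theorem SigmaEpi.ext {φ ψ : SigmaEpi F A} (h : ∀ x, φ.toMonoidHom x = ψ.toMonoidHom x) :
    φ = ψ := by
  obtain ⟨⟨⟨⟨f, _⟩, _⟩, _⟩, _, _⟩ := φ
  obtain ⟨⟨⟨⟨g, _⟩, _⟩, _⟩, _, _⟩ := ψ
  have : f = g := funext h
  subst this
  rfl

theorem SigmaIso.ext {e f : SigmaIso F A}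
    (h : ∀ x, e.toContinuousMulEquiv x = f.toContinuousMulEquiv x) : e = f := by
  obtain ⟨e, _⟩ := e
  obtain ⟨f, _⟩ := f
  have : e = f := ContinuousMulEquiv.ext h
  subst this
  rfl

instance SigmaEpi.isSigmaInvariant_ker (φ : SigmaEpi F A) :
    IsSigmaInvariant φ.toMonoidHom.ker where
  sigma_mem x hx := by
    rw [MonoidHom.mem_ker] at hx ⊢
    rw [φ.toMonoidHom_sigma, hx, map_one]

/-- The projection to the quotient by a `σ`-invariant normal subgroup. -/
def mkEpi (N : Subgroup F) [N.Normal] [IsSigmaInvariant N] : SigmaEpi F (F ⧸ N) where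
  toMonoidHom := QuotientGroup.mk' N
  continuous_toFun := QuotientGroup.continuous_mk
  map_sigma _ := rfl
  surjective := QuotientGroup.mk_surjective

theorem ker_mkEpi (N : Subgroup F) [N.Normal] [IsSigmaInvariant N] :
    (mkEpi N).toMonoidHom.ker = N := QuotientGroup.ker_mk' N

/-- The kernel of `F → G → G / π(D)`. -/
theorem ker_mkEpi_image_comp (π : SigmaEpi F A) (D : Subgroup F) [D.Normal]
    [IsSigmaInvariant D] :
    ((mkEpi (π.image D)).comp π).toMonoidHom.ker = π.toMonoidHom.ker ⊔ D := by
  rw [SigmaEpi.ker_comp, ker_mkEpi, SigmaEpi.image, Subgroup.comap_map_eq, sup_comm]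

/-- A surjective `σ`-homomorphism from a compact group to a Hausdorff group is determined up to
`σ`-isomorphism by its kernel. -/
theorem SigmaEpi.exists_iso_of_ker_eq [CompactSpace F] [T2Space A] [T2Space B]
    (φ : SigmaEpi F A) (ψ : SigmaEpi F B) (h : φ.toMonoidHom.ker = ψ.toMonoidHom.ker) :
    ∃ e : SigmaIso A B, ∀ x, e.toContinuousMulEquiv (φ.toMonoidHom x) = ψ.toMonoidHom x := by
  let e₀ : A ≃* B := (QuotientGroup.quotientKerEquivOfSurjective φ.toMonoidHom φ.surj).symm.trans
    ((QuotientGroup.quotientMulEquivOfEq h).trans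
      (QuotientGroup.quotientKerEquivOfSurjective ψ.toMonoidHom ψ.surj))
  have key : ∀ x, e₀ (φ.toMonoidHom x) = ψ.toMonoidHom x := by
    intro x
    have : (QuotientGroup.quotientKerEquivOfSurjective φ.toMonoidHom φ.surj).symm
        (φ.toMonoidHom x) = (x : F ⧸ φ.toMonoidHom.ker) := by
      rw [MulEquiv.symm_apply_eq]; rfl
    change (QuotientGroup.quotientKerEquivOfSurjective ψ.toMonoidHom ψ.surj)
      ((QuotientGroup.quotientMulEquivOfEq h)
        ((QuotientGroup.quotientKerEquivOfSurjective φ.toMonoidHom φ.surj).symm _)) = _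
    rw [this]
    rfl
  have key' : ∀ x, e₀.symm (ψ.toMonoidHom x) = φ.toMonoidHom x := fun x => by
    rw [← key, MulEquiv.symm_apply_apply]
  have hφ : IsQuotientMap φ.toMonoidHom :=
    φ.continuous.isClosedMap.isQuotientMap φ.continuous φ.surj
  have hψ : IsQuotientMap ψ.toMonoidHom :=
    ψ.continuous.isClosedMap.isQuotientMap ψ.continuous ψ.surj
  refine ⟨{ toMulEquiv := e₀, continuous_toFun := ?_, continuous_invFun := ?_, map_sigma := ?_ },
    key⟩
  · change Continuous e₀
    rw [hφ.continuous_iff]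
    exact ψ.continuous.congr fun x => (key x).symm
  · change Continuous e₀.symm
    rw [hψ.continuous_iff]
    exact φ.continuous.congr fun x => (key' x).symm
  · intro a
    change e₀ (sigma a) = sigma (e₀ a)
    obtain ⟨x, rfl⟩ := φ.surj a
    rw [← φ.toMonoidHom_sigma, key, key, ψ.toMonoidHom_sigma]

end Morphisms

/-! ### Central Frattini subgroups, central chains and the Zassenhaus filtration -/

section CentralFrattini

theorem mem_of_mem_sup_of_normal {G : Type u} [Group G] {K L : Subgroup G} [L.Normal] {x : G}
    (h : x ∈ K ⊔ L) :
    ∃ k ∈ K, ∃ l ∈ L, x = k * l := by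
  rw [Subgroup.mem_sup_of_normal_right] at h
  obtain ⟨k, hk, l, hl, rfl⟩ := h
  exact ⟨k, hk, l, hl, rfl⟩

variable (p : ℕ) {G : Type u} [Group G] [TopologicalSpace G] [IsTopologicalGroup G]
  {H : Type v} [Group H] [TopologicalSpace H] [IsTopologicalGroup H]

/-- The closed subgroup `L^p [L, G]`. For normal `L`, it is the smallest closed subgroup `K` such
that `L / K` is central in `G / K` and of exponent dividing `p`. -/
def centralFrattini (L : Subgroup G) : Subgroup G :=
  (Subgroup.closure ({g | ∃ x ∈ L, g = x ^ p} ∪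
    {g | ∃ x ∈ L, ∃ y, g = x * y * x⁻¹ * y⁻¹})).topologicalClosure

variable {p}

theorem isClosed_centralFrattini (L : Subgroup G) :
    IsClosed (centralFrattini p L : Set G) := Subgroup.isClosed_topologicalClosure _

theorem pow_mem_centralFrattini {L : Subgroup G} {x : G} (hx : x ∈ L) :
    x ^ p ∈ centralFrattini p L :=
  Subgroup.le_topologicalClosure _ (Subgroup.subset_closure (Or.inl ⟨x, hx, rfl⟩))

theorem commutator_mem_centralFrattini {L : Subgroup G} {x : G} (hx : x ∈ L) (y : G) :
    x * y * x⁻¹ * y⁻¹ ∈ centralFrattini p L :=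
  Subgroup.le_topologicalClosure _ (Subgroup.subset_closure (Or.inr ⟨x, hx, y, rfl⟩))

theorem centralFrattini_le {L K : Subgroup G} (hK : IsClosed (K : Set G))
    (h1 : ∀ x ∈ L, x ^ p ∈ K) (h2 : ∀ x ∈ L, ∀ y, x * y * x⁻¹ * y⁻¹ ∈ K) :
    centralFrattini p L ≤ K := by
  refine Subgroup.topologicalClosure_minimal _ ?_ hK
  rw [Subgroup.closure_le]
  rintro g (⟨x, hx, rfl⟩ | ⟨x, hx, y, rfl⟩)
  · exact h1 x hx
  · exact h2 x hx y

theorem centralFrattini_le_self {L : Subgroup G} [hn : L.Normal] (hL : IsClosed (L : Set G)) :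
    centralFrattini p L ≤ L := by
  refine centralFrattini_le hL (fun x hx => pow_mem hx p) fun x hx y => ?_
  have := L.mul_mem hx (hn.conj_mem _ (L.inv_mem hx) y)
  rwa [← mul_assoc, ← mul_assoc] at this

theorem centralFrattini_le_comap (f : G →* H) (hf : Continuous f) {L : Subgroup G}
    {L' : Subgroup H} (h : L ≤ L'.comap f) :
    centralFrattini p L ≤ (centralFrattini p L').comap f := by
  refine centralFrattini_le ((isClosed_centralFrattini L').preimage hf) (fun x hx => ?_)
    fun x hx y => ?_
  · rw [Subgroup.mem_comap, map_pow]
    exact pow_mem_centralFrattini (h hx)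
  · simp only [Subgroup.mem_comap, map_mul, map_inv]
    exact commutator_mem_centralFrattini (L := L') (h hx) _

instance centralFrattini_normal (L : Subgroup G) [hL : L.Normal] :
    (centralFrattini p L).Normal where
  conj_mem x hx g := by
    refine centralFrattini_le_comap (L := L) (L' := L) (MulAut.conj g).toMonoidHom ?_ ?_ hx
    · change Continuous fun x => g * x * g⁻¹
      fun_prop
    · intro y hy
      exact hL.conj_mem y hy g

instance centralFrattini_sigmaInvariant [SigmaGroup G] (L : Subgroup G)
    [hL : IsSigmaInvariant L] : IsSigmaInvariant (centralFrattini p L) where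
  sigma_mem _ hx := centralFrattini_le_comap (L := L) (L' := L)
    (sigma (G := G)).toMonoidHom (sigma (G := G)).continuous_toFun
    (fun y hy => hL.sigma_mem y hy) hx

theorem proFrattini_eq : proFrattini p G = centralFrattini p ⊤ := by
  simp [proFrattini, centralFrattini]

theorem isClosed_proFrattini : IsClosed (proFrattini p G : Set G) :=
  Subgroup.isClosed_topologicalClosure _

instance proFrattini_normal : (proFrattini p G).Normal := by
  rw [proFrattini_eq]; infer_instance

instance top_sigmaInvariant [SigmaGroup G] : IsSigmaInvariant (⊤ : Subgroup G) :=
  ⟨fun _ _ => Subgroup.mem_top _⟩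

instance proFrattini_sigmaInvariant [SigmaGroup G] :
    IsSigmaInvariant (proFrattini p G) := by
  rw [proFrattini_eq]; infer_instance

theorem proFrattini_le_comap (f : G →* H) (hf : Continuous f) :
    proFrattini p G ≤ (proFrattini p H).comap f := by
  rw [proFrattini_eq, proFrattini_eq]
  exact centralFrattini_le_comap f hf le_top

variable (p) in
/-- `CentralChain p M`: there is a chain of normal subgroups from `G` down to `M` in which every
factor `M' / M''` is central in `G / M''` and of exponent dividing `p`. -/
inductive CentralChain {G : Type u} [Group G] : Subgroup G → Prop
  | top : CentralChain ⊤
  | step {M' M : Subgroup G} : CentralChain M' → M.Normal → M ≤ M' →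
      (∀ x ∈ M', x ^ p ∈ M) → (∀ x ∈ M', ∀ y, x * y * x⁻¹ * y⁻¹ ∈ M) → CentralChain M

theorem CentralChain.normal {G : Type u} [Group G] {M : Subgroup G} (h : CentralChain p M) :
    M.Normal := by
  cases h with
  | top => infer_instance
  | step _ h _ _ _ => exact h

/-- A normal subgroup whose quotient is a finite `p`-group is the end of a central chain, since the
centre of a nontrivial finite `p`-group is nontrivial. -/
theorem CentralChain.of_isPGroup {G : Type u} [Group G] [hp : Fact p.Prime] (M : Subgroup G)
    [M.Normal] [Finite (G ⧸ M)] (h : IsPGroup p (G ⧸ M)) : CentralChain p M := by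
  induction hk : M.index using Nat.strong_induction_on generalizing M with
  | _ k ih =>
  by_cases htop : M = ⊤
  · rw [htop]; exact .top
  have hnt : Nontrivial (G ⧸ M) := by
    rw [QuotientGroup.nontrivial_iff]; exact htop
  have hc := h.center_nontrivial
  obtain ⟨z, hz1⟩ := exists_ne (1 : Subgroup.center (G ⧸ M))
  -- a power of `z` is central of order `p`
  obtain ⟨c, hcc, hcp, hc1⟩ : ∃ c ∈ Subgroup.center (G ⧸ M), c ^ p = 1 ∧ c ≠ 1 := by
    obtain ⟨k, hk⟩ := (h.to_subgroup (Subgroup.center (G ⧸ M))) z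
    classical
    have hex : ∃ k, z ^ p ^ k = 1 := ⟨k, hk⟩
    have h0 : Nat.find hex ≠ 0 := by
      intro h0
      have := Nat.find_spec hex
      rw [h0, pow_zero, pow_one] at this
      exact hz1 this
    obtain ⟨j, hj⟩ := Nat.exists_eq_succ_of_ne_zero h0
    refine ⟨(z ^ p ^ j : Subgroup.center (G ⧸ M)), (z ^ p ^ j).2, ?_, ?_⟩
    · have := Nat.find_spec hex
      rw [hj, pow_succ, pow_mul] at this
      exact congrArg Subtype.val this
    · intro h1
      exact Nat.find_min hex (m := j) (by omega) (Subtype.ext h1)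
  have hZle : Subgroup.zpowers c ≤ Subgroup.center (G ⧸ M) := by
    rw [Subgroup.zpowers_le]; exact hcc
  have hZn : (Subgroup.zpowers c).Normal := ⟨fun x hx g => by
    have := Subgroup.mem_center_iff.mp (hZle hx) g
    rwa [this, mul_inv_cancel_right]⟩
  let M' : Subgroup G := (Subgroup.zpowers c).comap (QuotientGroup.mk' M)
  have hMM' : M ≤ M' := fun x hx => by
    change QuotientGroup.mk' M x ∈ Subgroup.zpowers c
    rw [(QuotientGroup.eq_one_iff x).mpr hx |> (show QuotientGroup.mk' M x = 1 from ·)]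
    exact one_mem _
  have hM'n : M'.Normal := hZn.comap _
  have hfi : M.FiniteIndex := Subgroup.finiteIndex_of_finite_quotient
  have hfi' : M'.FiniteIndex := Subgroup.finiteIndex_of_le hMM'
  have hlt : M < M' := by
    refine lt_of_le_of_ne hMM' fun heq => ?_
    obtain ⟨g, rfl⟩ := QuotientGroup.mk_surjective c
    have : g ∈ M' := Subgroup.mem_zpowers _
    rw [← heq] at this
    exact hc1 ((QuotientGroup.eq_one_iff g).mpr this)
  have hfin' : Finite (G ⧸ M') := Subgroup.finite_quotient_of_finiteIndex
  have hchain : CentralChain p M' := by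
    refine ih M'.index ?_ M' (h.of_surjective (QuotientGroup.map M M' (MonoidHom.id G) hMM') ?_) rfl
    · rw [← hk]; exact Subgroup.index_strictAnti hlt
    · intro x
      obtain ⟨g, rfl⟩ := QuotientGroup.mk_surjective x
      exact ⟨g, rfl⟩
  refine .step hchain inferInstance hMM' (fun x hx => ?_) fun x hx y => ?_
  · rw [← QuotientGroup.eq_one_iff]
    obtain ⟨j, hj⟩ := Subgroup.mem_zpowers_iff.mp (show (x : G ⧸ M) ∈ _ from hx)
    rw [QuotientGroup.mk_pow, ← hj, ← zpow_natCast, zpow_comm, zpow_natCast, hcp, one_zpow]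
  · rw [← QuotientGroup.eq_one_iff]
    have := Subgroup.mem_center_iff.mp (hZle (show (x : G ⧸ M) ∈ _ from hx)) y
    rw [QuotientGroup.mk_mul, QuotientGroup.mk_mul, QuotientGroup.mk_mul, ← this,
      QuotientGroup.mk_inv, QuotientGroup.mk_inv, mul_inv_cancel_right, mul_inv_cancel]

/-- Induction along a central chain: if `L ≤ N · L^p [L, G]`, then `L ≤ N M` for every `M` at the
end of a central chain. -/
theorem CentralChain.le_sup {M : Subgroup G} (hM : CentralChain p M) (hMo : IsOpen (M : Set G))
    {N L : Subgroup G} [N.Normal] (h : L ≤ N ⊔ centralFrattini p L) : L ≤ N ⊔ M := by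
  induction hM with
  | top => simp
  | @step M' M hM' hn hle hp hc ih =>
    have hL := ih (Subgroup.isOpen_mono hle hMo)
    have hn' := hM'.normal
    have hopen : IsOpen ((N ⊔ M : Subgroup G) : Set G) := Subgroup.isOpen_mono le_sup_right hMo
    refine h.trans (sup_le le_sup_left ?_)
    have hq : ∀ x ∈ L, ∃ y ∈ M', (x : G ⧸ (N ⊔ M)) = y := by
      intro x hx
      obtain ⟨a, ha, b, hb, rfl⟩ := mem_of_mem_sup_of_normal (hL hx)
      refine ⟨b, hb, ?_⟩
      rw [QuotientGroup.mk_mul,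
        (QuotientGroup.eq_one_iff a).mpr ((le_sup_left : N ≤ N ⊔ M) ha), one_mul]
    refine centralFrattini_le (Subgroup.isClosed_of_isOpen _ hopen) (fun x hx => ?_)
      fun x hx y => ?_
    · obtain ⟨b, hb, hxb⟩ := hq x hx
      rw [← QuotientGroup.eq_one_iff, QuotientGroup.mk_pow, hxb, ← QuotientGroup.mk_pow,
        QuotientGroup.eq_one_iff]
      exact (le_sup_right : M ≤ N ⊔ M) (hp b hb)
    · obtain ⟨b, hb, hxb⟩ := hq x hx
      rw [← QuotientGroup.eq_one_iff]
      have := (QuotientGroup.eq_one_iff _).mpr ((le_sup_right : M ≤ N ⊔ M) (hc b hb y))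
      simpa [hxb] using this

/-- A subgroup that generates `G` modulo the Frattini subgroup generates `G` modulo the end of
every open central chain. -/
theorem CentralChain.sup_eq_top {M : Subgroup G} (hM : CentralChain p M)
    (hMo : IsOpen (M : Set G)) {K : Subgroup G} (h : K ⊔ proFrattini p G = ⊤) : K ⊔ M = ⊤ := by
  induction hM with
  | top => simp
  | @step M' M hM' hn hle hp hc ih =>
    have hK := ih (Subgroup.isOpen_mono hle hMo)
    have hn' := hM'.normal
    have hopen : IsOpen ((K ⊔ M : Subgroup G) : Set G) := Subgroup.isOpen_mono le_sup_right hMo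
    have hMK : M ≤ K ⊔ M := le_sup_right
    -- `K M` is normalized by `K` and, as `M' / M` is central, by `M'`
    have hnorm : (K ⊔ M).Normal := by
      rw [← Subgroup.normalizer_eq_top_iff, eq_top_iff, ← hK]
      refine sup_le (le_sup_left.trans Subgroup.le_normalizer) fun x hx => ?_
      rw [Subgroup.mem_normalizer_iff]
      have key : ∀ y, x * y * x⁻¹ = (x * y * x⁻¹ * y⁻¹) * y := fun y => by group
      intro y
      rw [key, Subgroup.mul_mem_cancel_left _ (hMK (hc x hx y))]
    rw [eq_top_iff, ← h]
    refine sup_le le_sup_left ?_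
    have hq : ∀ x : G, ∃ y ∈ M', (x : G ⧸ (K ⊔ M)) = y := by
      intro x
      obtain ⟨a, ha, b, hb, rfl⟩ :=
        mem_of_mem_sup_of_normal (show x ∈ K ⊔ M' from hK ▸ Subgroup.mem_top x)
      refine ⟨b, hb, ?_⟩
      rw [QuotientGroup.mk_mul,
        (QuotientGroup.eq_one_iff a).mpr ((le_sup_left : K ≤ K ⊔ M) ha), one_mul]
    rw [proFrattini_eq]
    refine centralFrattini_le (Subgroup.isClosed_of_isOpen _ hopen) (fun x _ => ?_)
      fun x _ y => ?_
    · obtain ⟨b, hb, hxb⟩ := hq x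
      rw [← QuotientGroup.eq_one_iff, QuotientGroup.mk_pow, hxb, ← QuotientGroup.mk_pow,
        QuotientGroup.eq_one_iff]
      exact hMK (hp b hb)
    · obtain ⟨b, hb, hxb⟩ := hq x
      rw [← QuotientGroup.eq_one_iff]
      have := (QuotientGroup.eq_one_iff _).mpr (hMK (hc b hb y))
      simpa [hxb] using this

theorem isClosed_zassenhaus (i : ℕ) : IsClosed (zassenhaus p G i : Set G) := by
  rw [zassenhaus]
  split_ifs
  · exact isClosed_univ
  · exact Subgroup.isClosed_topologicalClosure _

theorem zassenhaus_of_le_one {i : ℕ} (hi : i ≤ 1) : zassenhaus p G i = ⊤ := by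
  rw [zassenhaus, if_pos hi]

theorem pow_mem_zassenhaus {i k : ℕ} (hk : k < i) (hik : i ≤ p * k) {x : G}
    (hx : x ∈ zassenhaus p G k) : x ^ p ∈ zassenhaus p G i := by
  rw [zassenhaus]
  split_ifs
  · exact Subgroup.mem_top _
  · exact Subgroup.le_topologicalClosure _
      (Subgroup.subset_closure (Or.inl ⟨k, hk, hik, x, hx, rfl⟩))

theorem commutator_mem_zassenhaus {i j : ℕ} (hj : 0 < j) (hji : j < i) {x y : G}
    (hx : x ∈ zassenhaus p G j) (hy : y ∈ zassenhaus p G (i - j)) :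
    x * y * x⁻¹ * y⁻¹ ∈ zassenhaus p G i := by
  rw [zassenhaus]
  split_ifs
  · exact Subgroup.mem_top _
  · exact Subgroup.le_topologicalClosure _
      (Subgroup.subset_closure (Or.inr ⟨j, hj, hji, x, hx, y, hy, rfl⟩))

theorem zassenhaus_le {i : ℕ} (hi : 1 < i) {K : Subgroup G} (hK : IsClosed (K : Set G))
    (h1 : ∀ k, k < i → i ≤ p * k → ∀ x ∈ zassenhaus p G k, x ^ p ∈ K)
    (h2 : ∀ j, 0 < j → j < i → ∀ x ∈ zassenhaus p G j, ∀ y ∈ zassenhaus p G (i - j),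
      x * y * x⁻¹ * y⁻¹ ∈ K) : zassenhaus p G i ≤ K := by
  rw [zassenhaus, if_neg (by omega)]
  refine Subgroup.topologicalClosure_minimal _ ?_ hK
  rw [Subgroup.closure_le]
  rintro g (⟨k, hk, hik, x, hx, rfl⟩ | ⟨j, hj, hji, x, hx, y, hy, rfl⟩)
  · exact h1 k hk hik x hx
  · exact h2 j hj hji x hx y hy

theorem zassenhaus_le_proFrattini {i : ℕ} (hi : 2 ≤ i) : zassenhaus p G i ≤ proFrattini p G := by
  rw [proFrattini_eq]
  exact zassenhaus_le hi (isClosed_centralFrattini _)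
    (fun _ _ _ x _ => pow_mem_centralFrattini (Subgroup.mem_top x))
    fun _ _ _ x _ y _ => commutator_mem_centralFrattini (Subgroup.mem_top x) y

theorem centralFrattini_zassenhaus_le (hp : 2 ≤ p) {i : ℕ} (hi : 1 ≤ i) :
    centralFrattini p (zassenhaus p G i) ≤ zassenhaus p G (i + 1) := by
  refine centralFrattini_le (isClosed_zassenhaus _) (fun x hx => ?_) fun x hx y => ?_
  · exact pow_mem_zassenhaus (Nat.lt_succ_self i) (by nlinarith) hx
  · refine commutator_mem_zassenhaus hi (Nat.lt_succ_self i) hx ?_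
    rw [zassenhaus_of_le_one (by omega)]
    exact Subgroup.mem_top _

/-- The Zassenhaus filtration eventually lies in the end of every open central chain. -/
theorem CentralChain.exists_zassenhaus_le {M : Subgroup G} (hM : CentralChain p M)
    (hMo : IsOpen (M : Set G)) : ∃ e, ∀ i, e ≤ i → zassenhaus p G i ≤ M := by
  induction hM with
  | top => exact ⟨0, fun i _ => le_top⟩
  | @step M' M hM' hn hle hp hc ih =>
    obtain ⟨e, he⟩ := ih (Subgroup.isOpen_mono hle hMo)
    refine ⟨p * e + 2 * e + 2, fun i hi => zassenhaus_le (by omega)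
      (Subgroup.isClosed_of_isOpen _ hMo) (fun k _ hik x hx => ?_) fun j hj hji x hx y hy => ?_⟩
    · refine hp x (he k ?_ hx)
      by_contra! hlt
      have : p * k ≤ p * e := Nat.mul_le_mul_left p hlt.le
      omega
    · by_cases hje : e ≤ j
      · exact hc x (he j hje hx) y
      · have h := M.inv_mem (hc y (he (i - j) (by omega) hy) x)
        simpa [mul_assoc] using h

variable (p) in
/-- The Zassenhaus filtration commutes with quotients of compact groups. -/
theorem zassenhaus_map_eq [CompactSpace G] [T2Space H] (f : G →* H) (hf : Continuous f)
    (hs : Function.Surjective f) (i : ℕ) :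
    (zassenhaus p G i).map f = zassenhaus p H i := by
  induction i using Nat.strong_induction_on with
  | _ i ih =>
  by_cases hi : i ≤ 1
  · rw [zassenhaus_of_le_one hi, zassenhaus_of_le_one hi, Subgroup.map_top_of_surjective f hs]
  · apply le_antisymm
    · rw [Subgroup.map_le_iff_le_comap]
      refine zassenhaus_le (by omega) ((isClosed_zassenhaus i).preimage hf)
        (fun k hk hik x hx => ?_) fun j hj hji x hx y hy => ?_
      · rw [Subgroup.mem_comap, map_pow]
        exact pow_mem_zassenhaus hk hik (ih k hk ▸ Subgroup.mem_map_of_mem f hx)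
      · simp only [Subgroup.mem_comap, map_mul, map_inv]
        exact commutator_mem_zassenhaus hj hji (ih j hji ▸ Subgroup.mem_map_of_mem f hx)
          (ih (i - j) (by omega) ▸ Subgroup.mem_map_of_mem f hy)
    · refine zassenhaus_le (by omega)
        ((isClosed_zassenhaus i).isCompact.image hf).isClosed
        (fun k hk hik x hx => ?_) fun j hj hji x hx y hy => ?_
      · rw [← ih k hk] at hx
        obtain ⟨x, hx, rfl⟩ := hx
        exact ⟨x ^ p, pow_mem_zassenhaus hk hik hx, map_pow f x p⟩
      · rw [← ih j hji] at hx
        rw [← ih (i - j) (by omega)] at hy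
        obtain ⟨x, hx, rfl⟩ := hx
        obtain ⟨y, hy, rfl⟩ := hy
        exact ⟨_, commutator_mem_zassenhaus hj hji hx hy, by simp⟩

end CentralFrattini

/-! ### The free pro-`p`-group: density, universal property, bases of neighbourhoods -/

namespace FreeProP

variable {p n m : ℕ}

theorem exists_pow_mem_of_index {G : Type u} [Group G] {N : Subgroup G} [hN : N.Normal] {k : ℕ}
    (h : N.index = p ^ k) (x : G) : x ^ p ^ k ∈ N := by
  rw [← QuotientGroup.eq_one_iff, QuotientGroup.mk_pow, ← h]
  exact pow_card_eq_one'

theorem continuous_proj (N : PowIndex p n) : Continuous (proj N) :=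
  (continuous_apply N).comp continuous_subtype_val

theorem continuous_trans {M N : PowIndex p n} (h : M.1 ≤ N.1) : Continuous (Stage.trans h) :=
  continuous_of_discreteTopology

variable [hp : Fact p.Prime]

theorem exists_index_eq_pow {G : Type u} [Group G] (N : Subgroup G) [N.Normal] [N.FiniteIndex]
    (h : ∀ x, ∃ k, x ^ p ^ k ∈ N) : ∃ k, N.index = p ^ k := by
  have : Finite (G ⧸ N) := Subgroup.finite_quotient_of_finiteIndex
  refine IsPGroup.iff_card.mp fun q => ?_
  obtain ⟨x, rfl⟩ := QuotientGroup.mk_surjective q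
  obtain ⟨k, hk⟩ := h x
  exact ⟨k, by rwa [← QuotientGroup.mk_pow, QuotientGroup.eq_one_iff]⟩

theorem powIndex_finiteIndex (N : PowIndex p n) : N.1.FiniteIndex := by
  obtain ⟨k, hk⟩ := N.2.2
  exact ⟨by rw [hk]; exact pow_ne_zero k hp.out.ne_zero⟩

/-- The inverse system of the finite quotients is directed. -/
theorem exists_powIndex_le (I : Finset (PowIndex p n)) :
    ∃ M : PowIndex p n, ∀ N ∈ I, M.1 ≤ N.1 := by
  classical
  induction I using Finset.induction_on with
  | empty => exact ⟨⟨⊤, inferInstance, 0, by simp⟩, by simp⟩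
  | insert N I _ ih =>
    obtain ⟨M, hM⟩ := ih
    have := powIndex_finiteIndex M
    have := powIndex_finiteIndex N
    obtain ⟨k, hk⟩ := M.2.2
    obtain ⟨l, hl⟩ := N.2.2
    refine ⟨⟨M.1 ⊓ N.1, inferInstance, exists_index_eq_pow _ fun x => ⟨k + l, ?_, ?_⟩⟩, ?_⟩
    · rw [pow_add, pow_mul]
      exact pow_mem (exists_pow_mem_of_index hk x) _
    · rw [pow_add, mul_comm, pow_mul]
      exact pow_mem (exists_pow_mem_of_index hl x) _
    · intro K hK
      rcases Finset.mem_insert.mp hK with rfl | hK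
      · exact inf_le_right
      · exact inf_le_left.trans (hM K hK)

theorem denseRange_ofFree : DenseRange (ofFree : FreeGroup (Fin n) → FreeProP p n) := by
  rw [DenseRange, dense_iff_inter_open]
  rintro U hU ⟨x, hx⟩
  obtain ⟨V, hV, rfl⟩ := isOpen_induced_iff.mp hU
  obtain ⟨I, u, hu, hsub⟩ := isOpen_pi_iff.mp hV x.1 hx
  obtain ⟨M, hM⟩ := exists_powIndex_le I
  obtain ⟨w, hw⟩ := QuotientGroup.mk_surjective (x.1 M)
  refine ⟨ofFree w, hsub fun N hN => ?_, w, rfl⟩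
  have : (ofFree w : FreeProP p n).1 N = x.1 N := by
    rw [← x.2 M N (hM N hN), ← hw]
    rfl
  rw [this]
  exact (hu N hN).2

/-- A continuous homomorphism from `F_n` is determined by the images of the generators. -/
theorem hom_ext {A : Type u} [Group A] [TopologicalSpace A] [T2Space A] {f g : FreeProP p n →* A}
    (hf : Continuous f) (hg : Continuous g) (h : ∀ i, f (gen i) = g (gen i)) : f = g := by
  have h1 : f.comp ofFree = g.comp ofFree := FreeGroup.ext_hom _ _ h
  refine DFunLike.coe_injective (denseRange_ofFree.equalizer hf hg ?_)
  exact funext fun w => DFunLike.congr_fun h1 w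

/-- A closed subgroup that contains the generators is everything. -/
theorem eq_top_of_gen_mem {K : Subgroup (FreeProP p n)} (hK : IsClosed (K : Set (FreeProP p n)))
    (h : ∀ i, gen i ∈ K) : K = ⊤ := by
  have h1 : K.comap ofFree = ⊤ := by
    rw [eq_top_iff, ← FreeGroup.closure_range_of, Subgroup.closure_le]
    rintro _ ⟨i, rfl⟩
    exact h i
  rw [Subgroup.eq_top_iff']
  intro x
  have : Set.range (ofFree : FreeGroup (Fin n) → FreeProP p n) ⊆ K := by
    rintro _ ⟨w, rfl⟩
    exact (h1 ▸ Subgroup.mem_top w : w ∈ K.comap ofFree)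
  exact closure_minimal this hK (denseRange_ofFree x)

/-- The universal property of `F_n` for finite `p`-groups. -/
theorem exists_lift_finite {Q : Type u} [Group Q] [TopologicalSpace Q] [Finite Q]
    (hQ : IsPGroup p Q) (y : Fin n → Q) :
    ∃ f : FreeProP p n →* Q, Continuous f ∧ ∀ i, f (gen i) = y i := by
  let g : FreeGroup (Fin n) →* Q := FreeGroup.lift y
  have hfi : g.ker.FiniteIndex := inferInstance
  let N : PowIndex p n := ⟨g.ker, inferInstance, exists_index_eq_pow _ fun x => by
    obtain ⟨k, hk⟩ := hQ (g x)
    exact ⟨k, by rw [MonoidHom.mem_ker, map_pow, hk]⟩⟩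
  let f : Stage N →* Q := QuotientGroup.kerLift g
  have hfc : Continuous f := continuous_of_discreteTopology
  refine ⟨f.comp (proj N), hfc.comp (continuous_proj N), fun i => ?_⟩
  change g (FreeGroup.of i) = _
  exact FreeGroup.lift_apply_of

theorem isPGroup_stage (N : PowIndex p n) : IsPGroup p (Stage N) :=
  IsPGroup.iff_card.mpr N.2.2

/-- The universal property of `F_n` for free pro-`p`-groups as targets. -/
theorem exists_lift (y : Fin n → FreeProP p m) :
    ∃ f : FreeProP p n →* FreeProP p m, Continuous f ∧ ∀ i, f (gen i) = y i := by
  choose f hf hfy using fun N : PowIndex p m =>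
    exists_lift_finite (isPGroup_stage N) (fun i => proj N (y i))
  have compat : ∀ (M N : PowIndex p m) (h : M.1 ≤ N.1), (Stage.trans h).comp (f M) = f N := by
    intro M N h
    refine hom_ext ((continuous_trans h).comp (hf M)) (hf N) fun i => ?_
    rw [MonoidHom.comp_apply, hfy, hfy]
    exact (y i).2 M N h
  refine ⟨{ toFun := fun x => ⟨fun N => f N x, fun M N h => DFunLike.congr_fun (compat M N h) x⟩
            map_one' := Subtype.ext (funext fun N => map_one (f N))
            map_mul' := fun x z => Subtype.ext (funext fun N => map_mul (f N) x z) }, ?_, ?_⟩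
  · exact Continuous.subtype_mk (continuous_pi fun N => hf N) _
  · exact fun i => Subtype.ext (funext fun N => hfy N i)

/-- A homomorphism from `F_n` that maps the generators to odd elements is `σ`-equivariant. -/
theorem map_sigma_of_odd {A : Type u} [Group A] [TopologicalSpace A] [SigmaGroup A] [T2Space A]
    {f : FreeProP p n →* A} (hf : Continuous f) (h : ∀ i, sigma (f (gen i)) = (f (gen i))⁻¹)
    (x : FreeProP p n) : f (sigma x) = sigma (f x) := by
  have key : f.comp (sigma (G := FreeProP p n)).toMonoidHom =
      (sigma (G := A)).toMonoidHom.comp f := by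
    refine hom_ext (hf.comp (sigma (G := FreeProP p n)).continuous_toFun)
      ((sigma (G := A)).continuous_toFun.comp hf) fun i => ?_
    change f (sigma (gen i)) = sigma (f (gen i))
    rw [sigma_gen, map_inv, h]
  exact DFunLike.congr_fun key x

/-- Free pro-`p`-groups of finite rank are Hopfian. -/
theorem injective_of_surjective {f : FreeProP p n →* FreeProP p n} (hf : Continuous f)
    (hs : Function.Surjective f) : Function.Injective f := by
  rw [← MonoidHom.ker_eq_bot_iff, eq_bot_iff]
  intro x hx
  refine Subtype.ext (funext fun N => ?_)
  change proj N x = 1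
  -- precomposition with `f` is injective on the finite set of homomorphisms to `Stage N`
  let S := {g : FreeProP p n →* Stage N // Continuous g}
  have : Finite S := by
    refine Finite.of_injective (fun (g : S) (i : Fin n) => g.1 (gen i)) fun g g' h => ?_
    exact Subtype.ext (hom_ext g.2 g'.2 fun i => congrFun h i)
  let c : S → S := fun g => ⟨g.1.comp f, g.2.comp hf⟩
  have hc : Function.Injective c := fun g g' h => by
    refine Subtype.ext (MonoidHom.ext fun y => ?_)
    obtain ⟨z, rfl⟩ := hs y
    exact DFunLike.congr_fun (congrArg Subtype.val h) z
  obtain ⟨g, hg⟩ := Finite.surjective_of_injective hc ⟨proj N, continuous_proj N⟩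
  have : g.1.comp f = proj N := congrArg Subtype.val hg
  rw [← this, MonoidHom.comp_apply, (MonoidHom.mem_ker).mp hx, map_one]

/-- Odd elements that generate `F_n` are the images of the generators under a
`σ`-automorphism. -/
theorem exists_aut {y : Fin n → FreeProP p n} (hy : ∀ i, sigma (y i) = (y i)⁻¹)
    (hgen : ∀ K : Subgroup (FreeProP p n), IsClosed (K : Set (FreeProP p n)) →
      (∀ i, y i ∈ K) → K = ⊤) :
    ∃ α : SigmaAut (FreeProP p n), ∀ i, α.toContinuousMulEquiv (gen i) = y i := by
  obtain ⟨f, hf, hfy⟩ := exists_lift y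
  have hs : Function.Surjective f := by
    rw [← MonoidHom.range_eq_top]
    exact hgen _ (isCompact_range hf).isClosed fun i => ⟨gen i, hfy i⟩
  have hσ := map_sigma_of_odd hf fun i => by rw [hfy, hy]
  let φ : SigmaEpi (FreeProP p n) (FreeProP p n) :=
    { toMonoidHom := f, continuous_toFun := hf, map_sigma := hσ, surjective := hs }
  have hk : (SigmaIso.refl (FreeProP p n)).toEpi.toMonoidHom.ker = φ.toMonoidHom.ker := by
    refine Eq.trans ?_ ((MonoidHom.ker_eq_bot_iff f).mpr (injective_of_surjective hf hs)).symm
    exact (MonoidHom.ker_eq_bot_iff _).mpr Function.injective_id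
  obtain ⟨e, he⟩ := SigmaEpi.exists_iso_of_ker_eq _ φ hk
  exact ⟨e, fun i => (he (gen i)).trans (hfy i)⟩

instance : TotallyDisconnectedSpace (FreeProP p n) :=
  inferInstanceAs (TotallyDisconnectedSpace (limitSubgroup p n))

/-- The open normal `σ`-invariant subgroups form a basis of neighbourhoods of `1`. -/
theorem exists_open_normal_le {U : Set (FreeProP p n)} (hU : IsOpen U) (h1 : 1 ∈ U) :
    ∃ M : Subgroup (FreeProP p n), M.Normal ∧ IsSigmaInvariant M ∧
      IsOpen (M : Set (FreeProP p n)) ∧ (M : Set (FreeProP p n)) ⊆ U := by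
  obtain ⟨V, hV⟩ := ProfiniteGrp.exist_openNormalSubgroup_sub_open_nhds_of_one hU h1
  have hVn : V.toSubgroup.Normal := V.isNormal'
  let s := (sigma (G := FreeProP p n)).toMonoidHom
  refine ⟨V.toSubgroup ⊓ V.toSubgroup.comap s, inferInstance, ⟨fun g hg => ⟨hg.2, ?_⟩⟩, ?_,
    fun x hx => hV hx.1⟩
  · change sigma (sigma g) ∈ V.toSubgroup
    rw [sigma_sigma]
    exact hg.1
  · exact V.isOpen'.inter (V.isOpen'.preimage (sigma (G := FreeProP p n)).continuous_toFun)

theorem finite_quotient_of_isOpen (M : Subgroup (FreeProP p n))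
    (hM : IsOpen (M : Set (FreeProP p n))) :
    Finite (FreeProP p n ⧸ M) := Subgroup.quotient_finite_of_isOpen M hM

theorem isPGroup_quotient (M : Subgroup (FreeProP p n)) [M.Normal]
    (hM : IsOpen (M : Set (FreeProP p n))) : IsPGroup p (FreeProP p n ⧸ M) := by
  intro q
  obtain ⟨x, rfl⟩ := QuotientGroup.mk_surjective q
  obtain ⟨k, hk⟩ := exists_pow_mem M hM x
  exact ⟨k, by rwa [← QuotientGroup.mk_pow, QuotientGroup.eq_one_iff]⟩

theorem centralChain_of_isOpen (M : Subgroup (FreeProP p n)) [M.Normal]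
    (hM : IsOpen (M : Set (FreeProP p n))) : CentralChain p M :=
  have := finite_quotient_of_isOpen M hM
  CentralChain.of_isPGroup M (isPGroup_quotient M hM)

/-- A closed subgroup is the intersection of the `N M` for the open normal subgroups `M`. -/
theorem le_of_forall_le_sup {N L : Subgroup (FreeProP p n)} (hN : IsClosed (N : Set (FreeProP p n)))
    (h : ∀ M : Subgroup (FreeProP p n), M.Normal → IsOpen (M : Set (FreeProP p n)) → L ≤ N ⊔ M) :
    L ≤ N := by
  intro x hx
  by_contra hxN
  have hU : IsOpen ((fun y => x * y) ⁻¹' (N : Set (FreeProP p n))ᶜ) :=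
    hN.isOpen_compl.preimage (continuous_const_mul x)
  obtain ⟨M, hMn, _, hMo, hMU⟩ := exists_open_normal_le hU (by simpa using hxN)
  obtain ⟨a, ha, b, hb, rfl⟩ := mem_of_mem_sup_of_normal (h M hMn hMo hx)
  exact hMU (M.inv_mem hb) (by simpa using ha)

/-- Nakayama's lemma for normal subgroups: `L^p [L, F]` does not contribute to the generation
of `L` as a normal subgroup. -/
theorem le_of_le_sup_centralFrattini {N L : Subgroup (FreeProP p n)} [N.Normal]
    (hN : IsClosed (N : Set (FreeProP p n))) (h : L ≤ N ⊔ centralFrattini p L) : L ≤ N :=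
  le_of_forall_le_sup hN fun M _ hMo => (centralChain_of_isOpen M hMo).le_sup hMo h

/-- Burnside's basis theorem: the Frattini subgroup does not contribute to the generation
of `F_n`. -/
theorem eq_top_of_sup_proFrattini {K : Subgroup (FreeProP p n)}
    (hK : IsClosed (K : Set (FreeProP p n))) (h : K ⊔ proFrattini p (FreeProP p n) = ⊤) :
    K = ⊤ := by
  rw [eq_top_iff]
  exact le_of_forall_le_sup hK fun M _ hMo =>
    ((centralChain_of_isOpen M hMo).sup_eq_top hMo h).ge

/-- The Zassenhaus filtration of `F_n` eventually lies in every open normal subgroup. -/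
theorem exists_zassenhaus_le (M : Subgroup (FreeProP p n)) [M.Normal]
    (hM : IsOpen (M : Set (FreeProP p n))) :
    ∃ e, ∀ i, e ≤ i → zassenhaus p (FreeProP p n) i ≤ M :=
  (centralChain_of_isOpen M hM).exists_zassenhaus_le hM

/-- If `L` is open and normal, then so is `L^p [L, F]`. -/
theorem isOpen_centralFrattini {L : Subgroup (FreeProP p n)} [L.Normal]
    (hL : IsOpen (L : Set (FreeProP p n))) :
    IsOpen (centralFrattini p L : Set (FreeProP p n)) := by
  let C := centralFrattini p L
  have hCc : IsClosed (C : Set (FreeProP p n)) := isClosed_centralFrattini L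
  have hfinL := finite_quotient_of_isOpen L hL
  have hLfi : L.FiniteIndex := Subgroup.finiteIndex_of_finite_quotient
  -- the image `A` in `F / C` of the dense subgroup `L ∩ FreeGroup` of `L` is finite
  let Γ : Subgroup (FreeGroup (Fin n)) := L.comap ofFree
  have hΓfg : Γ.FG := (Group.fg_iff_subgroup_fg Γ).mp
    (have : Γ.FiniteIndex := ⟨by
      rw [Subgroup.index_comap]
      exact (inferInstance : (L.subgroupOf _).FiniteIndex).index_ne_zero⟩
    Subgroup.fg_of_index_ne_zero Γ)
  let A : Subgroup (FreeProP p n ⧸ C) := Γ.map ((QuotientGroup.mk' C).comp ofFree)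
  have hAmem : ∀ a ∈ A, ∃ x ∈ L, (x : FreeProP p n ⧸ C) = a := by
    rintro _ ⟨w, hw, rfl⟩
    exact ⟨ofFree w, hw, rfl⟩
  have hcomm : ∀ a ∈ A, ∀ b, a * b = b * a := by
    intro a ha b
    obtain ⟨x, hx, rfl⟩ := hAmem a ha
    obtain ⟨y, rfl⟩ := QuotientGroup.mk_surjective b
    have := (QuotientGroup.eq_one_iff _).mpr (commutator_mem_centralFrattini (p := p) hx y)
    rw [QuotientGroup.mk_mul, QuotientGroup.mk_mul, QuotientGroup.mk_mul,
      QuotientGroup.mk_inv, QuotientGroup.mk_inv, mul_inv_eq_one, mul_inv_eq_iff_eq_mul] at this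
    exact this
  have hAfin : Finite A := by
    let _ : CommGroup A := { (inferInstance : Group A) with
      mul_comm := fun a b => Subtype.ext (hcomm a.1 a.2 b.1) }
    classical
    obtain ⟨S, hS⟩ := hΓfg
    have : Group.FG A := (Group.fg_iff_subgroup_fg A).mpr
      ⟨S.image ((QuotientGroup.mk' C).comp ofFree), by
        rw [Finset.coe_image, ← MonoidHom.map_closure, hS]⟩
    refine CommGroup.finite_of_fg_isMulTorsion A ?_
    rintro ⟨a, ha⟩
    obtain ⟨x, hx, rfl⟩ := hAmem a ha
    refine isOfFinOrder_iff_pow_eq_one.mpr ⟨p, hp.out.pos, Subtype.ext ?_⟩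
    change (x : FreeProP p n ⧸ C) ^ p = 1
    rw [← QuotientGroup.mk_pow, QuotientGroup.eq_one_iff]
    exact pow_mem_centralFrattini hx
  have : T2Space (FreeProP p n ⧸ C) := inferInstance
  have hLA : ∀ x ∈ L, (x : FreeProP p n ⧸ C) ∈ A := by
    intro x hx
    have hcl : IsClosed ((fun x : FreeProP p n => (x : FreeProP p n ⧸ C)) ⁻¹' A) :=
      (Set.toFinite (A : Set _)).isClosed.preimage (QuotientGroup.continuous_mk (N := C))
    have hd := (denseRange_ofFree (p := p) (n := n)).open_subset_closure_inter hL hx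
    refine closure_minimal ?_ hcl hd
    rintro _ ⟨hw, w, rfl⟩
    exact ⟨w, hw, rfl⟩
  have hCL : C ≤ L := centralFrattini_le_self (Subgroup.isClosed_of_isOpen _ hL)
  have hCfi : C.FiniteIndex := by
    constructor
    rw [← Subgroup.relIndex_mul_index hCL]
    refine mul_ne_zero ?_ hLfi.index_ne_zero
    have hk : C.relIndex L = Nat.card (L.map (QuotientGroup.mk' C)) := by
      rw [← Subgroup.relIndex_ker, QuotientGroup.ker_mk']
    have : Finite (L.map (QuotientGroup.mk' C)) := by
      refine Set.Finite.subset (Set.toFinite (A : Set _)) ?_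
      rintro _ ⟨x, hx, rfl⟩
      exact hLA x hx
    rw [hk]
    exact Nat.card_pos.ne'
  exact Subgroup.isOpen_of_isClosed_of_finiteIndex C hCc

/-- The terms of the Zassenhaus filtration are open, as `D_i^p [D_i, F] ≤ D_{i+1}`. -/
theorem isOpen_zassenhaus (i : ℕ) :
    IsOpen (zassenhaus p (FreeProP p n) i : Set (FreeProP p n)) := by
  induction i with
  | zero => rw [zassenhaus_of_le_one (by omega)]; exact isOpen_univ
  | succ i ih =>
    rcases Nat.eq_zero_or_pos i with rfl | hi
    · rw [zassenhaus_of_le_one (by omega)]; exact isOpen_univ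
    · exact Subgroup.isOpen_mono (centralFrattini_zassenhaus_le hp.out.two_le hi)
        (isOpen_centralFrattini ih)

theorem isOpen_proFrattini : IsOpen (proFrattini p (FreeProP p n) : Set (FreeProP p n)) := by
  rw [proFrattini_eq]
  exact isOpen_centralFrattini isOpen_univ

end FreeProP

/-! ### Elementary abelian sections -/

section Coordinates

/-- An isomorphism of the section `L / L'` of a group with `𝔽_p^m`, as a function on the whole
group of which only the restriction to `L` matters. -/
structure Coordinates (p : ℕ) {G : Type u} [Group G] (L L' : Subgroup G) (m : ℕ) where
  /-- the coordinate vector of an element of `L` -/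
  toFun : G → Fin m → ZMod p
  map_mul : ∀ x ∈ L, ∀ y ∈ L, toFun (x * y) = toFun x + toFun y
  surj : ∀ v, ∃ x ∈ L, toFun x = v
  mem_iff : ∀ x ∈ L, x ∈ L' ↔ toFun x = 0

variable {p : ℕ} {G : Type u} [Group G] {L L' : Subgroup G} {m : ℕ}

theorem Coordinates.map_one (c : Coordinates p L L' m) : c.toFun 1 = 0 :=
  (c.mem_iff 1 L.one_mem).mp L'.one_mem

theorem Coordinates.map_inv (c : Coordinates p L L' m) {x : G} (hx : x ∈ L) :
    c.toFun x⁻¹ = -c.toFun x := by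
  rw [eq_neg_iff_add_eq_zero, ← c.map_mul _ (L.inv_mem hx) _ hx, inv_mul_cancel, c.map_one]

theorem Coordinates.eq_iff (c : Coordinates p L L' m) {x y : G} (hx : x ∈ L) (hy : y ∈ L) :
    c.toFun x = c.toFun y ↔ x⁻¹ * y ∈ L' := by
  rw [c.mem_iff _ (L.mul_mem (L.inv_mem hx) hy), c.map_mul _ (L.inv_mem hx) _ hy, c.map_inv hx,
    neg_add_eq_zero]

theorem Coordinates.relIndex_eq [Fact p.Prime] (c : Coordinates p L L' m) :
    L'.relIndex L = p ^ m := by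
  let f : L →* Multiplicative (Fin m → ZMod p) :=
    { toFun := fun x => Multiplicative.ofAdd (c.toFun x)
      map_one' := congrArg Multiplicative.ofAdd c.map_one
      map_mul' := fun x y => congrArg Multiplicative.ofAdd (c.map_mul x x.2 y y.2) }
  have hk : f.ker = L'.subgroupOf L := by
    ext x
    exact (c.mem_iff x.1 x.2).symm
  have hr : f.range = ⊤ := by
    rw [MonoidHom.range_eq_top]
    intro v
    obtain ⟨x, hx, hv⟩ := c.surj v.toAdd
    exact ⟨⟨x, hx⟩, congrArg Multiplicative.ofAdd hv⟩
  rw [Subgroup.relIndex, ← hk, Subgroup.index_ker, hr, Subgroup.card_top, Nat.card_eq_fintype_card,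
    Fintype.card_multiplicative]
  simp

/-- The set of coordinate vectors of a subgroup of `L`. -/
def Coordinates.image (c : Coordinates p L L' m) (K : Subgroup G) (hK : K ≤ L) :
    Submodule (ZMod p) (Fin m → ZMod p) :=
  AddSubgroup.toZModSubmodule p
    { carrier := c.toFun '' K
      zero_mem' := ⟨1, K.one_mem, c.map_one⟩
      add_mem' := by
        rintro _ _ ⟨x, hx, rfl⟩ ⟨y, hy, rfl⟩
        exact ⟨x * y, K.mul_mem hx hy, c.map_mul x (hK hx) y (hK hy)⟩
      neg_mem' := by
        rintro _ ⟨x, hx, rfl⟩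
        exact ⟨x⁻¹, K.inv_mem hx, c.map_inv (hK hx)⟩ }

theorem Coordinates.mem_image (c : Coordinates p L L' m) {K : Subgroup G} {hK : K ≤ L}
    {v : Fin m → ZMod p} : v ∈ c.image K hK ↔ ∃ x ∈ K, c.toFun x = v := Iff.rfl

/-- The subgroup of all elements of `L` with coordinate vector in a given subspace. -/
def Coordinates.preimage (c : Coordinates p L L' m) (W : Submodule (ZMod p) (Fin m → ZMod p)) :
    Subgroup G where
  carrier := {x | x ∈ L ∧ c.toFun x ∈ W}
  one_mem' := ⟨L.one_mem, by rw [c.map_one]; exact W.zero_mem⟩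
  mul_mem' {x y} hx hy := ⟨L.mul_mem hx.1 hy.1, by
    rw [c.map_mul x hx.1 y hy.1]; exact W.add_mem hx.2 hy.2⟩
  inv_mem' {x} hx := ⟨L.inv_mem hx.1, by rw [c.map_inv hx.1]; exact W.neg_mem hx.2⟩

theorem Coordinates.le_preimage (c : Coordinates p L L' m) (h : L' ≤ L)
    (W : Submodule (ZMod p) (Fin m → ZMod p)) : L' ≤ c.preimage W := fun x hx =>
  ⟨h hx, by rw [(c.mem_iff x (h hx)).mp hx]; exact W.zero_mem⟩

/-- A subgroup whose coordinate vectors fill `𝔽_p^m` generates `L` modulo `L'`. -/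
theorem Coordinates.le_sup_of_image_eq_top (c : Coordinates p L L' m) {K : Subgroup G}
    (hK : K ≤ L) (h : c.image K hK = ⊤) : L ≤ K ⊔ L' := by
  intro x hx
  obtain ⟨y, hy, hxy⟩ := c.mem_image.mp (h ▸ Submodule.mem_top : c.toFun x ∈ c.image K hK)
  have := (c.eq_iff (hK hy) hx).mp hxy
  rw [← mul_inv_cancel_left y x]
  exact Subgroup.mul_mem_sup hy this

theorem exists_addEquiv_of_pow_eq_one [Fact p.Prime] {A : Type u} [CommGroup A] [Finite A]
    (h : ∀ a : A, a ^ p = 1) : ∃ m, Nonempty (Additive A ≃+ (Fin m → ZMod p)) := by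
  let _ : Module (ZMod p) (Additive A) := AddCommGroup.zmodModule (n := p) h
  have : Module.Finite (ZMod p) (Additive A) := Module.Finite.of_finite
  exact ⟨_, ⟨(Module.finBasis (ZMod p) (Additive A)).equivFun.toAddEquiv⟩⟩

/-- A finite section that is central of exponent dividing `p` has coordinates. -/
theorem exists_coordinates [hp : Fact p.Prime] [L'.Normal] [Finite (G ⧸ L')]
    (h1 : ∀ x ∈ L, x ^ p ∈ L') (h2 : ∀ x ∈ L, ∀ y, x * y * x⁻¹ * y⁻¹ ∈ L') :
    ∃ m, Nonempty (Coordinates p L L' m) := by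
  classical
  let A : Subgroup (G ⧸ L') := L.map (QuotientGroup.mk' L')
  have hA : ∀ a ∈ A, ∃ x ∈ L, (x : G ⧸ L') = a := fun a ha => ha
  let _ : CommGroup A := { (inferInstance : Group A) with
    mul_comm := by
      rintro ⟨a, ha⟩ ⟨b, hb⟩
      refine Subtype.ext ?_
      obtain ⟨x, hx, rfl⟩ := hA a ha
      obtain ⟨y, hy, rfl⟩ := hA b hb
      have := (QuotientGroup.eq_one_iff _).mpr (h2 x hx y)
      rwa [QuotientGroup.mk_mul, QuotientGroup.mk_mul, QuotientGroup.mk_mul,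
        QuotientGroup.mk_inv, QuotientGroup.mk_inv, mul_inv_eq_one, mul_inv_eq_iff_eq_mul] at this }
  have hAp : ∀ a : A, a ^ p = 1 := by
    rintro ⟨a, ha⟩
    obtain ⟨x, hx, rfl⟩ := hA a ha
    refine Subtype.ext ?_
    change (x : G ⧸ L') ^ p = 1
    rw [← QuotientGroup.mk_pow, QuotientGroup.eq_one_iff]
    exact h1 x hx
  obtain ⟨m, ⟨e⟩⟩ := exists_addEquiv_of_pow_eq_one (p := p) hAp
  let g : L → Additive A := fun x => Additive.ofMul ⟨(x : G), x, x.2, rfl⟩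
  have hg : ∀ x, g x = 0 ↔ (x : G) ∈ L' := by
    intro x
    rw [← QuotientGroup.eq_one_iff]
    exact Subtype.ext_iff
  refine ⟨m, ⟨⟨fun x => if hx : x ∈ L then e (g ⟨x, hx⟩) else 0, ?_, ?_, ?_⟩⟩⟩
  · intro x hx y hy
    rw [dif_pos hx, dif_pos hy, dif_pos (L.mul_mem hx hy), ← map_add]
    rfl
  · intro v
    obtain ⟨x, hx, hxa⟩ := hA (e.symm v).toMul.1 (e.symm v).toMul.2
    refine ⟨x, hx, ?_⟩
    rw [dif_pos hx, ← AddEquiv.eq_symm_apply]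
    exact congrArg Additive.ofMul (Subtype.ext hxa)
  · intro x hx
    rw [dif_pos hx, map_eq_zero_iff e e.injective, hg]

end Coordinates

/-! ### The Frattini quotient of the free pro-`p`-group -/

namespace FreeProP

variable {p n m : ℕ} [hp : Fact p.Prime]

/-- The homomorphism from `F_n` to `(ℤ/q)^n` for a power `q` of `p`, that maps the generators to
the standard basis. -/
theorem exists_exponents {q k : ℕ} (hq : q = p ^ k) :
    ∃ f : FreeProP p n →* Multiplicative (Fin n → ZMod q), Continuous f ∧
      ∀ i, f (gen i) = Multiplicative.ofAdd (Pi.single i 1) := by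
  have : NeZero q := ⟨by rw [hq]; exact pow_ne_zero _ hp.out.ne_zero⟩
  have : Finite (Multiplicative (Fin n → ZMod q)) := inferInstanceAs (Finite (Fin n → ZMod q))
  refine exists_lift_finite (fun x => ⟨k, ?_⟩) _
  rw [← hq]
  change Multiplicative.ofAdd (q • x.toAdd) = Multiplicative.ofAdd 0
  refine congrArg _ (funext fun i => ?_)
  simp

variable (p n) in
/-- The exponents modulo `p` of the generators in an element of `F_n`, as a homomorphism. -/
noncomputable def exponents : FreeProP p n →* Multiplicative (Fin n → ZMod p) :=
  (exists_exponents (n := n) (pow_one p).symm).choose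

theorem continuous_exponents : Continuous (exponents p n) :=
  (exists_exponents (n := n) (pow_one p).symm).choose_spec.1

theorem exponents_gen (i : Fin n) :
    exponents p n (gen i) = Multiplicative.ofAdd (Pi.single i 1) :=
  (exists_exponents (n := n) (pow_one p).symm).choose_spec.2 i

theorem span_single_eq_top {q : ℕ} : Submodule.span (ZMod q)
    (Set.range fun i : Fin n => (Pi.single i 1 : Fin n → ZMod q)) = ⊤ := by
  have := (Pi.basisFun (ZMod q) (Fin n)).span_eq
  convert this using 3
  funext i
  simp

theorem surjective_of_map_gen {q : ℕ} {f : FreeProP p n →* Multiplicative (Fin n → ZMod q)}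
    (hf : ∀ i, f (gen i) = Multiplicative.ofAdd (Pi.single i 1)) : Function.Surjective f := by
  let W : Submodule (ZMod q) (Fin n → ZMod q) :=
    AddSubgroup.toZModSubmodule q (Subgroup.toAddSubgroup' f.range)
  have hW : W = ⊤ := by
    rw [eq_top_iff, ← span_single_eq_top, Submodule.span_le]
    rintro _ ⟨i, rfl⟩
    exact ⟨gen i, hf i⟩
  intro v
  have : v.toAdd ∈ W := hW ▸ Submodule.mem_top
  exact this

theorem exponents_surjective : Function.Surjective (exponents p n) :=
  surjective_of_map_gen exponents_gen

theorem isOpen_ker_exponents : IsOpen ((exponents p n).ker : Set (FreeProP p n)) := by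
  have : (((exponents p n).ker : Subgroup _) : Set (FreeProP p n)) = exponents p n ⁻¹' {1} := rfl
  rw [this]
  refine IsOpen.preimage continuous_exponents ?_
  exact (isOpen_discrete ({0} : Set (Fin n → ZMod p)))

theorem proFrattini_le_ker : proFrattini p (FreeProP p n) ≤ (exponents p n).ker := by
  rw [proFrattini_eq]
  refine centralFrattini_le (Subgroup.isClosed_of_isOpen _ isOpen_ker_exponents)
    (fun x _ => ?_) fun x _ y => ?_
  · rw [MonoidHom.mem_ker, map_pow]
    change Multiplicative.ofAdd (p • (exponents p n x).toAdd) = Multiplicative.ofAdd 0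
    refine congrArg _ (funext fun i => ?_)
    simp
  · rw [MonoidHom.mem_ker]
    simp only [map_mul, map_inv]
    rw [mul_comm (exponents p n x), mul_inv_cancel_right, mul_inv_cancel]

/-- The Frattini subgroup of `F_n` is the kernel of the exponents modulo `p`. -/
theorem ker_exponents : (exponents p n).ker = proFrattini p (FreeProP p n) := by
  have hfin := finite_quotient_of_isOpen _ (isOpen_proFrattini (p := p) (n := n))
  obtain ⟨m, ⟨c⟩⟩ := exists_coordinates (p := p) (L := ⊤) (L' := proFrattini p (FreeProP p n))
    (fun x _ => by rw [proFrattini_eq]; exact pow_mem_centralFrattini (Subgroup.mem_top x))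
    fun x _ y => by
      rw [proFrattini_eq]; exact commutator_mem_centralFrattini (Subgroup.mem_top x) y
  -- the generators span the Frattini quotient, whose dimension is thus at most `n`
  let W := Submodule.span (ZMod p) (Set.range fun i : Fin n => c.toFun (gen i))
  have hW : W = ⊤ := by
    have htop : c.preimage W = ⊤ := by
      refine eq_top_of_gen_mem (Subgroup.isClosed_of_isOpen _
        (Subgroup.isOpen_mono (c.le_preimage le_top W) isOpen_proFrattini)) fun i => ?_
      exact ⟨Subgroup.mem_top _, Submodule.subset_span ⟨i, rfl⟩⟩
    rw [eq_top_iff]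
    rintro v -
    obtain ⟨x, _, rfl⟩ := c.surj v
    exact ((Subgroup.eq_top_iff' _).mp htop x).2
  have hmn : m ≤ n := by
    have := finrank_range_le_card (R := ZMod p) (fun i : Fin n => c.toFun (gen i))
    rw [Set.finrank] at this
    change Module.finrank (ZMod p) W ≤ _ at this
    rw [hW, finrank_top] at this
    simpa using this
  have h1 : (proFrattini p (FreeProP p n)).index = p ^ m := by
    rw [← Subgroup.relIndex_top_right, c.relIndex_eq]
  have h2 : (exponents p n).ker.index = p ^ n := by
    rw [Subgroup.index_ker, MonoidHom.range_eq_top.mpr exponents_surjective, Subgroup.card_top,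
      Nat.card_eq_fintype_card, Fintype.card_multiplicative]
    simp
  have h3 := Subgroup.relIndex_mul_index (proFrattini_le_ker (p := p) (n := n))
  have h4 : (proFrattini p (FreeProP p n)).relIndex (exponents p n).ker = 1 := by
    have hle : p ^ m ≤ p ^ n := Nat.pow_le_pow_right hp.out.pos hmn
    have hpos : 0 < p ^ m := pow_pos hp.out.pos m
    rw [h1, h2] at h3
    by_contra hne
    have h0 : (proFrattini p (FreeProP p n)).relIndex (exponents p n).ker ≠ 0 := by
      intro h0
      rw [h0, zero_mul] at h3
      omega
    have : 2 ≤ (proFrattini p (FreeProP p n)).relIndex (exponents p n).ker := by omega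
    nlinarith
  exact le_antisymm (Subgroup.relIndex_eq_one.mp h4) proFrattini_le_ker

variable (p n) in
/-- The coordinates on `F_n` modulo its Frattini subgroup given by the exponents modulo `p`. -/
noncomputable def frattiniCoordinates :
    Coordinates p (⊤ : Subgroup (FreeProP p n)) (proFrattini p (FreeProP p n)) n where
  toFun x := (exponents p n x).toAdd
  map_mul x _ y _ := by rw [map_mul]; rfl
  surj v := by
    obtain ⟨x, hx⟩ := exponents_surjective (Multiplicative.ofAdd v)
    exact ⟨x, Subgroup.mem_top x, by rw [hx]; rfl⟩
  mem_iff x _ := by rw [← ker_exponents]; rfl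

theorem frattiniCoordinates_gen (i : Fin n) :
    (frattiniCoordinates p n).toFun (gen i) = Pi.single i 1 := by
  change (exponents p n (gen i)).toAdd = _
  rw [exponents_gen]; rfl

/-- Elements whose exponents modulo `p` span `𝔽_p^n` generate `F_n`. -/
theorem eq_top_of_span {ι : Type u} {y : ι → FreeProP p n} {K : Subgroup (FreeProP p n)}
    (hK : IsClosed (K : Set (FreeProP p n))) (hy : ∀ i, y i ∈ K)
    (h : Submodule.span (ZMod p) (Set.range fun i => (frattiniCoordinates p n).toFun (y i)) = ⊤) :
    K = ⊤ := by
  refine eq_top_of_sup_proFrattini hK (top_le_iff.mp ?_)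
  refine (frattiniCoordinates p n).le_sup_of_image_eq_top le_top (top_le_iff.mp ?_)
  rw [← h, Submodule.span_le]
  rintro _ ⟨i, rfl⟩
  exact ⟨y i, hy i, rfl⟩

/-- The exponents modulo `p` of generating elements span `𝔽_p^n`. -/
theorem span_eq_top_of_generate {ι : Type u} {y : ι → FreeProP p n}
    (h : ∀ K : Subgroup (FreeProP p n), IsClosed (K : Set (FreeProP p n)) →
      (∀ i, y i ∈ K) → K = ⊤) :
    Submodule.span (ZMod p) (Set.range fun i => (frattiniCoordinates p n).toFun (y i)) = ⊤ := by
  set W := Submodule.span (ZMod p) (Set.range fun i => (frattiniCoordinates p n).toFun (y i))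
  have htop : (frattiniCoordinates p n).preimage W = ⊤ := by
    refine h _ (Subgroup.isClosed_of_isOpen _ (Subgroup.isOpen_mono
      ((frattiniCoordinates p n).le_preimage le_top W) isOpen_proFrattini)) fun i => ?_
    exact ⟨Subgroup.mem_top _, Submodule.subset_span ⟨i, rfl⟩⟩
  rw [eq_top_iff]
  rintro v -
  obtain ⟨x, _, rfl⟩ := (frattiniCoordinates p n).surj v
  exact ((Subgroup.eq_top_iff' _).mp htop x).2

/-- Exchange: a generator can be replaced by any element in which its exponent modulo `p` is not
zero. -/
theorem eq_top_of_exchange {y : FreeProP p n} {j : Fin n}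
    (hj : (frattiniCoordinates p n).toFun y j ≠ 0) {K : Subgroup (FreeProP p n)}
    (hK : IsClosed (K : Set (FreeProP p n))) (hy : y ∈ K) (hgen : ∀ i, i ≠ j → gen i ∈ K) :
    K = ⊤ := by
  classical
  set c := frattiniCoordinates p n
  have hW : ∀ i, i ≠ j → (Pi.single i 1 : Fin n → ZMod p) ∈ c.image K le_top := fun i hi =>
    ⟨gen i, hgen i hi, frattiniCoordinates_gen i⟩
  have hyW : c.toFun y ∈ c.image K le_top := ⟨y, hy, rfl⟩
  refine eq_top_of_sup_proFrattini hK (top_le_iff.mp ?_)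
  refine c.le_sup_of_image_eq_top le_top (top_le_iff.mp ?_)
  rw [← span_single_eq_top, Submodule.span_le]
  rintro _ ⟨i, rfl⟩
  by_cases hi : i = j
  · subst hi
    have hsum : c.toFun y = ∑ k, c.toFun y k • (Pi.single k 1 : Fin n → ZMod p) := by
      conv_lhs => rw [pi_eq_sum_univ' (c.toFun y)]
    rw [← Finset.add_sum_erase _ _ (Finset.mem_univ i)] at hsum
    have hmem : ∑ k ∈ Finset.univ.erase i, c.toFun y k • (Pi.single k 1 : Fin n → ZMod p) ∈
        c.image K le_top :=
      Submodule.sum_mem _ fun k hk => Submodule.smul_mem _ _ (hW k (Finset.ne_of_mem_erase hk))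
    have h1 : c.toFun y i • (Pi.single i 1 : Fin n → ZMod p) ∈ c.image K le_top := by
      rw [eq_sub_of_add_eq hsum.symm]
      exact Submodule.sub_mem _ hyW hmem
    exact (Submodule.smul_mem_iff _ hj).mp h1
  · exact hW i hi

theorem exists_coord_ne_zero {y : FreeProP p n} (hy : y ∉ proFrattini p (FreeProP p n)) :
    ∃ j, (frattiniCoordinates p n).toFun y j ≠ 0 := by
  rw [(frattiniCoordinates p n).mem_iff y (Subgroup.mem_top y)] at hy
  exact Function.ne_iff.mp hy

/-- A closed subgroup with surjective image generates, if the kernel is in the Frattini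
subgroup. -/
theorem eq_top_of_map_eq_top {A : Type u} [Group A] {f : FreeProP p n →* A}
    (hker : f.ker ≤ proFrattini p (FreeProP p n)) {K : Subgroup (FreeProP p n)}
    (hK : IsClosed (K : Set (FreeProP p n))) (h : K.map f = ⊤) : K = ⊤ := by
  refine eq_top_of_sup_proFrattini hK (top_le_iff.mp ?_)
  refine le_trans ?_ (sup_le_sup_left hker K)
  rw [← Subgroup.comap_map_eq, h, Subgroup.comap_top]

/-- A quotient of `F_n` by a subgroup of the Frattini subgroup needs `n` generators. -/
theorem minGens_eq_of_ker_le {A : Type u} [Group A] [TopologicalSpace A] [IsTopologicalGroup A]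
    [T2Space A] {f : FreeProP p n →* A} (hf : Continuous f) (hs : Function.Surjective f)
    (hker : f.ker ≤ proFrattini p (FreeProP p n)) : minGens A = n := by
  have hn : n ∈ {k | ∃ s : Fin k → A,
      (Subgroup.closure (Set.range s)).topologicalClosure = ⊤} := by
    refine ⟨fun i => f (gen i), ?_⟩
    set R := (Subgroup.closure (Set.range fun i => f (gen i))).topologicalClosure
    have hR : R.comap f = ⊤ := by
      refine eq_top_of_gen_mem ((Subgroup.isClosed_topologicalClosure _).preimage hf) fun i => ?_
      exact Subgroup.le_topologicalClosure _ (Subgroup.subset_closure ⟨i, rfl⟩)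
    rw [eq_top_iff]
    intro a _
    obtain ⟨x, rfl⟩ := hs a
    exact (hR ▸ Subgroup.mem_top x : x ∈ R.comap f)
  refine le_antisymm (Nat.sInf_le hn) (le_csInf ⟨n, hn⟩ ?_)
  -- lifts of `k` generators generate `F_n`, so their exponents span `𝔽_p^n`
  rintro k ⟨s, hsk⟩
  choose y hy using fun i => hs (s i)
  have hgen : ∀ K : Subgroup (FreeProP p n), IsClosed (K : Set (FreeProP p n)) →
      (∀ i, y i ∈ K) → K = ⊤ := by
    intro K hK hyK
    refine eq_top_of_map_eq_top hker hK (top_le_iff.mp ?_)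
    rw [← hsk]
    refine Subgroup.topologicalClosure_minimal _ ?_ (hK.isCompact.image hf).isClosed
    rw [Subgroup.closure_le]
    rintro _ ⟨i, rfl⟩
    exact ⟨y i, hyK i, hy i⟩
  have hspan := span_eq_top_of_generate hgen
  have := finrank_range_le_card (R := ZMod p)
    (fun i => (frattiniCoordinates p n).toFun (y i))
  rw [Set.finrank, hspan, finrank_top] at this
  simpa using this

/-- Conversely, if a quotient of `F_n` needs `n` generators, the kernel lies in the Frattini
subgroup, since any other element of the kernel would make a generator superfluous. -/
theorem ker_le_of_minGens_eq {A : Type u} [Group A] [TopologicalSpace A] [IsTopologicalGroup A]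
    {f : FreeProP p n →* A} (hf : Continuous f) (hs : Function.Surjective f)
    (h : minGens A = n) : f.ker ≤ proFrattini p (FreeProP p n) := by
  intro y hy
  by_contra hyΦ
  obtain ⟨j, hj⟩ := exists_coord_ne_zero hyΦ
  obtain ⟨k, rfl⟩ : ∃ k, n = k + 1 := Nat.exists_eq_succ_of_ne_zero (by
    rintro rfl; exact j.elim0)
  have hk : k ∈ {k | ∃ s : Fin k → A,
      (Subgroup.closure (Set.range s)).topologicalClosure = ⊤} := by
    refine ⟨fun i => f (gen (j.succAbove i)), ?_⟩
    set R := (Subgroup.closure (Set.range fun i => f (gen (j.succAbove i)))).topologicalClosure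
    have hR : R.comap f = ⊤ := by
      refine eq_top_of_exchange hj ((Subgroup.isClosed_topologicalClosure _).preimage hf) ?_ ?_
      · rw [Subgroup.mem_comap, MonoidHom.mem_ker.mp hy]
        exact R.one_mem
      · intro i hi
        obtain ⟨l, rfl⟩ := Fin.exists_succAbove_eq hi
        exact Subgroup.le_topologicalClosure _ (Subgroup.subset_closure ⟨l, rfl⟩)
    rw [eq_top_iff]
    intro a _
    obtain ⟨x, rfl⟩ := hs a
    exact (hR ▸ Subgroup.mem_top x : x ∈ R.comap f)
  have : minGens A ≤ k := Nat.sInf_le hk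
  omega

/-! ### Odd elements and the lifting of homomorphisms -/

/-- For odd `p`, odd elements lift to odd elements: if `b = ψ x` is odd, then `x σ(x)⁻¹` is an odd
lift of `b²`, and powers of it approximate an odd lift of `b`. -/
theorem exists_odd_lift (hp2 : p ≠ 2) {A : Type u} [Group A] [TopologicalSpace A] [SigmaGroup A]
    [T2Space A] (ψ : SigmaEpi (FreeProP p n) A) {K : Subgroup (FreeProP p n)}
    (hK : IsClosed (K : Set (FreeProP p n))) [hKσ : IsSigmaInvariant K] {b : A}
    (hb : sigma b = b⁻¹) (hbK : b ∈ K.map ψ.toMonoidHom) :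
    ∃ a ∈ K, sigma a = a⁻¹ ∧ ψ.toMonoidHom a = b := by
  let S : Set (FreeProP p n) := {a | a ∈ K ∧ sigma a = a⁻¹}
  have hS : IsClosed S :=
    hK.inter (isClosed_eq (sigma (G := FreeProP p n)).continuous_toFun continuous_inv)
  have himg : IsClosed (ψ.toMonoidHom '' S) := (hS.isCompact.image ψ.continuous).isClosed
  suffices h : b ∈ closure (ψ.toMonoidHom '' S) by
    rw [himg.closure_eq] at h
    obtain ⟨a, ⟨h1, h2⟩, h3⟩ := h
    exact ⟨a, h1, h2, h3⟩
  rw [mem_closure_iff]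
  intro o ho hbo
  obtain ⟨x, hxK, rfl⟩ := hbK
  let g := x * (sigma x)⁻¹
  have hgK : g ∈ K := K.mul_mem hxK (K.inv_mem (hKσ.sigma_mem x hxK))
  have hgσ : sigma g = g⁻¹ := by
    change sigma (x * (sigma x)⁻¹) = (x * (sigma x)⁻¹)⁻¹
    rw [map_mul, map_inv, sigma_sigma, mul_inv_rev, inv_inv]
  have hg : ψ.toMonoidHom g = ψ.toMonoidHom x * ψ.toMonoidHom x := by
    change ψ.toMonoidHom (x * (sigma x)⁻¹) = _
    rw [map_mul, map_inv, ψ.toMonoidHom_sigma, hb, inv_inv]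
  obtain ⟨M, hMn, _, hMo, hM⟩ := exists_open_normal_le
    (U := (fun y => ψ.toMonoidHom (x * y)) ⁻¹' o)
    (ho.preimage (ψ.continuous.comp (continuous_const_mul x))) (by simpa using hbo)
  -- if `x ^ (2 * j + 1)` is close to `1`, then `(ψ g) ^ (j + 1) = b ^ (2 * j + 2)` is close to `b`
  obtain ⟨k, hk⟩ := exists_pow_mem M hMo x
  obtain ⟨j, hj⟩ := (hp.out.odd_of_ne_two hp2).pow (n := k)
  refine ⟨ψ.toMonoidHom (g ^ (j + 1)), ?_, g ^ (j + 1), ⟨K.pow_mem hgK _, ?_⟩, rfl⟩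
  · have h1 : ψ.toMonoidHom (x * x ^ p ^ k) ∈ o := hM hk
    have h2 : ψ.toMonoidHom (g ^ (j + 1)) = ψ.toMonoidHom (x * x ^ p ^ k) := by
      rw [map_pow, hg, hj, ← pow_succ', map_pow, ← pow_two, ← pow_mul,
      show 2 * (j + 1) = 2 * j + 1 + 1 by ring]
    rw [h2]
    exact h1
  · rw [map_pow, hgσ, inv_pow]

/-- `F_n` is projective: surjective `σ`-homomorphisms from `F_n` to the same group differ by a
`σ`-automorphism, if the kernel of one of them is contained in the Frattini subgroup. -/
theorem exists_aut_comp_eq (hp2 : p ≠ 2) {A : Type u} [Group A] [TopologicalSpace A]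
    [SigmaGroup A] [T2Space A] (φ ψ : SigmaEpi (FreeProP p n) A)
    (hψ : ψ.toMonoidHom.ker ≤ proFrattini p (FreeProP p n)) :
    ∃ α : SigmaAut (FreeProP p n),
      ∀ x, ψ.toMonoidHom (α.toContinuousMulEquiv x) = φ.toMonoidHom x := by
  have hodd : ∀ i, sigma (φ.toMonoidHom (gen i)) = (φ.toMonoidHom (gen i))⁻¹ := fun i => by
    rw [← φ.toMonoidHom_sigma, sigma_gen, map_inv]
  choose y _ hyσ hy using fun i => exists_odd_lift hp2 ψ (K := ⊤) isClosed_univ (hodd i)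
    (by rw [Subgroup.map_top_of_surjective _ ψ.surj]; exact Subgroup.mem_top _)
  obtain ⟨α, hα⟩ := exists_aut hyσ fun K hK hyK => by
    refine eq_top_of_map_eq_top hψ hK ?_
    have : (K.map ψ.toMonoidHom).comap φ.toMonoidHom = ⊤ := by
      refine eq_top_of_gen_mem
        ((hK.isCompact.image ψ.continuous).isClosed.preimage φ.continuous) fun i => ?_
      exact ⟨y i, hyK i, hy i⟩
    rw [eq_top_iff]
    intro a _
    obtain ⟨x, rfl⟩ := φ.surj a
    exact (this ▸ Subgroup.mem_top x : x ∈ (K.map ψ.toMonoidHom).comap φ.toMonoidHom)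
  refine ⟨α, fun x => ?_⟩
  have key : (ψ.comp α.toEpi).toMonoidHom = φ.toMonoidHom := by
    refine hom_ext (ψ.comp α.toEpi).continuous φ.continuous fun i => ?_
    change ψ.toMonoidHom (α.toContinuousMulEquiv (gen i)) = _
    rw [hα, hy]
  exact DFunLike.congr_fun key x

/-- The quotient of `F_{n+1}` by an odd element outside the Frattini subgroup is `F_n`. -/
theorem exists_epi_of_notMem {y : FreeProP p (n + 1)} (hyσ : sigma y = y⁻¹)
    (hy : y ∉ proFrattini p (FreeProP p (n + 1))) :
    ∃ β : SigmaEpi (FreeProP p (n + 1)) (FreeProP p n),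
      β.toMonoidHom y = 1 ∧ ∀ K : Subgroup (FreeProP p (n + 1)), K.Normal →
        IsClosed (K : Set (FreeProP p (n + 1))) → y ∈ K → β.toMonoidHom.ker ≤ K := by
  obtain ⟨j, hj⟩ := exists_coord_ne_zero hy
  obtain ⟨α, hα⟩ := exists_aut (y := fun i => if i = j then y else gen i)
    (by intro i; split_ifs; exacts [hyσ, sigma_gen i])
    (fun K hK hyK => eq_top_of_exchange hj hK (by simpa using hyK j)
      fun i hi => by simpa [hi] using hyK i)
  have hα' : ∀ i, α.symm.toContinuousMulEquiv (if i = j then y else gen i) = gen i := fun i => by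
    rw [← hα]
    exact α.toContinuousMulEquiv.symm_apply_apply _
  obtain ⟨κ, hκc, hκ⟩ := exists_lift (p := p) (m := n) (j.insertNth (1 : FreeProP p n) gen)
  have hκj : κ (gen j) = 1 := by rw [hκ, Fin.insertNth_apply_same]
  have hκi : ∀ i, κ (gen (j.succAbove i)) = gen i := fun i => by
    rw [hκ, Fin.insertNth_apply_succAbove]
  have hκσ := map_sigma_of_odd hκc fun i => by
    rcases Fin.eq_self_or_eq_succAbove j i with rfl | ⟨l, rfl⟩
    · rw [hκj, map_one, inv_one]
    · rw [hκi, sigma_gen]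
  let κ' : SigmaEpi (FreeProP p (n + 1)) (FreeProP p n) :=
    { toMonoidHom := κ
      continuous_toFun := hκc
      map_sigma := hκσ
      surjective := by
        change Function.Surjective κ
        rw [← MonoidHom.range_eq_top]
        exact eq_top_of_gen_mem (isCompact_range hκc).isClosed fun i => ⟨_, hκi i⟩ }
  let β := κ'.comp α.symm.toEpi
  have hβy : β.toMonoidHom y = 1 := by
    have := hα' j
    rw [if_pos rfl] at this
    change κ (α.symm.toContinuousMulEquiv y) = 1
    rw [this, hκj]
  have hβi : ∀ i, β.toMonoidHom (gen (j.succAbove i)) = gen i := fun i => by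
    have := hα' (j.succAbove i)
    rw [if_neg (Fin.succAbove_ne j i)] at this
    change κ (α.symm.toContinuousMulEquiv _) = _
    rw [this, hκi]
  refine ⟨β, hβy, fun K hKn hK hyK x hx => ?_⟩
  -- modulo `K`, the obvious section `ι` of `β` is inverse to `β`
  obtain ⟨ι, hιc, hι⟩ := exists_lift (p := p) fun i => (gen (j.succAbove i) : FreeProP p (n + 1))
  let q := QuotientGroup.mk' K
  have hq : Continuous q := QuotientGroup.continuous_mk
  have htop : ((q.comp ι).comp β.toMonoidHom).eqLocus q = ⊤ := by
    refine eq_top_of_exchange hj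
      (isClosed_eq (hq.comp (hιc.comp β.continuous)) hq) ?_ ?_
    · change q (ι (β.toMonoidHom y)) = q y
      rw [hβy, map_one, map_one]
      exact ((QuotientGroup.eq_one_iff y).mpr hyK).symm
    · intro i hi
      obtain ⟨l, rfl⟩ := Fin.exists_succAbove_eq hi
      change q (ι (β.toMonoidHom _)) = q _
      rw [hβi, hι]
  have hxq : q (ι (β.toMonoidHom x)) = q x := (htop ▸ Subgroup.mem_top x :
    x ∈ ((q.comp ι).comp β.toMonoidHom).eqLocus q)
  rw [MonoidHom.mem_ker.mp hx, map_one, map_one] at hxq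
  exact (QuotientGroup.eq_one_iff x).mp hxq.symm

end FreeProP

/-! ### Uniform measures on odd parts -/

namespace FreeProP

variable {p n m : ℕ} [hp : Fact p.Prime]

instance : Countable (PowIndex p n) := by
  have : ∀ N : PowIndex p n, ∃ S : Finset (FreeGroup (Fin n)), Subgroup.closure (S : Set _) = N.1 :=
    fun N => by
      have := powIndex_finiteIndex N
      exact (Group.fg_iff_subgroup_fg N.1).mp (Subgroup.fg_of_index_ne_zero N.1)
  choose S hS using this
  have : Countable (FreeGroup (Fin n)) := Quot.mk_surjective.countable
  refine Function.Injective.countable (f := S) fun M N h => Subtype.ext ?_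
  rw [← hS M, ← hS N, h]

instance (N : PowIndex p n) : SecondCountableTopology (Stage N) :=
  DiscreteTopology.secondCountableTopology_of_countable

instance : SecondCountableTopology (FreeProP p n) := by
  have : SecondCountableTopology (∀ N : PowIndex p n, Stage N) := inferInstance
  exact TopologicalSpace.Subtype.secondCountableTopology
    (limitSubgroup p n : Set (∀ N : PowIndex p n, Stage N))

instance : SecondCountableTopology (OddPart (FreeProP p n)) :=
  TopologicalSpace.Subtype.secondCountableTopology {a : FreeProP p n | sigma a = a⁻¹}

/-- The map on odd parts induced by a `σ`-homomorphism. -/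
def oddMap (β : SigmaEpi (FreeProP p n) (FreeProP p m)) (x : OddPart (FreeProP p n)) :
    OddPart (FreeProP p m) :=
  ⟨β.toMonoidHom x, by rw [← β.toMonoidHom_sigma, x.2, map_inv]⟩

theorem continuous_oddMap (β : SigmaEpi (FreeProP p n) (FreeProP p m)) : Continuous (oddMap β) :=
  (β.continuous.comp continuous_subtype_val).subtype_mk _

/-- The set of odd elements of a coset of `N`. -/
def oddCoset (N : Subgroup (FreeProP p n)) (b : OddPart (FreeProP p n)) :
    Set (OddPart (FreeProP p n)) := {x | (b : FreeProP p n)⁻¹ * x ∈ N}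

/-- The set of odd elements of a subgroup. -/
def oddIn (N : Subgroup (FreeProP p n)) : Set (OddPart (FreeProP p n)) :=
  {x | (x : FreeProP p n) ∈ N}

theorem isOpen_oddCoset {N : Subgroup (FreeProP p n)} (hN : IsOpen (N : Set (FreeProP p n)))
    (b : OddPart (FreeProP p n)) : IsOpen (oddCoset N b) := by
  have hc : Continuous fun x : OddPart (FreeProP p n) => (b : FreeProP p n)⁻¹ * x := by fun_prop
  exact hN.preimage hc

theorem isOpen_oddIn {N : Subgroup (FreeProP p n)} (hN : IsOpen (N : Set (FreeProP p n))) :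
    IsOpen (oddIn N) := hN.preimage continuous_subtype_val

instance : One (OddPart (FreeProP p n)) := ⟨⟨1, by rw [map_one, inv_one]⟩⟩

theorem oddCoset_one (N : Subgroup (FreeProP p n)) : oddCoset N 1 = oddIn N := by
  ext x
  change (1 : FreeProP p n)⁻¹ * x ∈ N ↔ (x : FreeProP p n) ∈ N
  rw [inv_one, one_mul]

theorem oddCoset_eq {N : Subgroup (FreeProP p n)} {b c : OddPart (FreeProP p n)}
    (h : c ∈ oddCoset N b) : oddCoset N b = oddCoset N c := by
  ext x
  change (b : FreeProP p n)⁻¹ * x ∈ N ↔ (c : FreeProP p n)⁻¹ * x ∈ N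
  have h : (b : FreeProP p n)⁻¹ * c ∈ N := h
  have key : (b : FreeProP p n)⁻¹ * x = (b : FreeProP p n)⁻¹ * c * ((c : FreeProP p n)⁻¹ * x) := by
    group
  rw [key, Subgroup.mul_mem_cancel_left N h]

theorem oddCoset_inf {M N : Subgroup (FreeProP p n)} (b : OddPart (FreeProP p n)) :
    oddCoset (M ⊓ N) b = oddCoset M b ∩ oddCoset N b := rfl

theorem oddCoset_of_mem {N : Subgroup (FreeProP p n)} {b : OddPart (FreeProP p n)}
    (hb : (b : FreeProP p n) ∈ N) : oddCoset N b = oddIn N := by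
  ext x
  exact Subgroup.mul_mem_cancel_left N (N.inv_mem hb)

/-- A probability measure on the odd part of `F_n` is uniform on the odd part of `K`, if it lives
there and all cosets of any one open normal `σ`-invariant subgroup have the same measure. -/
structure IsUniformOn (K : Subgroup (FreeProP p n)) (μ : Measure (OddPart (FreeProP p n))) :
    Prop where
  prob : IsProbabilityMeasure μ
  compl : μ (oddIn K)ᶜ = 0
  eq : ∀ N : Subgroup (FreeProP p n), N.Normal → IsSigmaInvariant N →
    IsOpen (N : Set (FreeProP p n)) → N ≤ K → ∀ b ∈ oddIn K, ∀ c ∈ oddIn K,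
      μ (oddCoset N b) = μ (oddCoset N c)

instance inf_sigmaInvariant {G : Type u} [Group G] [TopologicalSpace G] [SigmaGroup G]
    (M N : Subgroup G) [hM : IsSigmaInvariant M] [hN : IsSigmaInvariant N] :
    IsSigmaInvariant (M ⊓ N) :=
  ⟨fun g hg => ⟨hM.sigma_mem g hg.1, hN.sigma_mem g hg.2⟩⟩

instance comap_sigmaInvariant {G : Type u} [Group G] [TopologicalSpace G] [SigmaGroup G]
    {H : Type v} [Group H] [TopologicalSpace H] [SigmaGroup H]
    (φ : SigmaEpi G H) (N : Subgroup H) [hN : IsSigmaInvariant N] :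
    IsSigmaInvariant (N.comap φ.toMonoidHom) :=
  ⟨fun g hg => by
    rw [Subgroup.mem_comap, φ.toMonoidHom_sigma]
    exact hN.sigma_mem _ hg⟩

theorem IsUniformOn.measure_inter {K : Subgroup (FreeProP p n)}
    {μ : Measure (OddPart (FreeProP p n))} (h : IsUniformOn K μ)
    (A : Set (OddPart (FreeProP p n))) :
    μ (A ∩ oddIn K) = μ A :=
  measure_inter_conull h.compl

theorem measurableSet_oddCoset {N : Subgroup (FreeProP p n)}
    (hN : IsOpen (N : Set (FreeProP p n))) (b : OddPart (FreeProP p n)) :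
    MeasurableSet (oddCoset N b) := (isOpen_oddCoset hN b).measurableSet

open Classical in
/-- A uniform measure gives each coset that it can see the inverse of their number. -/
theorem IsUniformOn.measure_oddIn {K : Subgroup (FreeProP p n)}
    {μ : Measure (OddPart (FreeProP p n))} (h : IsUniformOn K μ) {N : Subgroup (FreeProP p n)}
    (hNn : N.Normal) (hNσ : IsSigmaInvariant N) (hNo : IsOpen (N : Set (FreeProP p n)))
    (hNK : N ≤ K) :
    μ (oddIn N) = (Nat.card
      ((fun x : OddPart (FreeProP p n) => (x : FreeProP p n ⧸ N)) '' oddIn K) : ENNReal)⁻¹ := by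
  have := h.prob
  have hfin := finite_quotient_of_isOpen N hNo
  have := Fintype.ofFinite (FreeProP p n ⧸ N)
  let f : OddPart (FreeProP p n) → FreeProP p n ⧸ N := fun x => (x : FreeProP p n)
  have hfib : ∀ b, f ⁻¹' {f b} = oddCoset N b := fun b => by
    ext x
    change f x = f b ↔ _
    rw [eq_comm]
    exact QuotientGroup.eq
  have hempty : ∀ q, (∀ b, f b ≠ q) → f ⁻¹' {q} = ∅ := fun q hq =>
    Set.eq_empty_of_forall_notMem fun x hx => hq x hx
  have hmeas : ∀ q, MeasurableSet (f ⁻¹' {q}) := fun q => by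
    by_cases hq : ∃ b, f b = q
    · obtain ⟨b, rfl⟩ := hq
      rw [hfib]
      exact measurableSet_oddCoset hNo b
    · push Not at hq
      rw [hempty q hq]
      exact MeasurableSet.empty
  have hsum := sum_measure_preimage_singleton (μ := μ) Finset.univ (fun q _ => hmeas q)
  have hterm : ∀ q, μ (f ⁻¹' {q}) = if q ∈ f '' oddIn K then μ (oddIn N) else 0 := by
    intro q
    split_ifs with hq
    · obtain ⟨b, hb, rfl⟩ := hq
      rw [hfib, ← oddCoset_one]
      exact h.eq N hNn hNσ hNo hNK b hb 1 K.one_mem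
    · refine measure_mono_null (fun x hx => ?_) h.compl
      rintro hxK
      exact hq ⟨x, hxK, hx⟩
  rw [Finset.sum_congr rfl fun q _ => hterm q, ← Finset.sum_filter, Finset.sum_const,
    Finset.coe_univ, Set.preimage_univ, measure_univ, nsmul_eq_mul] at hsum
  rw [mul_comm] at hsum
  rw [ENNReal.eq_inv_of_mul_eq_one_left hsum]
  congr 2
  rw [Nat.card_eq_card_toFinset]
  congr 1
  ext q
  simp [f]

/-- The measure that is uniform on the odd part of `K` is unique. -/
theorem IsUniformOn.unique {K : Subgroup (FreeProP p n)} [hKn : K.Normal]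
    [hKσ : IsSigmaInvariant K] (hKo : IsOpen (K : Set (FreeProP p n)))
    {μ ν : Measure (OddPart (FreeProP p n))} (hμ : IsUniformOn K μ) (hν : IsUniformOn K ν) :
    μ = ν := by
  have := hμ.prob
  have := hν.prob
  -- the cosets of open normal subgroups form a basis that is stable under nonempty intersections
  let C : Set (Set (OddPart (FreeProP p n))) := {A | ∃ (N : Subgroup (FreeProP p n))
    (_ : N.Normal) (_ : IsSigmaInvariant N) (_ : IsOpen (N : Set (FreeProP p n)))
    (b : OddPart (FreeProP p n)), A = oddCoset N b}
  have hbasis : TopologicalSpace.IsTopologicalBasis C := by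
    refine TopologicalSpace.isTopologicalBasis_of_isOpen_of_nhds ?_ ?_
    · rintro _ ⟨N, _, _, hNo, b, rfl⟩
      exact isOpen_oddCoset hNo b
    · intro a U haU hU
      obtain ⟨V, hV, rfl⟩ := isOpen_induced_iff.mp hU
      obtain ⟨M, hMn, hMσ, hMo, hM⟩ := exists_open_normal_le
        (U := (fun y => (a : FreeProP p n) * y) ⁻¹' V) (hV.preimage (continuous_const_mul _))
        (by simpa using haU)
      refine ⟨oddCoset M a, ⟨M, hMn, hMσ, hMo, a, rfl⟩, ?_, fun x hx => ?_⟩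
      · change (a : FreeProP p n)⁻¹ * a ∈ M
        rw [inv_mul_cancel]
        exact M.one_mem
      · have := hM hx
        change (a : FreeProP p n) * ((a : FreeProP p n)⁻¹ * x) ∈ V at this
        rwa [mul_inv_cancel_left] at this
  refine ext_of_generate_finite C ?_ ?_ ?_ (by rw [measure_univ, measure_univ])
  · rw [← hbasis.borel_eq_generateFrom]
    exact BorelSpace.measurable_eq
  · rintro _ ⟨M, _, _, hMo, b, rfl⟩ _ ⟨N, _, _, hNo, c, rfl⟩ ⟨x, hxM, hxN⟩
    refine ⟨M ⊓ N, inferInstance, inferInstance, hMo.inter hNo, x, ?_⟩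
    rw [oddCoset_inf, oddCoset_eq hxM, oddCoset_eq hxN]
  · rintro _ ⟨N, hNn, hNσ, hNo, b, rfl⟩
    rw [← hμ.measure_inter, ← hν.measure_inter]
    rcases (oddCoset N b ∩ oddIn K).eq_empty_or_nonempty with he | ⟨x, hxN, hxK⟩
    · rw [he, measure_empty, measure_empty]
    · rw [oddCoset_eq hxN, ← oddCoset_of_mem hxK, ← oddCoset_inf]
      have hle : N ⊓ K ≤ K := inf_le_right
      have ho : IsOpen ((N ⊓ K : Subgroup _) : Set (FreeProP p n)) := hNo.inter hKo
      rw [hμ.eq _ inferInstance inferInstance ho hle x hxK 1 K.one_mem,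
        hν.eq _ inferInstance inferInstance ho hle x hxK 1 K.one_mem, oddCoset_one,
        hμ.measure_oddIn inferInstance inferInstance ho hle,
        hν.measure_oddIn inferInstance inferInstance ho hle]

/-- Images of uniform measures under surjective `σ`-homomorphisms are uniform. -/
theorem IsUniformOn.map (hp2 : p ≠ 2) {K : Subgroup (FreeProP p n)} [hKn : K.Normal]
    [hKσ : IsSigmaInvariant K] (hKo : IsOpen (K : Set (FreeProP p n)))
    {μ : Measure (OddPart (FreeProP p n))} (hμ : IsUniformOn K μ)
    (β : SigmaEpi (FreeProP p n) (FreeProP p m)) {K' : Subgroup (FreeProP p m)}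
    (hK' : IsOpen (K' : Set (FreeProP p m))) (h : K.map β.toMonoidHom = K') :
    IsUniformOn K' (μ.map (oddMap β)) := by
  have := hμ.prob
  have hβ : Measurable (oddMap β) := (continuous_oddMap β).measurable
  refine ⟨Measure.isProbabilityMeasure_map hβ.aemeasurable, ?_, ?_⟩
  · rw [Measure.map_apply hβ (isOpen_oddIn hK').measurableSet.compl]
    refine measure_mono_null (fun x hx => ?_) hμ.compl
    refine fun hxK => hx ?_
    change β.toMonoidHom x ∈ K'
    rw [← h]
    exact ⟨x, hxK, rfl⟩
  · intro N hNn hNσ hNo hNK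
    have hKc := Subgroup.isClosed_of_isOpen K hKo
    have ho : IsOpen ((N.comap β.toMonoidHom ⊓ K : Subgroup _) : Set (FreeProP p n)) :=
      (hNo.preimage β.continuous).inter hKo
    suffices key : ∀ b ∈ oddIn K',
        μ.map (oddMap β) (oddCoset N b) = μ (oddIn (N.comap β.toMonoidHom ⊓ K)) from
      fun b hb c hc => (key b hb).trans (key c hc).symm
    intro b hb
    have hb' : (b : FreeProP p m) ∈ K.map β.toMonoidHom := by rw [h]; exact hb
    obtain ⟨a, haK, haσ, ha⟩ := exists_odd_lift hp2 β hKc b.2 hb'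
    let a' : OddPart (FreeProP p n) := ⟨a, haσ⟩
    have ha'K : a' ∈ oddIn K := haK
    rw [Measure.map_apply hβ (measurableSet_oddCoset hNo b), ← oddCoset_one,
      hμ.eq _ inferInstance inferInstance ho inf_le_right 1 K.one_mem a' ha'K, oddCoset_inf,
      oddCoset_of_mem (N := K) (b := a') haK, hμ.measure_inter]
    congr 1
    ext x
    change (b : FreeProP p m)⁻¹ * β.toMonoidHom x ∈ N ↔ β.toMonoidHom (a⁻¹ * x) ∈ N
    rw [map_mul, map_inv, ha]

theorem isUniformOn_oddHaar (hp2 : p ≠ 2) : IsUniformOn (⊤ : Subgroup (FreeProP p n))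
    (oddHaar p n) := by
  obtain ⟨h1, h2⟩ := isOddHaar_oddHaar p n hp2
  refine ⟨h1, ?_, fun N hNn hNσ hNo _ b _ c _ => h2 N hNn hNσ hNo b c⟩
  convert measure_empty (μ := oddHaar p n)
  ext x
  simp [oddIn]

theorem measure_oddCoset (hp2 : p ≠ 2) (N : Subgroup (FreeProP p n)) [hNn : N.Normal]
    [hNσ : IsSigmaInvariant N] (hNo : IsOpen (N : Set (FreeProP p n)))
    (b : OddPart (FreeProP p n)) : oddHaar p n (oddCoset N b) = oddHaar p n (oddIn N) := by
  rw [← oddCoset_one]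
  exact (isOddHaar_oddHaar p n hp2).2 N hNn hNσ hNo b 1

theorem isProbabilityMeasure_oddHaar (hp2 : p ≠ 2) : IsProbabilityMeasure (oddHaar p n) :=
  (isOddHaar_oddHaar p n hp2).1

theorem map_oddHaar (hp2 : p ≠ 2) (β : SigmaEpi (FreeProP p n) (FreeProP p m)) :
    (oddHaar p n).map (oddMap β) = oddHaar p m :=
  IsUniformOn.unique isOpen_univ
    ((isUniformOn_oddHaar hp2).map hp2 isOpen_univ β isOpen_univ
      (Subgroup.map_top_of_surjective _ β.surj)) (isUniformOn_oddHaar hp2)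

theorem measure_oddIn_ne_zero (hp2 : p ≠ 2) (N : Subgroup (FreeProP p n)) [hNn : N.Normal]
    [hNσ : IsSigmaInvariant N] (hNo : IsOpen (N : Set (FreeProP p n))) :
    oddHaar p n (oddIn N) ≠ 0 := by
  rw [(isUniformOn_oddHaar hp2).measure_oddIn hNn hNσ hNo le_top]
  exact ENNReal.inv_ne_zero.mpr (ENNReal.natCast_ne_top _)

variable (p n) in
/-- The Haar measure on the odd part of the Frattini subgroup. -/
noncomputable def frattiniHaar : Measure (OddPart (FreeProP p n)) :=
  (oddHaar p n (oddIn (proFrattini p (FreeProP p n))))⁻¹ •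
    (oddHaar p n).restrict (oddIn (proFrattini p (FreeProP p n)))

theorem isUniformOn_frattiniHaar (hp2 : p ≠ 2) :
    IsUniformOn (proFrattini p (FreeProP p n)) (frattiniHaar p n) := by
  have hprob := isProbabilityMeasure_oddHaar (p := p) (n := n) hp2
  have ho := isOpen_oddIn (isOpen_proFrattini (p := p) (n := n))
  refine ⟨⟨?_⟩, ?_, ?_⟩
  · rw [frattiniHaar, Measure.smul_apply, Measure.restrict_apply_univ, smul_eq_mul]
    exact ENNReal.inv_mul_cancel (measure_oddIn_ne_zero hp2 _ isOpen_proFrattini)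
      (measure_ne_top _ _)
  · rw [frattiniHaar, Measure.smul_apply, Measure.restrict_apply ho.measurableSet.compl]
    simp
  · intro N hNn hNσ hNo hNK b hb c hc
    have key : ∀ b ∈ oddIn (proFrattini p (FreeProP p n)),
        oddCoset N b ∩ oddIn (proFrattini p (FreeProP p n)) = oddCoset N b := by
      intro b hb
      refine Set.inter_eq_left.mpr fun x hx => ?_
      exact (Subgroup.mul_mem_cancel_left _ (Subgroup.inv_mem _ hb)).mp (hNK hx)
    rw [frattiniHaar, Measure.smul_apply, Measure.smul_apply,
      Measure.restrict_apply (measurableSet_oddCoset hNo b),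
      Measure.restrict_apply (measurableSet_oddCoset hNo c), key b hb, key c hc,
      measure_oddCoset hp2 N hNo b, measure_oddCoset hp2 N hNo c]

theorem map_proFrattini (β : SigmaEpi (FreeProP p n) (FreeProP p m)) :
    (proFrattini p (FreeProP p n)).map β.toMonoidHom = proFrattini p (FreeProP p m) := by
  apply le_antisymm
  · rw [Subgroup.map_le_iff_le_comap]
    exact proFrattini_le_comap _ β.continuous
  · rw [proFrattini_eq (G := FreeProP p m), proFrattini_eq (G := FreeProP p n)]
    refine centralFrattini_le
      ((isClosed_centralFrattini _).isCompact.image β.continuous).isClosed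
      (fun x _ => ?_) fun x _ y => ?_
    · obtain ⟨x, rfl⟩ := β.surj x
      exact ⟨x ^ p, pow_mem_centralFrattini (Subgroup.mem_top x), map_pow _ _ _⟩
    · obtain ⟨x, rfl⟩ := β.surj x
      obtain ⟨y, rfl⟩ := β.surj y
      exact ⟨_, commutator_mem_centralFrattini (Subgroup.mem_top x) y, by
        rw [map_mul, map_mul, map_mul, map_inv, map_inv]⟩

theorem map_frattiniHaar (hp2 : p ≠ 2) (β : SigmaEpi (FreeProP p n) (FreeProP p m)) :
    (frattiniHaar p n).map (oddMap β) = frattiniHaar p m :=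
  IsUniformOn.unique isOpen_proFrattini
    ((isUniformOn_frattiniHaar hp2).map hp2 isOpen_proFrattini β isOpen_proFrattini
      (map_proFrattini β)) (isUniformOn_frattiniHaar hp2)

/-! ### Random elements of an elementary abelian section -/

/-- The involution acts by inversion on the Frattini quotient of `F_n`. -/
theorem frattiniCoordinates_sigma (x : FreeProP p n) :
    (frattiniCoordinates p n).toFun (sigma x) = -(frattiniCoordinates p n).toFun x := by
  have key : (exponents p n).comp (sigma (G := FreeProP p n)).toMonoidHom =
      (exponents p n)⁻¹ := by
    refine hom_ext (continuous_exponents.comp (sigma (G := FreeProP p n)).continuous_toFun)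
      (continuous_exponents.inv) fun i => ?_
    change exponents p n (sigma (gen i)) = (exponents p n (gen i))⁻¹
    rw [sigma_gen, map_inv]
  exact congrArg Multiplicative.toAdd (DFunLike.congr_fun key x)

section Sections

variable {L L' : Subgroup (FreeProP p n)}

/-- If `σ` acts on `L / L'` by inversion, every coordinate vector is that of an odd element. -/
theorem exists_odd_toFun_eq (hp2 : p ≠ 2) (c : Coordinates p L L' m) [hLσ : IsSigmaInvariant L]
    (hσ : ∀ x ∈ L, c.toFun (sigma x) = -c.toFun x) (v : Fin m → ZMod p) :
    ∃ b : OddPart (FreeProP p n), (b : FreeProP p n) ∈ L ∧ c.toFun b = v := by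
  obtain ⟨x, hx, hxv⟩ := c.surj ((2 : ZMod p)⁻¹ • v)
  have hsx := hLσ.sigma_mem x hx
  refine ⟨⟨x * (sigma x)⁻¹, by
    rw [map_mul, map_inv, sigma_sigma, mul_inv_rev, inv_inv]⟩,
    L.mul_mem hx (L.inv_mem hsx), ?_⟩
  change c.toFun (x * (sigma x)⁻¹) = v
  have h2 : (2 : ZMod p) ≠ 0 := by
    intro h
    have h' : ((2 : ℕ) : ZMod p) = 0 := by exact_mod_cast h
    rw [ZMod.natCast_eq_zero_iff] at h'
    exact hp2 ((Nat.prime_dvd_prime_iff_eq hp.out Nat.prime_two).mp h')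
  rw [c.map_mul _ hx _ (L.inv_mem hsx), c.map_inv hsx, hσ x hx, neg_neg, hxv, ← two_smul (ZMod p),
    smul_smul, mul_inv_cancel₀ h2, one_smul]

/-- The set of odd elements of `L` with given coordinate vector. -/
def oddFibre (c : Coordinates p L L' m) (v : Fin m → ZMod p) : Set (OddPart (FreeProP p n)) :=
  {x | (x : FreeProP p n) ∈ L ∧ c.toFun x = v}

theorem oddFibre_eq (c : Coordinates p L L' m) (hle : L' ≤ L) {b : OddPart (FreeProP p n)}
    (hb : (b : FreeProP p n) ∈ L) : oddFibre c (c.toFun b) = oddCoset L' b := by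
  ext x
  change _ ∧ _ ↔ (b : FreeProP p n)⁻¹ * x ∈ L'
  constructor
  · rintro ⟨hx, hxb⟩
    exact (c.eq_iff hb hx).mp hxb.symm
  · intro h
    have hx : (x : FreeProP p n) ∈ L :=
      (Subgroup.mul_mem_cancel_left L (L.inv_mem hb)).mp (hle h)
    exact ⟨hx, ((c.eq_iff hb hx).mpr h).symm⟩

variable [L'.Normal] [IsSigmaInvariant L'] [IsSigmaInvariant L]

theorem measurableSet_oddFibre (hp2 : p ≠ 2) (c : Coordinates p L L' m) (hle : L' ≤ L)
    (hL' : IsOpen (L' : Set (FreeProP p n))) (hσ : ∀ x ∈ L, c.toFun (sigma x) = -c.toFun x)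
    (v : Fin m → ZMod p) : MeasurableSet (oddFibre c v) := by
  obtain ⟨b, hb, rfl⟩ := exists_odd_toFun_eq hp2 c hσ v
  rw [oddFibre_eq c hle hb]
  exact measurableSet_oddCoset hL' b

theorem measure_oddFibre (hp2 : p ≠ 2) (c : Coordinates p L L' m) (hle : L' ≤ L)
    (hL' : IsOpen (L' : Set (FreeProP p n))) (hσ : ∀ x ∈ L, c.toFun (sigma x) = -c.toFun x)
    (v : Fin m → ZMod p) : oddHaar p n (oddFibre c v) = oddHaar p n (oddIn L') := by
  obtain ⟨b, hb, rfl⟩ := exists_odd_toFun_eq hp2 c hσ v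
  rw [oddFibre_eq c hle hb, measure_oddCoset hp2 L' hL']

/-- If `σ` acts on `L / L'` by inversion, all `p^m` cosets of `L'` in `L` contain odd elements,
with the same probability. -/
theorem measure_oddIn_eq (hp2 : p ≠ 2) (c : Coordinates p L L' m) (hle : L' ≤ L)
    (hL' : IsOpen (L' : Set (FreeProP p n))) (hσ : ∀ x ∈ L, c.toFun (sigma x) = -c.toFun x) :
    oddHaar p n (oddIn L) = p ^ m * oddHaar p n (oddIn L') := by
  have hu : oddIn L = ⋃ v ∈ (Finset.univ : Finset (Fin m → ZMod p)), oddFibre c v := by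
    ext x
    simp [oddIn, oddFibre]
  rw [hu, measure_biUnion_finset]
  · rw [Finset.sum_congr rfl fun v _ => measure_oddFibre hp2 c hle hL' hσ v]
    simp
  · intro v _ w _ hvw
    exact Set.disjoint_left.mpr fun x hx hx' => hvw (hx.2.symm.trans hx'.2)
  · exact fun v _ => measurableSet_oddFibre hp2 c hle hL' hσ v

/-- The probability that `k` random odd elements lie in `L` and span `L / L'` is determined by
the number of spanning `k`-tuples. -/
theorem measure_span_eq_top (hp2 : p ≠ 2) (c : Coordinates p L L' m) (hle : L' ≤ L)
    (hL' : IsOpen (L' : Set (FreeProP p n))) (hσ : ∀ x ∈ L, c.toFun (sigma x) = -c.toFun x)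
    (k : ℕ) :
    Measure.pi (fun _ : Fin k => oddHaar p n)
      {r | (∀ i, (r i : FreeProP p n) ∈ L) ∧
        Submodule.span (ZMod p) (Set.range fun i => c.toFun (r i)) = ⊤} =
    Nat.card {v : Fin k → Fin m → ZMod p // Submodule.span (ZMod p) (Set.range v) = ⊤} *
      oddHaar p n (oddIn L') ^ k := by
  classical
  have hprob := isProbabilityMeasure_oddHaar (p := p) (n := n) hp2
  let S : Finset (Fin k → Fin m → ZMod p) :=
    Finset.univ.filter fun v => Submodule.span (ZMod p) (Set.range v) = ⊤
  have hu : {r : Fin k → OddPart (FreeProP p n) | (∀ i, (r i : FreeProP p n) ∈ L) ∧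
        Submodule.span (ZMod p) (Set.range fun i => c.toFun (r i)) = ⊤} =
      ⋃ v ∈ S, Set.pi Set.univ fun i => oddFibre c (v i) := by
    ext r
    simp only [Set.mem_ofPred_eq, Set.mem_iUnion, Set.mem_pi, Set.mem_univ, true_implies]
    constructor
    · rintro ⟨h1, h2⟩
      exact ⟨fun i => c.toFun (r i), by simpa [S] using h2, fun i => ⟨h1 i, rfl⟩⟩
    · rintro ⟨v, hv, h⟩
      have : (fun i => c.toFun (r i)) = v := funext fun i => (h i).2
      rw [this]
      exact ⟨fun i => (h i).1, by simpa [S] using hv⟩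
  rw [hu, measure_biUnion_finset]
  · have hterm : ∀ v ∈ S, Measure.pi (fun _ : Fin k => oddHaar p n)
        (Set.pi Set.univ fun i => oddFibre c (v i)) = oddHaar p n (oddIn L') ^ k := fun v _ => by
      rw [Measure.pi_pi, Finset.prod_congr rfl fun i _ => measure_oddFibre hp2 c hle hL' hσ (v i)]
      simp
    rw [Finset.sum_congr rfl hterm, Finset.sum_const, nsmul_eq_mul]
    congr 2
    rw [Nat.card_eq_fintype_card, Fintype.card_subtype]
  · intro v _ w _ hvw
    obtain ⟨i, hi⟩ := Function.ne_iff.mp hvw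
    refine Set.disjoint_left.mpr fun x hx hx' => hi ?_
    exact (hx i trivial).2.symm.trans (hx' i trivial).2
  · exact fun v _ => MeasurableSet.univ_pi fun i => measurableSet_oddFibre hp2 c hle hL' hσ (v i)

end Sections

theorem measure_oddIn_proFrattini (hp2 : p ≠ 2) :
    p ^ n * oddHaar p n (oddIn (proFrattini p (FreeProP p n))) = 1 := by
  have hprob := isProbabilityMeasure_oddHaar (p := p) (n := n) hp2
  rw [← measure_oddIn_eq hp2 (frattiniCoordinates p n) le_top isOpen_proFrattini
    fun x _ => frattiniCoordinates_sigma x]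
  have : oddIn (⊤ : Subgroup (FreeProP p n)) = Set.univ := by
    ext x
    simp [oddIn]
  rw [this, measure_univ]

end FreeProP

/-! ### Relation subgroups and the continuity of `Θ_n` -/

section Theta

variable {p n m : ℕ}

theorem isClosed_relSubgroup (r : Fin n → OddPart (FreeProP p n)) :
    IsClosed (relSubgroup r : Set (FreeProP p n)) := Subgroup.isClosed_topologicalClosure _

theorem mem_relSubgroup (r : Fin n → OddPart (FreeProP p n)) (i : Fin n) :
    (r i : FreeProP p n) ∈ relSubgroup r :=
  Subgroup.le_topologicalClosure _ (Subgroup.subset_normalClosure ⟨i, rfl⟩)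

theorem relSubgroup_le {r : Fin n → OddPart (FreeProP p n)} {K : Subgroup (FreeProP p n)}
    [K.Normal] (hK : IsClosed (K : Set (FreeProP p n))) (h : ∀ i, (r i : FreeProP p n) ∈ K) :
    relSubgroup r ≤ K := by
  refine Subgroup.topologicalClosure_minimal _ (Subgroup.normalClosure_le_normal ?_) hK
  rintro _ ⟨i, rfl⟩
  exact h i

instance t2Space_schurGroup (r : Fin n → OddPart (FreeProP p n)) : T2Space (SchurGroup r) := by
  have := isClosed_relSubgroup r
  infer_instance

instance t2Space_quotient_zassenhaus {G : Type u} [Group G] [TopologicalSpace G]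
    [IsTopologicalGroup G] (i : ℕ) : T2Space (G ⧸ zassenhaus p G i) := by
  have := isClosed_zassenhaus (p := p) (G := G) i
  infer_instance

theorem theta_eq_iff {r : Fin n → OddPart (FreeProP p n)} {s : Fin m → OddPart (FreeProP p m)} :
    theta p n r = theta p m s ↔ Nonempty (SigmaIso (SchurGroup r) (SchurGroup s)) :=
  Quotient.eq

theorem exists_theta_eq (q : Sch p) : ∃ (n : ℕ) (r : Fin n → OddPart (FreeProP p n)),
    theta p n r = q := by
  obtain ⟨⟨n, r⟩, rfl⟩ := Quotient.exists_rep q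
  exact ⟨n, r, rfl⟩

theorem nonempty_iso_quotient_zassenhaus {A : Type u} [Group A] [TopologicalSpace A]
    [IsTopologicalGroup A] [SigmaGroup A] [CompactSpace A] {B : Type v} [Group B]
    [TopologicalSpace B] [IsTopologicalGroup B] [SigmaGroup B] [T2Space B]
    (e : SigmaIso A B) (i : ℕ) :
    Nonempty (SigmaIso (A ⧸ zassenhaus p A i) (B ⧸ zassenhaus p B i)) := by
  have hk : (mkEpi (zassenhaus p A i)).toMonoidHom.ker =
      ((mkEpi (zassenhaus p B i)).comp e.toEpi).toMonoidHom.ker := by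
    rw [ker_mkEpi, SigmaEpi.ker_comp, ker_mkEpi,
      ← zassenhaus_map_eq p e.toEpi.toMonoidHom e.toEpi.continuous e.toEpi.surj,
      Subgroup.comap_map_eq, (MonoidHom.ker_eq_bot_iff _).mpr e.toContinuousMulEquiv.injective,
      sup_bot_eq]
  exact ⟨(SigmaEpi.exists_iso_of_ker_eq _ _ hk).choose⟩

variable [hp : Fact p.Prime]

/-- The kernel of `F_n → G → G / D_i(G)`. -/
theorem ker_mkEpi_zassenhaus_comp {A : Type u} [Group A] [TopologicalSpace A]
    [IsTopologicalGroup A] [SigmaGroup A] [T2Space A] (π : SigmaEpi (FreeProP p n) A) (i : ℕ) :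
    ((mkEpi (zassenhaus p A i)).comp π).toMonoidHom.ker =
      π.toMonoidHom.ker ⊔ zassenhaus p (FreeProP p n) i := by
  rw [SigmaEpi.ker_comp, ker_mkEpi, ← zassenhaus_map_eq p _ π.continuous π.surj,
    Subgroup.comap_map_eq, sup_comm]

theorem relSubgroup_sup_le {M : Subgroup (FreeProP p n)} [M.Normal]
    (hM : IsOpen (M : Set (FreeProP p n))) {r s : Fin n → OddPart (FreeProP p n)}
    (h : ∀ i, (r i : FreeProP p n)⁻¹ * s i ∈ M) : relSubgroup s ⊔ M ≤ relSubgroup r ⊔ M := by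
  refine sup_le (relSubgroup_le (Subgroup.isClosed_of_isOpen _
    (Subgroup.isOpen_mono le_sup_right hM)) fun i => ?_) le_sup_right
  rw [← mul_inv_cancel_left (r i : FreeProP p n) (s i)]
  exact Subgroup.mul_mem_sup (mem_relSubgroup r i) (h i)

/-- Relations that agree modulo an open subgroup define the same group modulo that subgroup. -/
theorem relSubgroup_sup_eq {M : Subgroup (FreeProP p n)} [M.Normal]
    (hM : IsOpen (M : Set (FreeProP p n))) {r s : Fin n → OddPart (FreeProP p n)}
    (h : ∀ i, (r i : FreeProP p n)⁻¹ * s i ∈ M) : relSubgroup s ⊔ M = relSubgroup r ⊔ M := by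
  refine le_antisymm (relSubgroup_sup_le hM h) (relSubgroup_sup_le hM fun i => ?_)
  have := M.inv_mem (h i)
  rwa [mul_inv_rev, inv_inv] at this

theorem theta_mem_basicOpen {r : Fin n → OddPart (FreeProP p n)} {i : ℕ} {b : Presentation p} :
    theta p n r ∈ basicOpen i b ↔
      Nonempty (SigmaIso (SchurGroup r ⧸ zassenhaus p (SchurGroup r) i)
        (SchurGroup b.2 ⧸ zassenhaus p (SchurGroup b.2) i)) := by
  constructor
  · rintro ⟨⟨m, s⟩, hs, ⟨f⟩⟩
    obtain ⟨e⟩ := theta_eq_iff.mp (show theta p m s = theta p n r from hs)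
    obtain ⟨e'⟩ := nonempty_iso_quotient_zassenhaus (p := p) e i
    exact ⟨e'.symm.trans f⟩
  · exact fun h => ⟨⟨n, r⟩, rfl, h⟩

/-- The map `Θ_n` is continuous: `G_r / D_i(G_r)` depends only on `r` modulo the open subgroup
`D_i(F_n)`. -/
theorem continuous_theta : Continuous (theta p n) := by
  refine continuous_generateFrom_iff.mpr ?_
  rintro _ ⟨i, -, b, rfl⟩
  rw [isOpen_iff_mem_nhds]
  intro r hr
  obtain ⟨f⟩ := theta_mem_basicOpen.mp hr
  have hD := FreeProP.isOpen_zassenhaus (p := p) (n := n) i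
  have hU : {s : Fin n → OddPart (FreeProP p n) | ∀ j,
      (r j : FreeProP p n)⁻¹ * s j ∈ zassenhaus p (FreeProP p n) i} ∈ 𝓝 r := by
    refine IsOpen.mem_nhds ?_ fun j => ?_
    · rw [Set.ofPred_forall]
      refine isOpen_iInter_of_finite fun j => ?_
      have hc : Continuous fun s : Fin n → OddPart (FreeProP p n) => s j := continuous_apply j
      exact (FreeProP.isOpen_oddCoset hD (r j)).preimage hc
    · rw [inv_mul_cancel]
      exact one_mem _
  refine mem_of_superset hU fun s hs => ?_
  refine theta_mem_basicOpen.mpr ?_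
  have hk : ((mkEpi (zassenhaus p (SchurGroup s) i)).comp (mkEpi (relSubgroup s))).toMonoidHom.ker =
      ((mkEpi (zassenhaus p (SchurGroup r) i)).comp (mkEpi (relSubgroup r))).toMonoidHom.ker := by
    rw [ker_mkEpi_zassenhaus_comp, ker_mkEpi_zassenhaus_comp, ker_mkEpi, ker_mkEpi,
      relSubgroup_sup_eq hD hs]
  exact ⟨(SigmaEpi.exists_iso_of_ker_eq _ _ hk).choose.trans f⟩

theorem measurable_theta : Measurable (theta p n) := continuous_theta.measurable

/-- A relation outside the Frattini subgroup can be used to eliminate a generator. -/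
theorem theta_succ_eq {r : Fin (n + 1) → OddPart (FreeProP p (n + 1))} {k : Fin (n + 1)}
    {β : SigmaEpi (FreeProP p (n + 1)) (FreeProP p n)} (h1 : β.toMonoidHom (r k) = 1)
    (h2 : ∀ K : Subgroup (FreeProP p (n + 1)), K.Normal →
        IsClosed (K : Set (FreeProP p (n + 1))) → (r k : FreeProP p (n + 1)) ∈ K →
        β.toMonoidHom.ker ≤ K) :
    theta p (n + 1) r = theta p n fun j => FreeProP.oddMap β (r (k.succAbove j)) := by
  set s : Fin n → OddPart (FreeProP p n) := fun j => FreeProP.oddMap β (r (k.succAbove j))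
  have hcr := isClosed_relSubgroup r
  have hk : (mkEpi (relSubgroup r)).toMonoidHom.ker =
      ((mkEpi (relSubgroup s)).comp β).toMonoidHom.ker := by
    rw [SigmaEpi.ker_comp, ker_mkEpi, ker_mkEpi]
    apply le_antisymm
    · have := (inferInstance : (relSubgroup s).Normal).comap β.toMonoidHom
      refine relSubgroup_le ((isClosed_relSubgroup s).preimage β.continuous) fun i => ?_
      rcases Fin.eq_self_or_eq_succAbove k i with rfl | ⟨l, rfl⟩
      · rw [Subgroup.mem_comap, h1]
        exact one_mem _
      · exact mem_relSubgroup s l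
    · have hle : relSubgroup s ≤ (relSubgroup r).map β.toMonoidHom := by
        have : ((relSubgroup r).map β.toMonoidHom).Normal :=
          (inferInstance : (relSubgroup r).Normal).map _ β.surj
        exact relSubgroup_le (hcr.isCompact.image β.continuous).isClosed
          fun j => ⟨_, mem_relSubgroup r (k.succAbove j), rfl⟩
      refine (Subgroup.comap_mono hle).trans ?_
      rw [Subgroup.comap_map_eq]
      exact sup_le le_rfl (h2 _ inferInstance hcr (mem_relSubgroup r k))
  exact theta_eq_iff.mpr ⟨(SigmaEpi.exists_iso_of_ker_eq _ _ hk).choose⟩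

end Theta

/-! ### Eliminating generators from random presentations -/

section Laws

variable {p n : ℕ} [hp : Fact p.Prime]

/-- Fubini's theorem for one of finitely many coordinates. -/
theorem pi_apply_eq_lintegral_insertNth {α : Type u} [MeasurableSpace α] {n : ℕ}
    (μ : Fin (n + 1) → Measure α) [∀ i, IsProbabilityMeasure (μ i)] (k : Fin (n + 1))
    {S : Set (Fin (n + 1) → α)} (hS : MeasurableSet S) :
    Measure.pi μ S = ∫⁻ y, Measure.pi (fun j => μ (k.succAbove j))
      {r | k.insertNth y r ∈ S} ∂(μ k) := by
  have h := (measurePreserving_piFinSuccAbove μ k).symm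
  rw [← h.measure_preimage hS.nullMeasurableSet, Measure.prod_apply (h.measurable hS)]
  rfl

variable (p n) in
/-- The law of `n` independent relations, of which the first `k` are uniform on the odd part of
`F_n`, and the others on the odd part of its Frattini subgroup. -/
noncomputable def mixedMeasure (k : ℕ) (i : Fin n) : Measure (OddPart (FreeProP p n)) :=
  if (i : ℕ) < k then oddHaar p n else FreeProP.frattiniHaar p n

theorem isProbabilityMeasure_mixedMeasure (hp2 : p ≠ 2) (k : ℕ) (i : Fin n) :
    IsProbabilityMeasure (mixedMeasure p n k i) := by
  rw [mixedMeasure]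
  split_ifs
  · exact FreeProP.isProbabilityMeasure_oddHaar hp2
  · exact (FreeProP.isUniformOn_frattiniHaar hp2).prob

variable (p n) in
/-- The law of the group defined by `n` random relations as in `mixedMeasure`. -/
noncomputable def mixedLaw (k : ℕ) : Measure (Sch p) :=
  (Measure.pi (mixedMeasure p n k)).map (theta p n)

theorem mixedLaw_self : mixedLaw p n n = schMeasure p n := by
  rw [mixedLaw, schMeasure]
  congr 2
  funext i
  rw [mixedMeasure, if_pos i.2]

theorem isProbabilityMeasure_mixedLaw (hp2 : p ≠ 2) (k : ℕ) :
    IsProbabilityMeasure (mixedLaw p n k) := by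
  have := isProbabilityMeasure_mixedMeasure (p := p) (n := n) hp2 k
  exact Measure.isProbabilityMeasure_map measurable_theta.aemeasurable

theorem map_mixedMeasure (hp2 : p ≠ 2) (β : SigmaEpi (FreeProP p (n + 1)) (FreeProP p n))
    (ν : Fin n → Measure (OddPart (FreeProP p (n + 1)))) (k : ℕ)
    (hν : ν = fun j : Fin n =>
      if (j : ℕ) < k then oddHaar p (n + 1) else FreeProP.frattiniHaar p (n + 1)) :
    (Measure.pi ν).map (fun r j => FreeProP.oddMap β (r j)) = Measure.pi (mixedMeasure p n k) := by
  have key : (fun j => (ν j).map (FreeProP.oddMap β)) = mixedMeasure p n k := by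
    funext j
    rw [hν, mixedMeasure]
    dsimp only
    split_ifs
    · exact FreeProP.map_oddHaar hp2 β
    · exact FreeProP.map_frattiniHaar hp2 β
  have hprob := isProbabilityMeasure_mixedMeasure (p := p) (n := n) hp2 k
  have : ∀ j, SigmaFinite ((ν j).map (FreeProP.oddMap β)) := fun j => by
    rw [congrFun key j]
    infer_instance
  rw [Measure.pi_map_pi fun j => (FreeProP.continuous_oddMap β).measurable.aemeasurable]
  rw [key]

/-- The recursion that eliminates a generator by means of the `k`-th relation, whenever this
relation lies outside the Frattini subgroup. -/
theorem mixedLaw_succ (hp2 : p ≠ 2) {k : ℕ} (hk : k ≤ n) {A : Set (Sch p)}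
    (hA : MeasurableSet A) :
    mixedLaw p (n + 1) (k + 1) A =
      oddHaar p (n + 1) (FreeProP.oddIn (proFrattini p (FreeProP p (n + 1))))ᶜ *
        mixedLaw p n k A +
      oddHaar p (n + 1) (FreeProP.oddIn (proFrattini p (FreeProP p (n + 1)))) *
        mixedLaw p (n + 1) k A := by
  set Φ := FreeProP.oddIn (proFrattini p (FreeProP p (n + 1))) with hΦ
  have hΦm : MeasurableSet Φ := (FreeProP.isOpen_oddIn FreeProP.isOpen_proFrattini).measurableSet
  have hprob := FreeProP.isProbabilityMeasure_oddHaar (p := p) (n := n + 1) hp2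
  have hprob1 := isProbabilityMeasure_mixedMeasure (p := p) (n := n + 1) hp2 (k + 1)
  have hprob0 := isProbabilityMeasure_mixedMeasure (p := p) (n := n + 1) hp2 k
  -- both laws are integrals over the relation with index `k`, the others being distributed by `ν`
  let j : Fin (n + 1) := ⟨k, by omega⟩
  let ν : Fin n → Measure (OddPart (FreeProP p (n + 1))) :=
    fun i => if (i : ℕ) < k then oddHaar p (n + 1) else FreeProP.frattiniHaar p (n + 1)
  have hlt : ∀ i : Fin n, (i : ℕ) < k → ((j.succAbove i : Fin (n + 1)) : ℕ) = i := fun i hi => by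
    rw [Fin.succAbove_of_castSucc_lt _ _ (by simpa [j, Fin.lt_def] using hi)]; rfl
  have hge : ∀ i : Fin n, ¬ (i : ℕ) < k → ((j.succAbove i : Fin (n + 1)) : ℕ) = i + 1 :=
    fun i hi => by
      rw [Fin.succAbove_of_le_castSucc _ _ (by simpa [j, Fin.le_def] using hi)]; rfl
  have hν1 : (fun i => mixedMeasure p (n + 1) (k + 1) (j.succAbove i)) = ν := by
    funext i
    by_cases hi : (i : ℕ) < k
    · simp only [mixedMeasure, ν, hlt i hi, if_pos hi]
      rw [if_pos (by omega)]
    · simp only [mixedMeasure, ν, hge i hi, if_neg hi]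
      rw [if_neg (by omega)]
  have hν0 : (fun i => mixedMeasure p (n + 1) k (j.succAbove i)) = ν := by
    funext i
    by_cases hi : (i : ℕ) < k
    · simp only [mixedMeasure, ν, hlt i hi, if_pos hi]
    · simp only [mixedMeasure, ν, hge i hi, if_neg hi]
      rw [if_neg (by omega)]
  have hj1 : mixedMeasure p (n + 1) (k + 1) j = oddHaar p (n + 1) := if_pos (by simp [j])
  have hj0 : mixedMeasure p (n + 1) k j = FreeProP.frattiniHaar p (n + 1) := if_neg (by simp [j])
  have hS : MeasurableSet (theta p (n + 1) ⁻¹' A) := measurable_theta hA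
  let f : OddPart (FreeProP p (n + 1)) → ENNReal := fun y =>
    Measure.pi ν {r | j.insertNth y r ∈ theta p (n + 1) ⁻¹' A}
  have hL1 : mixedLaw p (n + 1) (k + 1) A = ∫⁻ y, f y ∂(oddHaar p (n + 1)) := by
    rw [mixedLaw, Measure.map_apply measurable_theta hA, pi_apply_eq_lintegral_insertNth _ j hS,
      hν1, hj1]
  have hL0 : mixedLaw p (n + 1) k A = ∫⁻ y, f y ∂(FreeProP.frattiniHaar p (n + 1)) := by
    rw [mixedLaw, Measure.map_apply measurable_theta hA, pi_apply_eq_lintegral_insertNth _ j hS,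
      hν0, hj0]
  -- if that relation is outside the Frattini subgroup, it eliminates a generator
  have hf : ∀ y ∈ Φᶜ, f y = mixedLaw p n k A := by
    intro y hy
    obtain ⟨β, hβy, hβ⟩ := FreeProP.exists_epi_of_notMem y.2 hy
    have hmeas : Measurable fun (r : Fin n → OddPart (FreeProP p (n + 1))) i =>
        FreeProP.oddMap β (r i) :=
      measurable_pi_lambda _ fun i =>
        (FreeProP.continuous_oddMap β).measurable.comp (measurable_pi_apply i)
    rw [mixedLaw, Measure.map_apply measurable_theta hA, ← map_mixedMeasure hp2 β ν k rfl,
      Measure.map_apply hmeas (measurable_theta hA)]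
    change Measure.pi ν _ = Measure.pi ν _
    congr 1
    ext r
    change theta p (n + 1) (j.insertNth y r) ∈ A ↔ theta p n _ ∈ A
    rw [theta_succ_eq (k := j) (β := β) (by rw [Fin.insertNth_apply_same]; exact hβy)
      (by rw [Fin.insertNth_apply_same]; exact hβ)]
    simp only [Fin.insertNth_apply_succAbove]
  have hΦ0 : oddHaar p (n + 1) Φ ≠ 0 :=
    FreeProP.measure_oddIn_ne_zero hp2 _ FreeProP.isOpen_proFrattini
  rw [hL1, hL0, FreeProP.frattiniHaar, lintegral_smul_measure, ← hΦ, smul_eq_mul, ← mul_assoc,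
    ENNReal.mul_inv_cancel hΦ0 (measure_ne_top _ _), one_mul, ← lintegral_add_compl f hΦm,
    setLIntegral_congr_fun hΦm.compl hf, setLIntegral_const, add_comm, mul_comm]

end Laws

/-! ### The constants `C_k` and the distribution of the number of generators -/

section Constants

variable {p : ℕ} [hp : Fact p.Prime]

theorem constC_zero : constC p 0 = 1 := by simp [constC]

theorem constC_succ (k : ℕ) : constC p (k + 1) = constC p k * (1 - (p : ℝ)⁻¹ ^ (k + 1)) := by
  rw [constC, constC, Finset.prod_Icc_succ_top (by omega), inv_pow]

theorem inv_prime_pos : 0 < (p : ℝ)⁻¹ := inv_pos.mpr (by exact_mod_cast hp.out.pos)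

theorem inv_prime_le (hp2 : p ≠ 2) : (p : ℝ)⁻¹ ≤ 1 / 3 := by
  have h3 : 3 ≤ p := by
    have := hp.out.two_le
    omega
  rw [one_div]
  exact inv_anti₀ (by norm_num) (by exact_mod_cast h3)

/-- The summand `p^{-k} / 2` makes the induction for `C_k ≥ 1/2` work. -/
theorem constC_ge (hp2 : p ≠ 2) (k : ℕ) : 1 / 2 + (p : ℝ)⁻¹ ^ k / 2 ≤ constC p k := by
  induction k with
  | zero => rw [constC_zero]; norm_num
  | succ k ih =>
    have hq := inv_prime_pos (p := p)
    have hq3 := inv_prime_le hp2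
    rw [constC_succ]
    set q := (p : ℝ)⁻¹
    have hx : 0 < q ^ k := pow_pos hq k
    have hx1 : q ^ k ≤ 1 := pow_le_one₀ hq.le (by linarith)
    have hy : q ^ (k + 1) ≤ q ^ k / 3 := by
      rw [pow_succ]
      nlinarith
    have hy0 : 0 < q ^ (k + 1) := pow_pos hq _
    set x := q ^ k
    set y := q ^ (k + 1)
    nlinarith

theorem half_le_constC (hp2 : p ≠ 2) (k : ℕ) : 1 / 2 ≤ constC p k := by
  have := constC_ge hp2 k
  have hq : 0 < (p : ℝ)⁻¹ ^ k := pow_pos inv_prime_pos k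
  linarith

theorem constC_pos (hp2 : p ≠ 2) (k : ℕ) : 0 < constC p k := by
  have := half_le_constC hp2 k
  linarith

theorem constC_le_one (k : ℕ) : constC p k ≤ 1 := by
  refine Finset.prod_le_one (fun i _ => ?_) fun i _ => ?_
  · rw [sub_nonneg]
    exact inv_le_one_of_one_le₀ (one_le_pow₀ (by exact_mod_cast hp.out.one_le))
  · rw [sub_le_self_iff]
    positivity

theorem constC_eq_prod_range (k : ℕ) :
    constC p k = ∏ i ∈ Finset.range k, (1 - ((p : ℝ) ^ (i + 1))⁻¹) := by
  induction k with
  | zero => rw [constC_zero, Finset.prod_range_zero]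
  | succ k ih => rw [constC_succ, Finset.prod_range_succ, ih, inv_pow]

theorem tendsto_constC (hp2 : p ≠ 2) : Tendsto (constC p) atTop (𝓝 (constCInf p)) := by
  have hs : Summable fun i : ℕ => -((p : ℝ) ^ (i + 1))⁻¹ := by
    refine Summable.neg ?_
    have hq := inv_prime_pos (p := p)
    have := summable_geometric_of_lt_one hq.le (by linarith [inv_prime_le hp2])
    simpa [inv_pow] using (summable_nat_add_iff 1).mpr this
  have hm : Multipliable fun i : ℕ => 1 - ((p : ℝ) ^ (i + 1))⁻¹ := by
    simpa [sub_eq_add_neg] using Real.multipliable_one_add_of_summable hs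
  refine hm.hasProd.tendsto_prod_nat.congr fun k => ?_
  rw [constC_eq_prod_range]

theorem half_le_constCInf (hp2 : p ≠ 2) : 1 / 2 ≤ constCInf p :=
  ge_of_tendsto' (tendsto_constC hp2) (half_le_constC hp2)

variable (p) in
/-- The probability that `k` random vectors in `𝔽_p^{k+l}` span a subspace of codimension
`l + e`. -/
noncomputable def corankProb (k l e : ℕ) : ℝ :=
  if e ≤ k then (p : ℝ)⁻¹ ^ ((l + e) * e) * (constC p (k + l) * constC p k) /
    (constC p (l + e) * constC p e * constC p (k - e)) else 0

/-- Vectors are linearly independent if and only if the first is nonzero and the others are linearly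
independent modulo it. -/
theorem corankProb_zero_succ (hp2 : p ≠ 2) (k l : ℕ) :
    corankProb p (k + 1) l 0 = (1 - (p : ℝ)⁻¹ ^ (k + l + 1)) * corankProb p k l 0 := by
  have h1 := constC_pos hp2 l
  have h2 := constC_pos hp2 k
  have h3 := constC_pos hp2 (k + 1)
  rw [corankProb, corankProb, if_pos (Nat.zero_le _), if_pos (Nat.zero_le _),
    show k + 1 + l = k + l + 1 by omega, constC_succ (k + l), constC_zero]
  simp only [Nat.sub_zero, add_zero, mul_zero, pow_zero]
  field_simp

/-- Either the first vector is nonzero, and the others are considered modulo it, or it is zero,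
with probability `p^{-(k+l+1)}`, and the others have to span the subspace. -/
theorem corankProb_succ_succ (hp2 : p ≠ 2) (k l e : ℕ) :
    corankProb p (k + 1) l (e + 1) = (1 - (p : ℝ)⁻¹ ^ (k + l + 1)) * corankProb p k l (e + 1) +
      (p : ℝ)⁻¹ ^ (k + l + 1) * corankProb p k (l + 1) e := by
  have hN := constC_succ (p := p) (k + l)
  have hNpos := constC_pos hp2 (k + l + 1)
  have hk := constC_pos hp2 k
  have hk1 := constC_succ (p := p) k
  have hk1pos := constC_pos hp2 (k + 1)
  have he := constC_pos hp2 e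
  have he1 := constC_succ (p := p) e
  have he1pos := constC_pos hp2 (e + 1)
  have hle := constC_pos hp2 (l + (e + 1))
  rw [corankProb, corankProb, corankProb, show k + 1 + l = k + l + 1 by omega,
    show k + (l + 1) = k + l + 1 by omega, show l + 1 + e = l + (e + 1) by omega]
  rcases lt_trichotomy e k with h | rfl | h
  · obtain ⟨t, rfl⟩ : ∃ t, k = e + 1 + t := Nat.exists_eq_add_of_le h
    rw [if_pos (by omega), if_pos (by omega), if_pos (by omega),
      show e + 1 + t + 1 - (e + 1) = t + 1 by omega, show e + 1 + t - (e + 1) = t by omega,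
      show e + 1 + t - e = t + 1 by omega]
    have ht := constC_pos hp2 t
    have ht1 := constC_succ (p := p) t
    have ht1pos := constC_pos hp2 (t + 1)
    have hfe : (1 - (p : ℝ)⁻¹ ^ (e + 1)) ≠ 0 := fun h0 => by
      rw [h0, mul_zero] at he1; exact he1pos.ne' he1
    have hft : (1 - (p : ℝ)⁻¹ ^ (t + 1)) ≠ 0 := fun h0 => by
      rw [h0, mul_zero] at ht1; exact ht1pos.ne' ht1
    rw [hN, hk1, he1, ht1]
    generalize constC p (e + 1 + t + l) = cN
    generalize constC p (e + 1 + t) = ck at *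
    generalize constC p e = ce at *
    generalize constC p t = ct at *
    generalize constC p (l + (e + 1)) = cl at *
    have e1 : (p : ℝ)⁻¹ ^ ((l + (e + 1)) * (e + 1)) =
        (p : ℝ)⁻¹ ^ ((l + (e + 1)) * e) * (p : ℝ)⁻¹ ^ l * (p : ℝ)⁻¹ ^ (e + 1) := by ring
    have e2 : (p : ℝ)⁻¹ ^ (e + 1 + t + l + 1) =
        (p : ℝ)⁻¹ ^ (e + 1) * (p : ℝ)⁻¹ ^ (t + 1) * (p : ℝ)⁻¹ ^ l := by ring
    have e3 : (p : ℝ)⁻¹ ^ (e + 1 + t + 1) =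
        (p : ℝ)⁻¹ ^ (e + 1) * (p : ℝ)⁻¹ ^ (t + 1) := by ring
    rw [e1, e2, e3]
    generalize (p : ℝ)⁻¹ ^ ((l + (e + 1)) * e) = x1
    generalize (p : ℝ)⁻¹ ^ (e + 1) = x2 at *
    generalize (p : ℝ)⁻¹ ^ (t + 1) = x3 at *
    generalize (p : ℝ)⁻¹ ^ l = x4
    field_simp
    ring
  · rw [if_pos le_rfl, if_neg (by omega), if_pos le_rfl, mul_zero, zero_add, Nat.sub_self,
      Nat.sub_self, constC_zero, show l + (e + 1) = e + l + 1 by omega]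
    field_simp
    ring
  · rw [if_neg (by omega), if_neg (by omega), if_neg (by omega)]
    ring

theorem corankProb_nonneg (hp2 : p ≠ 2) (k l e : ℕ) : 0 ≤ corankProb p k l e := by
  rw [corankProb]
  have h1 := constC_pos hp2 (k + l)
  have h2 := constC_pos hp2 k
  have h3 := constC_pos hp2 (l + e)
  have h4 := constC_pos hp2 e
  have h5 := constC_pos hp2 (k - e)
  split_ifs <;> positivity

/-- A bound that is independent of `n` and summable over `d`. -/
theorem corankProb_le (hp2 : p ≠ 2) (n d : ℕ) : corankProb p n 0 d ≤ 8 * (p : ℝ)⁻¹ ^ d := by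
  have hq := inv_prime_pos (p := p)
  have hq3 := inv_prime_le hp2
  have hqd : 0 < (p : ℝ)⁻¹ ^ d := pow_pos hq d
  rw [corankProb]
  split_ifs
  · have h1 := constC_pos hp2 n
    have h1' := constC_le_one (p := p) n
    have h3 := half_le_constC hp2 d
    have h5 := half_le_constC hp2 (n - d)
    rw [add_zero, zero_add, div_le_iff₀ (by positivity)]
    have hpow : (p : ℝ)⁻¹ ^ (d * d) ≤ (p : ℝ)⁻¹ ^ d :=
      pow_le_pow_of_le_one hq.le (by linarith) (Nat.le_mul_self d)
    have hden : 1 / 8 ≤ constC p d * constC p d * constC p (n - d) := by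
      have : 1 / 4 ≤ constC p d * constC p d := by nlinarith
      nlinarith
    have hnum : constC p n * constC p n ≤ 1 := by nlinarith
    have hpos : 0 < (p : ℝ)⁻¹ ^ (d * d) := pow_pos hq _
    calc (p : ℝ)⁻¹ ^ (d * d) * (constC p n * constC p n) ≤ (p : ℝ)⁻¹ ^ (d * d) * 1 :=
          mul_le_mul_of_nonneg_left hnum hpos.le
      _ ≤ (p : ℝ)⁻¹ ^ d * 1 := by linarith
      _ ≤ 8 * (p : ℝ)⁻¹ ^ d * (constC p d * constC p d * constC p (n - d)) := by nlinarith
  · positivity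

variable (p) in
/-- The limit of `corankProb p n 0 d` for `n → ∞`. -/
noncomputable def corankProbInf (d : ℕ) : ℝ :=
  (p : ℝ)⁻¹ ^ (d * d) * constCInf p / (constC p d * constC p d)

theorem tendsto_corankProb (hp2 : p ≠ 2) (d : ℕ) :
    Tendsto (fun n => corankProb p n 0 d) atTop (𝓝 (corankProbInf p d)) := by
  have hC := tendsto_constC hp2
  have hInf := half_le_constCInf hp2
  have hne : constCInf p ≠ 0 := by linarith
  have hd := constC_pos hp2 d
  have hsub : Tendsto (fun n => constC p (n - d)) atTop (𝓝 (constCInf p)) :=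
    hC.comp (tendsto_sub_atTop_nat d)
  have hlim : Tendsto (fun n => (p : ℝ)⁻¹ ^ (d * d) * (constC p n * constC p n) /
      (constC p d * constC p d * constC p (n - d))) atTop
      (𝓝 ((p : ℝ)⁻¹ ^ (d * d) * (constCInf p * constCInf p) /
        (constC p d * constC p d * constCInf p))) :=
    ((hC.mul hC).const_mul _).div (hsub.const_mul _) (by positivity)
  have heq : corankProbInf p d = (p : ℝ)⁻¹ ^ (d * d) * (constCInf p * constCInf p) /
        (constC p d * constC p d * constCInf p) := by
    rw [corankProbInf]
    field_simp
  rw [heq]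
  refine hlim.congr' ?_
  filter_upwards [eventually_ge_atTop d] with n hn
  rw [corankProb, if_pos hn, zero_add, add_zero]

theorem measure_frattini_eq (hp2 : p ≠ 2) (n : ℕ) :
    oddHaar p n (FreeProP.oddIn (proFrattini p (FreeProP p n))) =
      ENNReal.ofReal ((p : ℝ)⁻¹ ^ n) := by
  have h := FreeProP.measure_oddIn_proFrattini (p := p) (n := n) hp2
  rw [mul_comm] at h
  rw [ENNReal.eq_inv_of_mul_eq_one_left h, inv_pow, ENNReal.ofReal_inv_of_pos
    (pow_pos (by exact_mod_cast hp.out.pos) n), ENNReal.ofReal_pow (Nat.cast_nonneg p),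
    ENNReal.ofReal_natCast]

theorem measure_compl_frattini_eq (hp2 : p ≠ 2) (n : ℕ) :
    oddHaar p n (FreeProP.oddIn (proFrattini p (FreeProP p n)))ᶜ =
      ENNReal.ofReal (1 - (p : ℝ)⁻¹ ^ n) := by
  have := FreeProP.isProbabilityMeasure_oddHaar (p := p) (n := n) hp2
  rw [prob_compl_eq_one_sub (FreeProP.isOpen_oddIn FreeProP.isOpen_proFrattini).measurableSet,
    measure_frattini_eq hp2, ENNReal.ofReal_sub _ (pow_nonneg inv_prime_pos.le n),
    ENNReal.ofReal_one]

/-- The law of the group of a random presentation is a mixture of the laws of the groups of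
random presentations with all relations in the Frattini subgroup. -/
theorem mixedLaw_eq_sum (hp2 : p ≠ 2) {A : Set (Sch p)} (hA : MeasurableSet A) (k l : ℕ) :
    mixedLaw p (k + l) k A = ∑ e ∈ Finset.range (k + 1),
      ENNReal.ofReal (corankProb p k l e) * mixedLaw p (l + e) 0 A := by
  induction k generalizing l with
  | zero =>
    have := constC_pos hp2 l
    rw [zero_add, zero_add, Finset.sum_range_one, corankProb, if_pos le_rfl]
    simp only [add_zero, mul_zero, pow_zero, zero_add, constC_zero, mul_one, one_mul, Nat.sub_self]
    rw [div_self this.ne', ENNReal.ofReal_one, one_mul]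
  | succ k ih =>
    rw [show k + 1 + l = k + l + 1 by omega, mixedLaw_succ hp2 (Nat.le_add_right k l) hA, ih l,
      show k + l + 1 = k + (l + 1) by omega, ih (l + 1), measure_frattini_eq hp2,
      measure_compl_frattini_eq hp2]
    have hq := inv_prime_pos (p := p)
    have hq1 : (p : ℝ)⁻¹ ≤ 1 := by linarith [inv_prime_le hp2]
    have hQ0 : 0 ≤ (p : ℝ)⁻¹ ^ (k + l + 1) := pow_nonneg hq.le _
    have hQ1 : 0 ≤ 1 - (p : ℝ)⁻¹ ^ (k + l + 1) := sub_nonneg.mpr (pow_le_one₀ hq.le hq1)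
    -- the first sum may be extended by a zero term
    have hext : ∑ e ∈ Finset.range (k + 1),
          ENNReal.ofReal (corankProb p k l e) * mixedLaw p (l + e) 0 A =
        ∑ e ∈ Finset.range (k + 1),
          ENNReal.ofReal (corankProb p k l (e + 1)) * mixedLaw p (l + (e + 1)) 0 A +
        ENNReal.ofReal (corankProb p k l 0) * mixedLaw p (l + 0) 0 A := by
      rw [← Finset.sum_range_succ' (fun e =>
        ENNReal.ofReal (corankProb p k l e) * mixedLaw p (l + e) 0 A),
        Finset.sum_range_succ _ (k + 1)]
      have : corankProb p k l (k + 1) = 0 := if_neg (by omega)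
      rw [this, ENNReal.ofReal_zero, zero_mul, add_zero]
    rw [hext, Finset.sum_range_succ' _ (k + 1), mul_add, Finset.mul_sum, Finset.mul_sum,
      add_right_comm, ← Finset.sum_add_distrib, corankProb_zero_succ hp2, ENNReal.ofReal_mul hQ1,
      mul_assoc]
    congr 1
    refine Finset.sum_congr rfl fun e _ => ?_
    rw [corankProb_succ_succ hp2, ENNReal.ofReal_add (mul_nonneg hQ1 (corankProb_nonneg hp2 _ _ _))
      (mul_nonneg hQ0 (corankProb_nonneg hp2 _ _ _)), ENNReal.ofReal_mul hQ1,
      ENNReal.ofReal_mul hQ0, add_mul, mul_assoc, mul_assoc, show l + 1 + e = l + (e + 1) by omega]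
    rfl

theorem schMeasure_eq_sum (hp2 : p ≠ 2) {A : Set (Sch p)} (hA : MeasurableSet A) (n : ℕ) :
    schMeasure p n A = ∑ d ∈ Finset.range (n + 1),
      ENNReal.ofReal (corankProb p n 0 d) * mixedLaw p d 0 A := by
  rw [← mixedLaw_self]
  refine (mixedLaw_eq_sum hp2 hA n 0).trans (Finset.sum_congr rfl fun d _ => ?_)
  rw [zero_add]

/-- The measures `μ_n` converge on every Borel set, by dominated convergence. -/
theorem exists_tendsto_schMeasure (hp2 : p ≠ 2) : ∃ μ : Measure (Sch p),
    ∀ A : Set (Sch p), MeasurableSet A → Tendsto (fun n => schMeasure p n A) atTop (𝓝 (μ A)) := by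
  refine ⟨Measure.sum fun d => ENNReal.ofReal (corankProbInf p d) • mixedLaw p d 0, fun A hA => ?_⟩
  have hprob := fun d => isProbabilityMeasure_mixedLaw (p := p) (n := d) hp2 0
  let w : ℕ → ℝ := fun d => (mixedLaw p d 0 A).toReal
  have hw0 : ∀ d, 0 ≤ w d := fun d => ENNReal.toReal_nonneg
  have hw1 : ∀ d, w d ≤ 1 := fun d => by
    have := (hprob d)
    exact ENNReal.toReal_mono ENNReal.one_ne_top prob_le_one
  have hw : ∀ d, mixedLaw p d 0 A = ENNReal.ofReal (w d) := fun d => by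
    have := (hprob d)
    exact (ENNReal.ofReal_toReal (measure_ne_top _ _)).symm
  have hbound : Summable fun d : ℕ => 8 * (p : ℝ)⁻¹ ^ d :=
    (summable_geometric_of_lt_one inv_prime_pos.le (by linarith [inv_prime_le hp2])).mul_left 8
  have hle : ∀ n d, corankProb p n 0 d * w d ≤ 8 * (p : ℝ)⁻¹ ^ d := fun n d => by
    have := corankProb_le hp2 n d
    have h0 := corankProb_nonneg hp2 n 0 d
    nlinarith [hw0 d, hw1 d]
  have hnn : ∀ n d, 0 ≤ corankProb p n 0 d * w d := fun n d =>
    mul_nonneg (corankProb_nonneg hp2 n 0 d) (hw0 d)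
  have hlim : ∀ d, Tendsto (fun n => corankProb p n 0 d * w d) atTop
      (𝓝 (corankProbInf p d * w d)) := fun d => (tendsto_corankProb hp2 d).mul_const _
  have hnnInf : ∀ d, 0 ≤ corankProbInf p d := fun d =>
    ge_of_tendsto' (tendsto_corankProb hp2 d) fun n => corankProb_nonneg hp2 n 0 d
  have hsummInf : Summable fun d => corankProbInf p d * w d :=
    Summable.of_nonneg_of_le (fun d => mul_nonneg (hnnInf d) (hw0 d))
      (fun d => le_of_tendsto' (hlim d) fun n => hle n d) hbound
  have hmain := tendsto_tsum_of_dominated_convergence (𝓕 := atTop) hbound hlim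
    (Eventually.of_forall fun n d => by
      rw [Real.norm_of_nonneg (hnn n d)]; exact hle n d)
  rw [Measure.sum_apply _ hA]
  have hR : ∑' d, (ENNReal.ofReal (corankProbInf p d) • mixedLaw p d 0) A =
      ENNReal.ofReal (∑' d, corankProbInf p d * w d) := by
    rw [ENNReal.ofReal_tsum_of_nonneg (fun d => mul_nonneg (hnnInf d) (hw0 d)) hsummInf]
    refine tsum_congr fun d => ?_
    rw [Measure.smul_apply, smul_eq_mul, hw, ENNReal.ofReal_mul (hnnInf d)]
  rw [hR]
  refine (ENNReal.tendsto_ofReal hmain).congr fun n => ?_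
  rw [schMeasure_eq_sum hp2 hA, tsum_eq_sum (s := Finset.range (n + 1)),
    ENNReal.ofReal_sum_of_nonneg fun d _ => hnn n d]
  · refine Finset.sum_congr rfl fun d _ => ?_
    rw [hw, ENNReal.ofReal_mul (corankProb_nonneg hp2 n 0 d)]
  · intro d hd
    have : corankProb p n 0 d = 0 := if_neg (by simpa using hd)
    rw [this, zero_mul]

theorem tendsto_schMeasure (hp2 : p ≠ 2) {A : Set (Sch p)} (hA : MeasurableSet A) :
    Tendsto (fun n => schMeasure p n A) atTop (𝓝 (schMeasureInf p A)) := by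
  have h := exists_tendsto_schMeasure hp2
  rw [schMeasureInf, dif_pos h]
  exact h.choose_spec A hA

/-- On a set of groups with exactly `n` generators, `μ_∞` is a multiple of `μ_n`. -/
theorem schMeasureInf_eq (hp2 : p ≠ 2) {A : Set (Sch p)} (hA : MeasurableSet A) (n : ℕ)
    (h0 : ∀ d, d ≠ n → mixedLaw p d 0 A = 0) :
    schMeasureInf p A =
      ENNReal.ofReal (constCInf p / (constC p n * constC p n)) * schMeasure p n A := by
  have hprob := isProbabilityMeasure_mixedLaw (p := p) (n := n) hp2 0
  have hN : ∀ N, n ≤ N →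
      schMeasure p N A = ENNReal.ofReal (corankProb p N 0 n) * mixedLaw p n 0 A := by
    intro N hn
    rw [schMeasure_eq_sum hp2 hA, Finset.sum_eq_single_of_mem n (by simpa using hn)]
    intro d _ hd
    rw [h0 d hd, mul_zero]
  have hn : corankProb p n 0 n = (p : ℝ)⁻¹ ^ (n * n) := by
    have := constC_pos hp2 n
    rw [corankProb, if_pos le_rfl, Nat.sub_self, constC_zero, zero_add, add_zero, mul_one,
      mul_div_assoc, div_self (by positivity), mul_one]
  have hInf := half_le_constCInf hp2
  have hlim : Tendsto (fun N => ENNReal.ofReal (corankProb p N 0 n) * mixedLaw p n 0 A) atTop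
      (𝓝 (ENNReal.ofReal (corankProbInf p n) * mixedLaw p n 0 A)) :=
    ENNReal.Tendsto.mul_const (ENNReal.tendsto_ofReal (tendsto_corankProb hp2 n))
      (Or.inr (measure_ne_top _ _))
  have heq : schMeasureInf p A = ENNReal.ofReal (corankProbInf p n) * mixedLaw p n 0 A := by
    refine tendsto_nhds_unique (tendsto_schMeasure hp2 hA) (hlim.congr' ?_)
    filter_upwards [eventually_ge_atTop n] with N h
    rw [hN N h]
  have hCn := constC_pos hp2 n
  rw [heq, hN n le_rfl, hn, ← mul_assoc, ← ENNReal.ofReal_mul (by positivity)]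
  congr 2
  rw [corankProbInf]
  ring

end Constants

/-! ### Counting spanning tuples -/

section Spanning

variable {p : ℕ} [hp : Fact p.Prime]

/-- The number of `n`-tuples that span `𝔽_p^m`: transposing matrices, it is the number of linearly
independent `m`-tuples in `𝔽_p^n`. -/
theorem card_span_eq_top {n m : ℕ} (hmn : m ≤ n) :
    Nat.card {v : Fin n → Fin m → ZMod p // Submodule.span (ZMod p) (Set.range v) = ⊤} =
      ∏ i : Fin m, (p ^ n - p ^ (i : ℕ)) := by
  have h := card_linearIndependent (K := ZMod p) (V := Fin n → ZMod p) (k := m) (by simpa using hmn)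
  rw [ZMod.card, Module.finrank_fin_fun] at h
  rw [← h]
  refine Nat.card_congr (Equiv.subtypeEquiv
    (Equiv.piComm fun (_ : Fin n) (_ : Fin m) => ZMod p) fun v => ?_)
  let M : Matrix (Fin n) (Fin m) (ZMod p) := v
  have h1 : M.rank = Module.finrank (ZMod p) (Submodule.span (ZMod p) (Set.range v)) :=
    M.rank_eq_finrank_span_row
  have h2 : M.rank = Set.finrank (ZMod p) (Set.range fun j i => v i j) :=
    M.rank_eq_finrank_span_cols
  change _ ↔ LinearIndependent (ZMod p) fun j i => v i j
  rw [linearIndependent_iff_card_eq_finrank_span, ← h2, h1, Fintype.card_fin]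
  constructor
  · intro h
    rw [h, finrank_top, Module.finrank_fin_fun]
  · intro h
    apply Submodule.eq_top_of_finrank_eq
    rw [← h, Module.finrank_fin_fun]

/-- The number of spanning tuples in terms of the constants `C_k`. -/
theorem prod_pow_sub_pow (hp2 : p ≠ 2) {n m : ℕ} (hmn : m ≤ n) :
    ((∏ i : Fin m, (p ^ n - p ^ (i : ℕ)) : ℕ) : ℝ) =
      (p : ℝ) ^ (m * n) * (constC p n / constC p (n - m)) := by
  induction m with
  | zero =>
    have := constC_pos hp2 n
    simp [div_self this.ne']
  | succ m ih =>
    have h1 := constC_pos hp2 (n - (m + 1))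
    have h2 := constC_pos hp2 (n - m)
    have hs := constC_succ (p := p) (n - (m + 1))
    rw [show n - (m + 1) + 1 = n - m by omega] at hs
    have hp0 : (p : ℝ) ≠ 0 := by exact_mod_cast hp.out.ne_zero
    have hf : (1 - (p : ℝ)⁻¹ ^ (n - m)) ≠ 0 := fun h0 => by
      rw [h0, mul_zero] at hs; exact h2.ne' hs
    rw [Fin.prod_univ_castSucc, Nat.cast_mul]
    simp only [Fin.val_castSucc, Fin.val_last]
    rw [ih (by omega), Nat.cast_sub (Nat.pow_le_pow_right hp.out.pos (by omega)), Nat.cast_pow,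
      Nat.cast_pow, hs]
    have hpn : (p : ℝ) ^ n = p ^ m * p ^ (n - m) := by rw [← pow_add]; congr 1; omega
    have hq : (p : ℝ) ^ n - p ^ m = p ^ n * (1 - (p : ℝ)⁻¹ ^ (n - m)) := by
      rw [hpn, inv_pow]
      field_simp
    rw [hq, add_mul, one_mul, pow_add]
    generalize (p : ℝ)⁻¹ ^ (n - m) = x at *
    field_simp

end Spanning

/-! ### Random relations generating a given normal subgroup -/

namespace FreeProP

variable {p n m k : ℕ} [hp : Fact p.Prime]

/-- The probability that `n` random odd elements lie in `L` and span `L / L'`. -/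
theorem measure_span_eq_top_eq_constC (hp2 : p ≠ 2) {L L' : Subgroup (FreeProP p n)} [L'.Normal]
    [IsSigmaInvariant L'] [IsSigmaInvariant L] (c : Coordinates p L L' m) (hle : L' ≤ L)
    (hL' : IsOpen (L' : Set (FreeProP p n))) (hσ : ∀ x ∈ L, c.toFun (sigma x) = -c.toFun x)
    (hmn : m ≤ n) :
    Measure.pi (fun _ : Fin n => oddHaar p n)
      {r | (∀ i, (r i : FreeProP p n) ∈ L) ∧
        Submodule.span (ZMod p) (Set.range fun i => c.toFun (r i)) = ⊤} =
    ENNReal.ofReal (constC p n / constC p (n - m)) * oddHaar p n (oddIn L) ^ n := by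
  have h1 := constC_pos hp2 n
  have h2 := constC_pos hp2 (n - m)
  rw [measure_span_eq_top hp2 c hle hL' hσ, card_span_eq_top hmn, ← ENNReal.ofReal_natCast,
    prod_pow_sub_pow hp2 hmn, measure_oddIn_eq hp2 c hle hL' hσ, mul_pow, ← pow_mul, ← mul_assoc,
    mul_comm ((p : ℝ) ^ (m * n)), ENNReal.ofReal_mul (by positivity),
    ENNReal.ofReal_pow (Nat.cast_nonneg p), ENNReal.ofReal_natCast]

/-- The closed normal subgroup generated by a family of elements. -/
def normalSpan (s : Fin k → FreeProP p n) : Subgroup (FreeProP p n) :=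
  (Subgroup.normalClosure (Set.range s)).topologicalClosure

theorem isClosed_normalSpan (s : Fin k → FreeProP p n) :
    IsClosed (normalSpan s : Set (FreeProP p n)) := Subgroup.isClosed_topologicalClosure _

instance normalSpan_normal (s : Fin k → FreeProP p n) : (normalSpan s).Normal :=
  Subgroup.is_normal_topologicalClosure _

theorem mem_normalSpan (s : Fin k → FreeProP p n) (i : Fin k) : s i ∈ normalSpan s :=
  Subgroup.le_topologicalClosure _ (Subgroup.subset_normalClosure ⟨i, rfl⟩)

theorem normalSpan_le {s : Fin k → FreeProP p n} {K : Subgroup (FreeProP p n)} [K.Normal]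
    (hK : IsClosed (K : Set (FreeProP p n))) (h : ∀ i, s i ∈ K) : normalSpan s ≤ K := by
  refine Subgroup.topologicalClosure_minimal _ (Subgroup.normalClosure_le_normal ?_) hK
  rintro _ ⟨i, rfl⟩
  exact h i

theorem isClosed_sup {K D : Subgroup (FreeProP p n)} [D.Normal]
    (hK : IsClosed (K : Set (FreeProP p n))) (hD : IsClosed (D : Set (FreeProP p n))) :
    IsClosed ((K ⊔ D : Subgroup _) : Set (FreeProP p n)) := by
  rw [Subgroup.mul_normal]
  exact (hK.isCompact.mul hD.isCompact).isClosed

variable {D L : Subgroup (FreeProP p n)} [D.Normal] [L.Normal]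

theorem isOpen_sup_centralFrattini (hL : IsOpen (L : Set (FreeProP p n))) :
    IsOpen ((D ⊔ centralFrattini p L : Subgroup _) : Set (FreeProP p n)) :=
  Subgroup.isOpen_mono le_sup_right (isOpen_centralFrattini hL)

theorem sup_centralFrattini_le (hL : IsOpen (L : Set (FreeProP p n))) (hDL : D ≤ L) :
    D ⊔ centralFrattini p L ≤ L :=
  sup_le hDL (centralFrattini_le_self (Subgroup.isClosed_of_isOpen _ hL))

theorem exists_coordinates_sup (D : Subgroup (FreeProP p n)) [D.Normal]
    (hL : IsOpen (L : Set (FreeProP p n))) :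
    ∃ m, Nonempty (Coordinates p L (D ⊔ centralFrattini p L) m) := by
  have := finite_quotient_of_isOpen _ (isOpen_sup_centralFrattini (D := D) hL)
  exact exists_coordinates
    (fun x hx => (le_sup_right : centralFrattini p L ≤ _) (pow_mem_centralFrattini hx))
    fun x hx y => (le_sup_right : centralFrattini p L ≤ _) (commutator_mem_centralFrattini hx y)

/-- Elements of `L` have the same coordinates as their conjugates. -/
theorem toFun_conj (c : Coordinates p L (D ⊔ centralFrattini p L) m) {x : FreeProP p n}
    (hx : x ∈ L) (g : FreeProP p n) : c.toFun (g * x * g⁻¹) = c.toFun x := by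
  refine ((c.eq_iff hx ((inferInstance : L.Normal).conj_mem x hx g)).mpr ?_).symm
  have := commutator_mem_centralFrattini (p := p) (L.inv_mem hx) g
  rw [inv_inv] at this
  refine (le_sup_right : centralFrattini p L ≤ D ⊔ _) ?_
  convert this using 1
  group

theorem preimage_normal (c : Coordinates p L (D ⊔ centralFrattini p L) m)
    (W : Submodule (ZMod p) (Fin m → ZMod p)) : (c.preimage W).Normal :=
  ⟨fun x hx g => ⟨(inferInstance : L.Normal).conj_mem x hx.1 g, by
    rw [toFun_conj c hx.1]; exact hx.2⟩⟩

/-- Elements generate `L` as a normal subgroup modulo `D` if and only if their coordinate vectors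
span `L / D L^p [L, F]`. -/
theorem normalSpan_sup_eq_iff (hD : IsClosed (D : Set (FreeProP p n)))
    (hL : IsOpen (L : Set (FreeProP p n))) (hDL : D ≤ L)
    (c : Coordinates p L (D ⊔ centralFrattini p L) m) (s : Fin k → FreeProP p n) :
    normalSpan s ⊔ D = L ↔
      (∀ i, s i ∈ L) ∧ Submodule.span (ZMod p) (Set.range fun i => c.toFun (s i)) = ⊤ := by
  constructor
  · intro h
    have hs : ∀ i, s i ∈ L := fun i => by
      rw [← h]; exact (le_sup_left : normalSpan s ≤ _) (mem_normalSpan s i)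
    refine ⟨hs, ?_⟩
    set W := Submodule.span (ZMod p) (Set.range fun i => c.toFun (s i))
    have hLW := c.le_preimage (sup_centralFrattini_le hL hDL) W
    have hn := preimage_normal c W
    have hcl := Subgroup.isClosed_of_isOpen _
      (Subgroup.isOpen_mono hLW (isOpen_sup_centralFrattini hL))
    have hle : L ≤ c.preimage W := by
      conv_lhs => rw [← h]
      exact sup_le (normalSpan_le hcl fun i => ⟨hs i, Submodule.subset_span ⟨i, rfl⟩⟩)
        (le_sup_left.trans hLW)
    rw [eq_top_iff]
    rintro v -
    obtain ⟨x, hx, rfl⟩ := c.surj v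
    exact (hle hx).2
  · rintro ⟨hs, hspan⟩
    have hle : normalSpan s ⊔ D ≤ L :=
      sup_le (normalSpan_le (Subgroup.isClosed_of_isOpen _ hL) hs) hDL
    refine le_antisymm hle
      (le_of_le_sup_centralFrattini (isClosed_sup (isClosed_normalSpan s) hD) ?_)
    have himg : c.image _ hle = ⊤ := by
      rw [eq_top_iff, ← hspan, Submodule.span_le]
      rintro _ ⟨i, rfl⟩
      exact ⟨s i, (le_sup_left : normalSpan s ≤ _) (mem_normalSpan s i), rfl⟩
    refine (c.le_sup_of_image_eq_top hle himg).trans ?_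
    rw [← sup_assoc, sup_assoc _ D D, sup_idem]

/-- If `L` is generated by odd elements as a normal subgroup modulo `D`, then `σ` acts on its
coordinates by inversion. -/
theorem toFun_sigma [IsSigmaInvariant D] [IsSigmaInvariant L]
    (hL : IsOpen (L : Set (FreeProP p n))) (hDL : D ≤ L)
    (c : Coordinates p L (D ⊔ centralFrattini p L) m) {r : Fin k → OddPart (FreeProP p n)}
    (hr : normalSpan (fun i => (r i : FreeProP p n)) ⊔ D = L) {x : FreeProP p n} (hx : x ∈ L) :
    c.toFun (sigma x) = -c.toFun x := by
  have hσL : ∀ x ∈ L, sigma x ∈ L := (inferInstance : IsSigmaInvariant L).sigma_mem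
  have hσD : ∀ x ∈ D, sigma x ∈ D := (inferInstance : IsSigmaInvariant D).sigma_mem
  let K : Subgroup (FreeProP p n) :=
    { carrier := {x | x ∈ L ∧ c.toFun (sigma x) = -c.toFun x}
      one_mem' := ⟨L.one_mem, by rw [map_one, c.map_one, neg_zero]⟩
      mul_mem' := fun {x y} hx hy => ⟨L.mul_mem hx.1 hy.1, by
        rw [map_mul, c.map_mul _ (hσL x hx.1) _ (hσL y hy.1), c.map_mul _ hx.1 _ hy.1, hx.2, hy.2,
          neg_add]⟩
      inv_mem' := fun {x} hx => ⟨L.inv_mem hx.1, by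
        rw [map_inv, c.map_inv (hσL x hx.1), c.map_inv hx.1, hx.2]⟩ }
  have hKn : K.Normal := ⟨fun x hx g => ⟨(inferInstance : L.Normal).conj_mem x hx.1 g, by
    rw [map_mul, map_mul, map_inv, toFun_conj c (hσL x hx.1), toFun_conj c hx.1, hx.2]⟩⟩
  have hL'K : D ⊔ centralFrattini p L ≤ K := fun x hx => by
    have hxL := sup_centralFrattini_le hL hDL hx
    have hsx : sigma x ∈ D ⊔ centralFrattini p L := by
      obtain ⟨a, ha, b, hb, rfl⟩ := mem_of_mem_sup_of_normal hx
      rw [map_mul]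
      exact Subgroup.mul_mem_sup (hσD a ha) (IsSigmaInvariant.sigma_mem b hb)
    exact ⟨hxL, by
      rw [(c.mem_iff x hxL).mp hx, (c.mem_iff _ (hσL x hxL)).mp hsx, neg_zero]⟩
  have hcl := Subgroup.isClosed_of_isOpen _
    (Subgroup.isOpen_mono hL'K (isOpen_sup_centralFrattini hL))
  have hle : L ≤ K := by
    conv_lhs => rw [← hr]
    refine sup_le (normalSpan_le hcl fun i => ?_) (le_sup_left.trans hL'K)
    have hi : (r i : FreeProP p n) ∈ L := by
      rw [← hr]
      exact (le_sup_left : normalSpan _ ≤ _) (mem_normalSpan (fun i => (r i : FreeProP p n)) i)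
    exact ⟨hi, by rw [(r i).2, c.map_inv hi]⟩
  exact (hle hx).2

instance sup_sigmaInvariant {G : Type u} [Group G] [TopologicalSpace G] [SigmaGroup G]
    (M N : Subgroup G) [N.Normal] [hM : IsSigmaInvariant M] [hN : IsSigmaInvariant N] :
    IsSigmaInvariant (M ⊔ N) where
  sigma_mem x hx := by
    obtain ⟨a, ha, b, hb, rfl⟩ := mem_of_mem_sup_of_normal hx
    rw [map_mul]
    exact Subgroup.mul_mem_sup (hM.sigma_mem a ha) (hN.sigma_mem b hb)

/-- The probability that random relations generate `L` modulo `D`. -/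
theorem measure_relSubgroup_sup_eq (hp2 : p ≠ 2) [IsSigmaInvariant D] [IsSigmaInvariant L]
    (hD : IsClosed (D : Set (FreeProP p n)))
    (hL : IsOpen (L : Set (FreeProP p n))) (hDL : D ≤ L)
    (c : Coordinates p L (D ⊔ centralFrattini p L) m) (hmn : m ≤ n)
    {r₀ : Fin n → OddPart (FreeProP p n)} (hr₀ : relSubgroup r₀ ⊔ D = L) :
    Measure.pi (fun _ : Fin n => oddHaar p n) {r | relSubgroup r ⊔ D = L} =
      ENNReal.ofReal (constC p n / constC p (n - m)) * oddHaar p n (oddIn L) ^ n := by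
  rw [← measure_span_eq_top_eq_constC hp2 c (sup_centralFrattini_le hL hDL)
    (isOpen_sup_centralFrattini hL)
    (fun x hx => toFun_sigma hL hDL c (r := r₀) hr₀ hx) hmn]
  congr 1
  ext r
  exact normalSpan_sup_eq_iff hD hL hDL c fun i => (r i : FreeProP p n)

/-- The set of relations that generate an open subgroup `L` modulo `D` is open. -/
theorem isOpen_relSubgroup_sup_eq (hD : IsClosed (D : Set (FreeProP p n)))
    (hL : IsOpen (L : Set (FreeProP p n))) :
    IsOpen {r : Fin n → OddPart (FreeProP p n) | relSubgroup r ⊔ D = L} := by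
  rw [isOpen_iff_mem_nhds]
  intro r hr
  have hC := isOpen_centralFrattini hL
  have hU : {s : Fin n → OddPart (FreeProP p n) | ∀ j,
      (r j : FreeProP p n)⁻¹ * s j ∈ centralFrattini p L} ∈ 𝓝 r := by
    refine IsOpen.mem_nhds ?_ fun j => ?_
    · rw [Set.ofPred_forall]
      refine isOpen_iInter_of_finite fun j => ?_
      have hc : Continuous fun s : Fin n → OddPart (FreeProP p n) => s j := continuous_apply j
      exact (isOpen_oddCoset hC (r j)).preimage hc
    · rw [inv_mul_cancel]
      exact one_mem _
  refine mem_of_superset hU fun s hs => ?_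
  have hr' : relSubgroup r ⊔ D = L := hr
  have hCL : centralFrattini p L ≤ L := centralFrattini_le_self (Subgroup.isClosed_of_isOpen _ hL)
  have heq := relSubgroup_sup_eq hC hs
  have hle : relSubgroup s ≤ L := le_sup_left.trans (heq.le.trans
    (sup_le (le_sup_left.trans hr'.le) hCL))
  refine le_antisymm (sup_le hle (le_sup_right.trans hr'.le)) ?_
  refine le_of_le_sup_centralFrattini (isClosed_sup (isClosed_relSubgroup s) hD) ?_
  conv_lhs => rw [← hr']
  rw [sup_right_comm, heq]
  exact sup_le (le_sup_left.trans le_sup_left) le_sup_right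

end FreeProP

/-! ### Counting epimorphisms onto a finite group -/

namespace FreeProP

variable {p n m k : ℕ} [hp : Fact p.Prime]

section Counting

variable {Q : Type u} [Group Q] [TopologicalSpace Q] [SigmaGroup Q] [T2Space Q] [Finite Q]

theorem sigmaEpi_ext {φ ψ : SigmaEpi (FreeProP p n) Q}
    (h : ∀ i, φ.toMonoidHom (gen i) = ψ.toMonoidHom (gen i)) : φ = ψ :=
  SigmaEpi.ext fun x => DFunLike.congr_fun (hom_ext φ.continuous ψ.continuous h) x

instance finite_sigmaEpi : Finite (SigmaEpi (FreeProP p n) Q) :=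
  Finite.of_injective (fun φ i => φ.toMonoidHom (gen i)) fun _ _ h => sigmaEpi_ext (congrFun h)

theorem isOpen_ker (φ : SigmaEpi (FreeProP p n) Q) :
    IsOpen (φ.toMonoidHom.ker : Set (FreeProP p n)) :=
  (isOpen_discrete ({1} : Set Q)).preimage φ.continuous

/-- The epimorphisms `F_n → Q` correspond to the cosets modulo the kernel of one of them of the
systems of free odd generators, so their number is determined by the probability `C_n` that `n`
random odd elements generate `F_n`. -/
theorem card_sigmaEpi_mul (hp2 : p ≠ 2) (φ₀ : SigmaEpi (FreeProP p n) Q)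
    (hφ₀ : φ₀.toMonoidHom.ker ≤ proFrattini p (FreeProP p n)) :
    Nat.card (SigmaEpi (FreeProP p n) Q) * oddHaar p n (oddIn φ₀.toMonoidHom.ker) ^ n =
      ENNReal.ofReal (constC p n) := by
  have := isProbabilityMeasure_oddHaar (n := n) hp2
  -- the generating tuples are divided according to the homomorphism `φ` with `φ (gen i) = φ₀ (x i)`
  let S : SigmaEpi (FreeProP p n) Q → Set (Fin n → OddPart (FreeProP p n)) := fun φ =>
    {x | ∀ i, φ₀.toMonoidHom (x i) = φ.toMonoidHom (gen i)}
  have hS : ∀ φ, ∃ b : Fin n → OddPart (FreeProP p n),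
      S φ = Set.univ.pi fun i => oddCoset φ₀.toMonoidHom.ker (b i) := by
    intro φ
    have hb : ∀ i, ∃ b : OddPart (FreeProP p n),
        φ₀.toMonoidHom b = φ.toMonoidHom (gen i) := fun i => by
      obtain ⟨a, -, ha, hab⟩ := exists_odd_lift hp2 φ₀ (K := ⊤) isClosed_univ
        (b := φ.toMonoidHom (gen i))
        (by rw [← φ.toMonoidHom_sigma, sigma_gen, map_inv])
        (by rw [Subgroup.map_top_of_surjective _ φ₀.surj]; exact Subgroup.mem_top _)
      exact ⟨⟨a, ha⟩, hab⟩
    choose b hb using hb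
    refine ⟨b, Set.ext fun x => ?_⟩
    simp only [Set.mem_pi, Set.mem_univ, true_imp_iff]
    refine forall_congr' fun i => ?_
    change _ ↔ φ₀.toMonoidHom ((b i : FreeProP p n)⁻¹ * x i) = 1
    rw [map_mul, map_inv, hb, inv_mul_eq_one, eq_comm]
  have hSm : ∀ φ, Measure.pi (fun _ : Fin n => oddHaar p n) (S φ) =
      oddHaar p n (oddIn φ₀.toMonoidHom.ker) ^ n := by
    intro φ
    obtain ⟨b, hb⟩ := hS φ
    rw [hb, Measure.pi_pi, Finset.prod_congr rfl fun i _ =>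
      measure_oddCoset hp2 φ₀.toMonoidHom.ker (isOpen_ker φ₀) (b i), Finset.prod_const,
      Finset.card_univ, Fintype.card_fin]
  have hSmeas : ∀ φ, MeasurableSet (S φ) := by
    intro φ
    obtain ⟨b, hb⟩ := hS φ
    rw [hb]
    exact MeasurableSet.univ_pi fun i => measurableSet_oddCoset (isOpen_ker φ₀) _
  have hdisj : Pairwise (Function.onFun Disjoint S) := by
    intro φ ψ hne
    refine Set.disjoint_left.mpr fun x hx hx' => hne (sigmaEpi_ext fun i => ?_)
    rw [← hx i, ← hx' i]
  have hE := measure_span_eq_top_eq_constC hp2 (frattiniCoordinates p n) le_top isOpen_proFrattini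
    (fun x _ => frattiniCoordinates_sigma x) le_rfl
  have hset : {r : Fin n → OddPart (FreeProP p n) |
      (∀ i, (r i : FreeProP p n) ∈ (⊤ : Subgroup (FreeProP p n))) ∧
        Submodule.span (ZMod p) (Set.range fun i => (frattiniCoordinates p n).toFun (r i)) = ⊤} =
      ⋃ φ, S φ := by
    ext x
    simp only [Set.mem_iUnion]
    constructor
    · rintro ⟨-, hx⟩
      obtain ⟨α, hα⟩ := exists_aut (y := fun i => (x i : FreeProP p n)) (fun i => (x i).2)
        fun K hK h => eq_top_of_span hK h hx
      refine ⟨φ₀.comp α.toEpi, fun i => ?_⟩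
      rw [SigmaEpi.comp_apply, SigmaIso.toEpi_apply, hα]
    · rintro ⟨φ, hφ⟩
      refine ⟨fun i => Subgroup.mem_top _, span_eq_top_of_generate fun K hK hx => ?_⟩
      refine eq_top_of_map_eq_top hφ₀ hK ?_
      have hcl : IsClosed ((K.map φ₀.toMonoidHom).comap φ.toMonoidHom : Set (FreeProP p n)) :=
        (isClosed_discrete (K.map φ₀.toMonoidHom : Set Q)).preimage φ.continuous
      have := eq_top_of_gen_mem hcl fun i => ⟨x i, hx i, hφ i⟩
      rw [eq_top_iff]
      rintro a -
      obtain ⟨z, rfl⟩ := φ.surj a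
      exact this.ge (Subgroup.mem_top z)
  have htop : oddIn (⊤ : Subgroup (FreeProP p n)) = Set.univ :=
    Set.eq_univ_of_forall fun x => Subgroup.mem_top (x : FreeProP p n)
  rw [hset, measure_iUnion hdisj hSmeas, Nat.sub_self, constC_zero, div_one, htop, measure_univ,
    one_pow, mul_one] at hE
  simp only [hSm] at hE
  have := Fintype.ofFinite (SigmaEpi (FreeProP p n) Q)
  rw [← hE, tsum_fintype, Finset.sum_const, Finset.card_univ, Nat.card_eq_fintype_card,
    nsmul_eq_mul]

/-- The group `Aut_σ(Q)` acts simply transitively on the epimorphisms `F_n → Q` with a given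
kernel. -/
theorem card_sigmaEpi_ker_eq (φ₁ : SigmaEpi (FreeProP p n) Q) :
    Nat.card {φ : SigmaEpi (FreeProP p n) Q // φ.toMonoidHom.ker = φ₁.toMonoidHom.ker} =
      Nat.card (SigmaAut Q) := by
  symm
  refine Nat.card_congr (Equiv.ofBijective
    (fun e => ⟨e.toEpi.comp φ₁, SigmaEpi.ker_iso_comp e φ₁⟩) ⟨fun e f h => ?_, fun φ => ?_⟩)
  · refine SigmaIso.ext fun a => ?_
    obtain ⟨x, rfl⟩ := φ₁.surj a
    exact DFunLike.congr_fun (congrArg (fun φ => φ.1.toMonoidHom) h) x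
  · obtain ⟨e, he⟩ := φ₁.exists_iso_of_ker_eq φ.1 φ.2.symm
    exact ⟨e, Subtype.ext (SigmaEpi.ext he)⟩

theorem finite_sigmaAut (φ₁ : SigmaEpi (FreeProP p n) Q) : Finite (SigmaAut Q) := by
  refine Finite.of_injective (fun e : SigmaAut Q => e.toEpi.comp φ₁) fun e f h => ?_
  refine SigmaIso.ext fun a => ?_
  obtain ⟨x, rfl⟩ := φ₁.surj a
  exact DFunLike.congr_fun (congrArg (fun φ => φ.toMonoidHom) h) x

end Counting

/-- The images of relations generate the image of the relation subgroup. -/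
theorem relSubgroup_oddMap (β : SigmaEpi (FreeProP p n) (FreeProP p n))
    (r : Fin n → OddPart (FreeProP p n)) :
    relSubgroup (fun i => oddMap β (r i)) = (relSubgroup r).map β.toMonoidHom := by
  have hn : ((relSubgroup r).map β.toMonoidHom).Normal :=
    (inferInstance : (relSubgroup r).Normal).map _ β.surj
  refine le_antisymm (relSubgroup_le ?_ fun i => ⟨r i, mem_relSubgroup r i, rfl⟩) ?_
  · exact ((isClosed_relSubgroup r).isCompact.image β.continuous).isClosed
  · rw [Subgroup.map_le_iff_le_comap]
    have := (inferInstance : (relSubgroup fun i => oddMap β (r i)).Normal).comap β.toMonoidHom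
    exact relSubgroup_le ((isClosed_relSubgroup _).preimage β.continuous) fun i =>
      mem_relSubgroup (fun i => oddMap β (r i)) i

variable {D : Subgroup (FreeProP p n)} [D.Normal]

theorem map_eq_of_aut_mem
    (hDaut : ∀ α : SigmaAut (FreeProP p n), ∀ x ∈ D, α.toContinuousMulEquiv x ∈ D)
    (α : SigmaAut (FreeProP p n)) : D.map α.toEpi.toMonoidHom = D := by
  apply le_antisymm
  · rintro _ ⟨x, hx, rfl⟩
    exact hDaut α x hx
  · intro x hx
    exact ⟨_, hDaut α.symm x hx, α.toContinuousMulEquiv.apply_symm_apply x⟩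

section Law

variable {Q : Type u} [Group Q] [TopologicalSpace Q] [SigmaGroup Q] [T2Space Q] [Finite Q]

/-- The probability that random relations generate the kernel of an epimorphism modulo `D` is the
same for all epimorphisms, since `Aut_σ(F_n)` acts transitively on these. -/
theorem measure_sup_eq_ker (hp2 : p ≠ 2) (hD : IsClosed (D : Set (FreeProP p n)))
    (hDaut : ∀ α : SigmaAut (FreeProP p n), ∀ x ∈ D, α.toContinuousMulEquiv x ∈ D)
    (φ ψ : SigmaEpi (FreeProP p n) Q)
    (hψ : ψ.toMonoidHom.ker ≤ proFrattini p (FreeProP p n)) :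
    Measure.pi (fun _ : Fin n => oddHaar p n) {r | relSubgroup r ⊔ D = ψ.toMonoidHom.ker} =
      Measure.pi (fun _ : Fin n => oddHaar p n) {r | relSubgroup r ⊔ D = φ.toMonoidHom.ker} := by
  have := isProbabilityMeasure_oddHaar (n := n) hp2
  obtain ⟨α, hα⟩ := exists_aut_comp_eq hp2 φ ψ hψ
  have hmeas : Measurable (oddMap α.toEpi) := (continuous_oddMap α.toEpi).measurable
  have hprob : IsProbabilityMeasure ((oddHaar p n).map (oddMap α.toEpi)) :=
    Measure.isProbabilityMeasure_map hmeas.aemeasurable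
  have hmap : (Measure.pi fun _ : Fin n => oddHaar p n).map (fun r i => oddMap α.toEpi (r i)) =
      Measure.pi fun _ : Fin n => oddHaar p n := by
    rw [Measure.pi_map_pi fun _ => hmeas.aemeasurable]
    simp_rw [map_oddHaar hp2]
  have hinj : Function.Injective α.toEpi.toMonoidHom := α.toContinuousMulEquiv.injective
  have hker : φ.toMonoidHom.ker.map α.toEpi.toMonoidHom = ψ.toMonoidHom.ker := by
    ext y
    obtain ⟨x, rfl⟩ := α.toEpi.surj y
    rw [Subgroup.mem_map_iff_mem hinj, MonoidHom.mem_ker, MonoidHom.mem_ker, SigmaIso.toEpi_apply,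
      hα]
  conv_lhs => rw [← hmap]
  have hmeas' : Measurable fun (r : Fin n → OddPart (FreeProP p n)) i => oddMap α.toEpi (r i) :=
    measurable_pi_lambda _ fun i => hmeas.comp (measurable_pi_apply i)
  rw [Measure.map_apply hmeas'
    (isOpen_relSubgroup_sup_eq hD (isOpen_ker ψ)).measurableSet]
  congr 1
  ext r
  change relSubgroup (fun i => oddMap α.toEpi (r i)) ⊔ D = _ ↔ relSubgroup r ⊔ D = _
  rw [relSubgroup_oddMap, ← hker]
  conv_lhs => rw [← map_eq_of_aut_mem hDaut α, ← Subgroup.map_sup]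
  exact (Subgroup.map_injective hinj).eq_iff

/-- The probability that random relations define, modulo `D`, a group isomorphic to `Q`. -/
theorem card_sigmaAut_mul_measure (hp2 : p ≠ 2) [IsTopologicalGroup Q] (hQ : minGens Q = n)
    [IsSigmaInvariant D] (hD : IsClosed (D : Set (FreeProP p n)))
    (hDaut : ∀ α : SigmaAut (FreeProP p n), ∀ x ∈ D, α.toContinuousMulEquiv x ∈ D)
    (φ₀ : SigmaEpi (FreeProP p n) Q) {r₀ : Fin n → OddPart (FreeProP p n)}
    (hr₀ : relSubgroup r₀ ⊔ D = φ₀.toMonoidHom.ker)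
    (c : Coordinates p φ₀.toMonoidHom.ker (D ⊔ centralFrattini p φ₀.toMonoidHom.ker) m)
    (hmn : m ≤ n) :
    Nat.card (SigmaAut Q) * Measure.pi (fun _ : Fin n => oddHaar p n)
        {r | ∃ φ : SigmaEpi (FreeProP p n) Q, relSubgroup r ⊔ D = φ.toMonoidHom.ker} =
      ENNReal.ofReal (constC p n * (constC p n / constC p (n - m))) := by
  classical
  have hfr : ∀ φ : SigmaEpi (FreeProP p n) Q,
      φ.toMonoidHom.ker ≤ proFrattini p (FreeProP p n) := fun φ =>
    ker_le_of_minGens_eq φ.continuous φ.surj hQ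
  have := Fintype.ofFinite (SigmaEpi (FreeProP p n) Q)
  let A : SigmaEpi (FreeProP p n) Q → Set (Fin n → OddPart (FreeProP p n)) := fun φ =>
    {r | relSubgroup r ⊔ D = φ.toMonoidHom.ker}
  have hA : ∀ φ, MeasurableSet (A φ) := fun φ =>
    (isOpen_relSubgroup_sup_eq hD (isOpen_ker φ)).measurableSet
  have hU : {r | ∃ φ : SigmaEpi (FreeProP p n) Q, relSubgroup r ⊔ D = φ.toMonoidHom.ker} =
      ⋃ φ, A φ := by
    ext r; simp [A]
  -- every outcome in the event is counted once for each automorphism of `Q`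
  have hcount : ∀ r, ∑ φ, (A φ).indicator (fun _ => (1 : ENNReal)) r =
      Nat.card (SigmaAut Q) * (⋃ φ, A φ).indicator (fun _ => (1 : ENNReal)) r := by
    intro r
    by_cases hr : r ∈ ⋃ φ, A φ
    · obtain ⟨φ₁, hφ₁⟩ := Set.mem_iUnion.mp hr
      have hφ₁' : relSubgroup r ⊔ D = φ₁.toMonoidHom.ker := hφ₁
      rw [Set.indicator_of_mem hr, mul_one, ← card_sigmaEpi_ker_eq φ₁, Nat.card_eq_fintype_card,
        Fintype.card_subtype, Finset.card_eq_sum_ones, Finset.sum_filter, Nat.cast_sum]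
      refine Finset.sum_congr rfl fun φ _ => ?_
      by_cases hφ : φ.toMonoidHom.ker = φ₁.toMonoidHom.ker
      · rw [if_pos hφ, Set.indicator_of_mem (show r ∈ A φ from hφ₁'.trans hφ.symm), Nat.cast_one]
      · rw [if_neg hφ, Set.indicator_of_notMem, Nat.cast_zero]
        exact fun h : relSubgroup r ⊔ D = φ.toMonoidHom.ker => hφ (h.symm.trans hφ₁')
    · rw [Set.indicator_of_notMem hr, mul_zero]
      refine Finset.sum_eq_zero fun φ _ => Set.indicator_of_notMem (fun h => hr ?_) _
      exact Set.mem_iUnion.mpr ⟨φ, h⟩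
  have hsum : ∑ φ, Measure.pi (fun _ : Fin n => oddHaar p n) (A φ) =
      Nat.card (SigmaAut Q) * Measure.pi (fun _ : Fin n => oddHaar p n) (⋃ φ, A φ) := by
    have h1 : Measurable ((⋃ φ, A φ).indicator fun _ => (1 : ENNReal)) :=
      measurable_const.indicator (MeasurableSet.iUnion hA)
    have h2 := lintegral_finsetSum (μ := Measure.pi fun _ : Fin n => oddHaar p n) Finset.univ
      (f := fun φ => (A φ).indicator fun _ => (1 : ENNReal))
      fun φ _ => measurable_const.indicator (hA φ)
    simp_rw [hcount, lintegral_const_mul _ h1, lintegral_indicator_const (MeasurableSet.iUnion hA),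
      lintegral_indicator_const (hA _), one_mul] at h2
    exact h2.symm
  have hpos := constC_pos hp2 n
  rw [hU, ← hsum, Finset.sum_congr rfl fun φ _ =>
    measure_sup_eq_ker hp2 hD hDaut φ₀ φ (hfr φ), Finset.sum_const, nsmul_eq_mul, Finset.card_univ,
    ← Nat.card_eq_fintype_card,
    measure_relSubgroup_sup_eq hp2 hD (isOpen_ker φ₀) (hr₀ ▸ le_sup_right) c hmn hr₀,
    ENNReal.ofReal_mul hpos.le, ← card_sigmaEpi_mul hp2 φ₀ (hfr φ₀)]
  ring

end Law

end FreeProP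

/-! ### Minimal presentations -/

section Minimal

variable {p n k l : ℕ} [hp : Fact p.Prime]

/-- Every weak Schur `σ`-group has a presentation with relations in the Frattini subgroup. -/
theorem exists_theta_eq_frattini (k : ℕ) (r : Fin k → OddPart (FreeProP p k)) :
    ∃ (d : ℕ) (s : Fin d → OddPart (FreeProP p d)),
      relSubgroup s ≤ proFrattini p (FreeProP p d) ∧ theta p k r = theta p d s := by
  induction k with
  | zero => exact ⟨0, r, relSubgroup_le isClosed_proFrattini fun i => i.elim0, rfl⟩
  | succ k ih =>
    by_cases h : ∀ i, (r i : FreeProP p (k + 1)) ∈ proFrattini p (FreeProP p (k + 1))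
    · exact ⟨k + 1, r, relSubgroup_le isClosed_proFrattini h, rfl⟩
    · push Not at h
      obtain ⟨i, hi⟩ := h
      obtain ⟨β, h1, h2⟩ := FreeProP.exists_epi_of_notMem (r i).2 hi
      obtain ⟨d, s, hs, hds⟩ := ih fun j => FreeProP.oddMap β (r (i.succAbove j))
      exact ⟨d, s, hs, (theta_succ_eq h1 h2).trans hds⟩

theorem minGens_schurGroup {s : Fin n → OddPart (FreeProP p n)}
    (hs : relSubgroup s ≤ proFrattini p (FreeProP p n)) : minGens (SchurGroup s) = n :=
  FreeProP.minGens_eq_of_ker_le (mkEpi (relSubgroup s)).continuous (mkEpi (relSubgroup s)).surj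
    ((ker_mkEpi _).le.trans hs)

theorem map_ker_comp {A : Type u} [Group A] [TopologicalSpace A] [SigmaGroup A]
    (ψ : SigmaEpi (FreeProP p n) A) (α : SigmaAut (FreeProP p n)) :
    (ψ.comp α.toEpi).toMonoidHom.ker.map α.toEpi.toMonoidHom = ψ.toMonoidHom.ker := by
  rw [SigmaEpi.ker_comp, Subgroup.map_comap_eq_self_of_surjective α.toEpi.surj]

/-- The kernel of any epimorphism from `F_n` to a weak Schur `σ`-group with `d_G = n` is generated
by `n` odd relations. -/
theorem exists_relSubgroup_eq_ker (hp2 : p ≠ 2) {G : Type u} [Group G] [TopologicalSpace G]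
    [IsTopologicalGroup G] [SigmaGroup G] [T2Space G] (hG : IsWeakSchur p G)
    (hd : minGens G = n) (π : SigmaEpi (FreeProP p n) G) :
    ∃ r : Fin n → OddPart (FreeProP p n), relSubgroup r = π.toMonoidHom.ker := by
  obtain ⟨k, r, ⟨e⟩⟩ := hG
  obtain ⟨d, s, hs, hrs⟩ := exists_theta_eq_frattini k r
  obtain ⟨f⟩ := theta_eq_iff.mp hrs
  let τ : SigmaEpi (FreeProP p d) G := (e.trans f).symm.toEpi.comp (mkEpi (relSubgroup s))
  have hτ : τ.toMonoidHom.ker = relSubgroup s := by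
    rw [SigmaEpi.ker_iso_comp, ker_mkEpi]
  obtain rfl : d = n := by
    rw [← hd]
    exact (FreeProP.minGens_eq_of_ker_le τ.continuous τ.surj (hτ.le.trans hs)).symm
  obtain ⟨α, hα⟩ := FreeProP.exists_aut_comp_eq hp2 τ π
    (FreeProP.ker_le_of_minGens_eq π.continuous π.surj hd)
  have hπα : π.comp α.toEpi = τ := SigmaEpi.ext hα
  refine ⟨fun i => FreeProP.oddMap α.toEpi (s i), ?_⟩
  rw [FreeProP.relSubgroup_oddMap, ← hτ, ← hπα, map_ker_comp]

end Minimal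

/-! ### The set of groups with a given quotient -/

section Membership

variable {p n k l : ℕ} [hp : Fact p.Prime] {D : Subgroup (FreeProP p n)} [D.Normal]
  [IsSigmaInvariant D] {G : Type u} [Group G] [TopologicalSpace G] [IsTopologicalGroup G]
  [SigmaGroup G]

theorem t2Space_quotD [T2Space G] (hD : IsClosed (D : Set (FreeProP p n)))
    (π : SigmaEpi (FreeProP p n) G) : T2Space (quotD D π) := by
  have : IsClosed (π.image D : Set G) := (hD.isCompact.image π.continuous).isClosed
  infer_instance

variable (D) in
/-- The projection `F_n → G_D`. -/
def quotEpi (π : SigmaEpi (FreeProP p n) G) : SigmaEpi (FreeProP p n) (quotD D π) :=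
  (mkEpi (π.image D)).comp π

theorem ker_quotEpi (π : SigmaEpi (FreeProP p n) G) :
    (quotEpi D π).toMonoidHom.ker = π.toMonoidHom.ker ⊔ D := ker_mkEpi_image_comp π D

theorem minGens_quotD [T2Space G] (hD : IsClosed (D : Set (FreeProP p n)))
    (hDf : D ≤ proFrattini p (FreeProP p n)) (hd : minGens G = n)
    (π : SigmaEpi (FreeProP p n) G) : minGens (quotD D π) = n := by
  have := t2Space_quotD hD π
  refine FreeProP.minGens_eq_of_ker_le (quotEpi D π).continuous (quotEpi D π).surj ?_
  rw [ker_quotEpi]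
  exact sup_le (FreeProP.ker_le_of_minGens_eq π.continuous π.surj hd) hDf

/-- `A_D` is the quotient of `F_n` by the product of `D` and the kernel of `F_n → A`. -/
theorem nonempty_iso_quotD {A : Type v} [Group A] [TopologicalSpace A]
    [IsTopologicalGroup A] [SigmaGroup A] [T2Space A] {B : Type w} [Group B] [TopologicalSpace B]
    [SigmaGroup B] [T2Space B]
    (hD : IsClosed (D : Set (FreeProP p n))) (ρ : SigmaEpi (FreeProP p n) A)
    (φ : SigmaEpi (FreeProP p n) B) (h : φ.toMonoidHom.ker = ρ.toMonoidHom.ker ⊔ D) :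
    Nonempty (SigmaIso (quotD D ρ) B) := by
  have := t2Space_quotD hD ρ
  exact ⟨((quotEpi D ρ).exists_iso_of_ker_eq φ ((ker_quotEpi ρ).trans h.symm)).choose⟩

/-- The condition defining `U_{D,G}` in terms of one fixed presentation of the group and of the
kernels of epimorphisms from `F_n`: an isomorphism `H_D ≅ G_D` is an epimorphism `F_n → G_D` with
the kernel of `F_n → H → H_D`. -/
theorem theta_mem_setUDG [T2Space G] (hD : IsClosed (D : Set (FreeProP p n)))
    (π : SigmaEpi (FreeProP p n) G) {r : Fin k → OddPart (FreeProP p k)} :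
    theta p k r ∈ setUDG D π ↔ ∃ ρ : SigmaEpi (FreeProP p n) (SchurGroup r),
      ρ.toMonoidHom.ker ≤ proFrattini p (FreeProP p n) ∧
        ∃ φ : SigmaEpi (FreeProP p n) (quotD D π),
          φ.toMonoidHom.ker = ρ.toMonoidHom.ker ⊔ D := by
  have := t2Space_quotD hD π
  constructor
  · rintro ⟨⟨l, s⟩, ha, hmin, ρ, ⟨e⟩⟩
    obtain ⟨f⟩ := theta_eq_iff.mp (show theta p l s = theta p k r from ha)
    refine ⟨f.toEpi.comp ρ, ?_, e.toEpi.comp (quotEpi D ρ), ?_⟩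
    · rw [SigmaEpi.ker_iso_comp]
      exact FreeProP.ker_le_of_minGens_eq ρ.continuous ρ.surj hmin
    · rw [SigmaEpi.ker_iso_comp, SigmaEpi.ker_iso_comp, ker_quotEpi]
  · rintro ⟨ρ, hρ, φ, hφ⟩
    exact ⟨⟨k, r⟩, rfl, FreeProP.minGens_eq_of_ker_le ρ.continuous ρ.surj hρ, ρ,
      nonempty_iso_quotD hD ρ φ hφ⟩

/-- For `n` relations of `F_n`, membership in `U_{D,G}` depends only on the subgroup that they
generate modulo `D`. -/
theorem theta_mem_setUDG_iff (hp2 : p ≠ 2) [T2Space G] (hD : IsClosed (D : Set (FreeProP p n)))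
    (hDf : D ≤ proFrattini p (FreeProP p n))
    (hDaut : ∀ α : SigmaAut (FreeProP p n), ∀ x ∈ D, α.toContinuousMulEquiv x ∈ D)
    (hd : minGens G = n) (π : SigmaEpi (FreeProP p n) G) {r : Fin n → OddPart (FreeProP p n)} :
    theta p n r ∈ setUDG D π ↔ ∃ φ : SigmaEpi (FreeProP p n) (quotD D π),
      relSubgroup r ⊔ D = φ.toMonoidHom.ker := by
  have := t2Space_quotD hD π
  rw [theta_mem_setUDG hD]
  constructor
  · rintro ⟨ρ, hρ, φ, hφ⟩
    obtain ⟨α, hα⟩ := FreeProP.exists_aut_comp_eq hp2 (mkEpi (relSubgroup r)) ρ hρ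
    have hρα : ρ.comp α.toEpi = mkEpi (relSubgroup r) := SigmaEpi.ext hα
    refine ⟨φ.comp α.toEpi, ?_⟩
    have hinj : Function.Injective α.toEpi.toMonoidHom := α.toContinuousMulEquiv.injective
    apply Subgroup.map_injective hinj
    rw [map_ker_comp, hφ, Subgroup.map_sup, FreeProP.map_eq_of_aut_mem hDaut,
      ← map_ker_comp ρ α, hρα, ker_mkEpi]
  · rintro ⟨φ, hφ⟩
    refine ⟨mkEpi (relSubgroup r), ?_, φ, ?_⟩
    · rw [ker_mkEpi]
      exact le_sup_left.trans (hφ.le.trans (FreeProP.ker_le_of_minGens_eq φ.continuous φ.surj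
        (minGens_quotD hD hDf hd π)))
    · rw [ker_mkEpi, hφ]

/-- Relations in the Frattini subgroup of `F_d`, with `d ≠ n`, almost surely define a group that
is not in `U_{D,G}`, since it has `d` generators. -/
theorem mixedLaw_setUDG_eq_zero (hp2 : p ≠ 2) [T2Space G]
    (hD : IsClosed (D : Set (FreeProP p n))) (π : SigmaEpi (FreeProP p n) G)
    (hU : MeasurableSet (setUDG D π)) {d : ℕ} (hdn : d ≠ n) :
    mixedLaw p d 0 (setUDG D π) = 0 := by
  have := isProbabilityMeasure_mixedMeasure (p := p) (n := d) hp2 0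
  rw [mixedLaw, Measure.map_apply measurable_theta hU]
  have hsub : theta p d ⁻¹' setUDG D π ⊆
      ⋃ i, (fun r : Fin d → OddPart (FreeProP p d) => r i) ⁻¹'
        (FreeProP.oddIn (proFrattini p (FreeProP p d)))ᶜ := by
    intro r hr
    by_contra hnot
    have hr' : ∀ i, (r i : FreeProP p d) ∈ proFrattini p (FreeProP p d) := fun i => by
      by_contra hi
      exact hnot (Set.mem_iUnion.mpr ⟨i, hi⟩)
    obtain ⟨ρ, hρ, -⟩ := (theta_mem_setUDG hD π).mp hr
    have h1 := FreeProP.minGens_eq_of_ker_le ρ.continuous ρ.surj hρ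
    have h2 := minGens_schurGroup (relSubgroup_le isClosed_proFrattini hr')
    exact hdn (h2.symm.trans h1)
  refine measure_mono_null hsub (measure_iUnion_null fun i => ?_)
  refine Measure.pi_eval_preimage_null _ ?_
  rw [mixedMeasure, if_neg (Nat.not_lt_zero _)]
  exact (FreeProP.isUniformOn_frattiniHaar hp2).compl

/-- Membership in `U_{D,G}` is determined by the quotient by a step of the Zassenhaus filtration
that lies in `L^p [L, F]` for the kernels `L` of all epimorphisms `F_n → G_D`. -/
theorem theta_mem_setUDG_of_iso (hp2 : p ≠ 2) [T2Space G]
    (hD : IsClosed (D : Set (FreeProP p n)))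
    (π : SigmaEpi (FreeProP p n) G) {i : ℕ} (hi : 2 ≤ i)
    (hDi : ∀ φ : SigmaEpi (FreeProP p n) (quotD D π),
      zassenhaus p (FreeProP p n) i ≤ centralFrattini p φ.toMonoidHom.ker)
    {r : Fin k → OddPart (FreeProP p k)} {s : Fin l → OddPart (FreeProP p l)}
    (e : SigmaIso (SchurGroup r ⧸ zassenhaus p (SchurGroup r) i)
      (SchurGroup s ⧸ zassenhaus p (SchurGroup s) i))
    (h : theta p k r ∈ setUDG D π) : theta p l s ∈ setUDG D π := by
  have := t2Space_quotD hD π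
  obtain ⟨ρ, hρ, φ, hφ⟩ := (theta_mem_setUDG hD π).mp h
  obtain ⟨d, t, ht, hst⟩ := exists_theta_eq_frattini l s
  obtain ⟨f⟩ := theta_eq_iff.mp hst
  rw [hst, theta_mem_setUDG hD]
  obtain ⟨f'⟩ := nonempty_iso_quotient_zassenhaus (p := p) f i
  let ρi := (e.trans f').toEpi.comp ((mkEpi (zassenhaus p (SchurGroup r) i)).comp ρ)
  have hρi : ρi.toMonoidHom.ker = ρ.toMonoidHom.ker ⊔ zassenhaus p (FreeProP p n) i := by
    rw [SigmaEpi.ker_iso_comp, ker_mkEpi_zassenhaus_comp]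
  let τ := mkEpi (relSubgroup t)
  let τi := (mkEpi (zassenhaus p (SchurGroup t) i)).comp τ
  have hτi : τi.toMonoidHom.ker ≤ proFrattini p (FreeProP p d) := by
    rw [ker_mkEpi_zassenhaus_comp, ker_mkEpi]
    exact sup_le ht (zassenhaus_le_proFrattini hi)
  -- both groups have the same number of generators, as it can be read off from the quotients
  obtain rfl : d = n := by
    rw [← FreeProP.minGens_eq_of_ker_le τi.continuous τi.surj hτi]
    refine FreeProP.minGens_eq_of_ker_le ρi.continuous ρi.surj ?_
    rw [hρi]
    exact sup_le hρ (zassenhaus_le_proFrattini hi)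
  obtain ⟨α, hα⟩ := FreeProP.exists_aut_comp_eq hp2 ρi τi hτi
  have hτα : (mkEpi (zassenhaus p (SchurGroup t) i)).comp (τ.comp α.toEpi) = ρi :=
    SigmaEpi.ext hα
  have hker : (τ.comp α.toEpi).toMonoidHom.ker ⊔ zassenhaus p (FreeProP p d) i =
      ρ.toMonoidHom.ker ⊔ zassenhaus p (FreeProP p d) i := by
    rw [← ker_mkEpi_zassenhaus_comp, hτα, hρi]
  have hcl : IsClosed ((τ.comp α.toEpi).toMonoidHom.ker : Set (FreeProP p d)) :=
    (isClosed_singleton (x := (1 : SchurGroup t))).preimage (τ.comp α.toEpi).continuous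
  have hCL : centralFrattini p φ.toMonoidHom.ker ≤ φ.toMonoidHom.ker :=
    centralFrattini_le_self (isClosed_singleton.preimage φ.continuous)
  have hDφ : D ≤ φ.toMonoidHom.ker := hφ ▸ le_sup_right
  refine ⟨τ.comp α.toEpi, ?_, φ, le_antisymm ?_ (sup_le ?_ hDφ)⟩
  · exact le_sup_left.trans (hker.le.trans (sup_le hρ (zassenhaus_le_proFrattini hi)))
  -- the kernels agree modulo `L^p [L, F]`, which Nakayama's lemma allows to ignore
  · refine FreeProP.le_of_le_sup_centralFrattini (FreeProP.isClosed_sup hcl hD) ?_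
    conv_lhs => rw [hφ]
    refine sup_le ((le_sup_left.trans hker.ge).trans (sup_le ?_ ?_)) ?_
    · exact le_sup_left.trans le_sup_left
    · exact (hDi φ).trans le_sup_right
    · exact le_sup_right.trans le_sup_left
  · exact le_sup_left.trans (hker.le.trans (sup_le (hφ ▸ le_sup_left) ((hDi φ).trans hCL)))

/-- Whether a group lies in `U_{D,G}` is decided by its quotient by one fixed term of the Zassenhaus
filtration, so `U_{D,G}` and its complement are unions of basic open sets. -/
theorem isClopen_setUDG (hp2 : p ≠ 2) [T2Space G] (hD : IsClosed (D : Set (FreeProP p n)))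
    (π : SigmaEpi (FreeProP p n) G) [Finite (quotD D π)] : IsClopen (setUDG D π) := by
  have := t2Space_quotD hD π
  have hex : ∀ φ : SigmaEpi (FreeProP p n) (quotD D π), ∃ e, ∀ i, e ≤ i →
      zassenhaus p (FreeProP p n) i ≤ centralFrattini p φ.toMonoidHom.ker := fun φ =>
    FreeProP.exists_zassenhaus_le _ (FreeProP.isOpen_centralFrattini (FreeProP.isOpen_ker φ))
  choose e he using hex
  have := Fintype.ofFinite (SigmaEpi (FreeProP p n) (quotD D π))
  let i := max 2 (Finset.univ.sup e)
  have hi : 2 ≤ i := le_max_left _ _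
  have hDi : ∀ φ : SigmaEpi (FreeProP p n) (quotD D π),
      zassenhaus p (FreeProP p n) i ≤ centralFrattini p φ.toMonoidHom.ker := fun φ =>
    he φ i ((Finset.le_sup (Finset.mem_univ φ)).trans (le_max_right _ _))
  have hopen : ∀ b : Presentation p, IsOpen (basicOpen i b) := fun b =>
    TopologicalSpace.isOpen_generateFrom_of_mem ⟨i, hi, b, rfl⟩
  have hself : ∀ (k : ℕ) (r : Fin k → OddPart (FreeProP p k)), theta p k r ∈ basicOpen i ⟨k, r⟩ :=
    fun k r => theta_mem_basicOpen.mpr ⟨SigmaIso.refl _⟩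
  constructor
  · rw [← isOpen_compl_iff, isOpen_iff_forall_mem_open]
    intro q hq
    obtain ⟨k, r, rfl⟩ := exists_theta_eq q
    refine ⟨basicOpen i ⟨k, r⟩, fun q' hq' hU => ?_, hopen _, hself k r⟩
    obtain ⟨l, s, rfl⟩ := exists_theta_eq q'
    obtain ⟨e⟩ := theta_mem_basicOpen.mp hq'
    exact hq (theta_mem_setUDG_of_iso hp2 hD π hi hDi e hU)
  · rw [isOpen_iff_forall_mem_open]
    intro q hq
    obtain ⟨k, r, rfl⟩ := exists_theta_eq q
    refine ⟨basicOpen i ⟨k, r⟩, fun q' hq' => ?_, hopen _, hself k r⟩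
    obtain ⟨l, s, rfl⟩ := exists_theta_eq q'
    obtain ⟨e⟩ := theta_mem_basicOpen.mp hq'
    exact theta_mem_setUDG_of_iso hp2 hD π hi hDi e.symm hq

end Membership

/-! ### The number of relations -/

namespace FreeProP

variable {p n m k : ℕ} [hp : Fact p.Prime] {D L : Subgroup (FreeProP p n)} [D.Normal] [L.Normal]

/-- Generation as a normal subgroup in `F_n / D` and in `F_n` modulo `D` agree. -/
theorem map_normalSpan_sup (hD : IsClosed (D : Set (FreeProP p n)))
    (s : Fin k → FreeProP p n) :
    (normalSpan s ⊔ D).map (QuotientGroup.mk' D) = (Subgroup.normalClosure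
      (Set.range fun i => (s i : FreeProP p n ⧸ D))).topologicalClosure := by
  have hN : ((normalSpan s ⊔ D).map (QuotientGroup.mk' D)).Normal :=
    (inferInstance : (normalSpan s ⊔ D).Normal).map _ QuotientGroup.mk_surjective
  have hcont : Continuous (QuotientGroup.mk' D) := QuotientGroup.continuous_mk
  apply le_antisymm
  · rw [Subgroup.map_le_iff_le_comap]
    have hn := (Subgroup.is_normal_topologicalClosure
      (Subgroup.normalClosure (Set.range fun i => (s i : FreeProP p n ⧸ D)))).comap
        (QuotientGroup.mk' D)
    refine sup_le (normalSpan_le ?_ fun i => ?_) fun x hx => ?_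
    · exact (Subgroup.isClosed_topologicalClosure _).preimage hcont
    · exact Subgroup.le_topologicalClosure _ (Subgroup.subset_normalClosure ⟨i, rfl⟩)
    · rw [Subgroup.mem_comap, QuotientGroup.mk'_apply, (QuotientGroup.eq_one_iff x).mpr hx]
      exact one_mem _
  · refine Subgroup.topologicalClosure_minimal _ (Subgroup.normalClosure_le_normal ?_) ?_
    · rintro _ ⟨i, rfl⟩
      exact ⟨s i, (le_sup_left : normalSpan s ≤ _) (mem_normalSpan s i), rfl⟩
    · exact ((isClosed_sup (isClosed_normalSpan s) hD).isCompact.image hcont).isClosed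

theorem le_of_span_eq_top {v : Fin k → Fin m → ZMod p}
    (h : Submodule.span (ZMod p) (Set.range v) = ⊤) : m ≤ k := by
  have := finrank_range_le_card (R := ZMod p) v
  rw [Set.finrank, h, finrank_top, Module.finrank_fin_fun, Fintype.card_fin] at this
  exact this

theorem exists_normalSpan_sup_eq (hD : IsClosed (D : Set (FreeProP p n)))
    (hL : IsOpen (L : Set (FreeProP p n))) (hDL : D ≤ L)
    (c : Coordinates p L (D ⊔ centralFrattini p L) m) :
    ∃ s : Fin m → FreeProP p n, normalSpan s ⊔ D = L := by
  choose s hsL hs using fun i : Fin m => c.surj (Pi.single i 1)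
  refine ⟨s, (normalSpan_sup_eq_iff hD hL hDL c s).mpr ⟨hsL, ?_⟩⟩
  simp_rw [hs]
  exact span_single_eq_top

/-- The number of relations modulo `D` is the dimension of `L / D L^p [L, F]`. -/
theorem relRank_eq {G : Type u} [Group G] [TopologicalSpace G] [SigmaGroup G]
    (π : SigmaEpi (FreeProP p n) G) (hD : IsClosed (D : Set (FreeProP p n)))
    (hL : IsOpen (L : Set (FreeProP p n))) (hπ : L = π.toMonoidHom.ker ⊔ D)
    (c : Coordinates p L (D ⊔ centralFrattini p L) m) : relRank D π = m := by
  have hDL : D ≤ L := hπ ▸ le_sup_right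
  have hmk : π.toMonoidHom.ker.map (QuotientGroup.mk' D) = L.map (QuotientGroup.mk' D) := by
    rw [hπ, Subgroup.map_sup, QuotientGroup.map_mk'_self, sup_bot_eq]
  rw [relRank, minNormalGens, hmk]
  obtain ⟨s, hs⟩ := exists_normalSpan_sup_eq hD hL hDL c
  have hmem : ∃ t : Fin m → FreeProP p n ⧸ D,
      (Subgroup.normalClosure (Set.range t)).topologicalClosure = L.map (QuotientGroup.mk' D) :=
    ⟨fun i => s i, by rw [← map_normalSpan_sup hD, hs]⟩
  refine le_antisymm (Nat.sInf_le hmem) (le_csInf ⟨m, hmem⟩ ?_)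
  rintro k ⟨t, ht⟩
  obtain ⟨s, rfl⟩ : ∃ s : Fin k → FreeProP p n, (fun i => (s i : FreeProP p n ⧸ D)) = t :=
    ⟨fun i => (t i).out, funext fun i => QuotientGroup.out_eq' (t i)⟩
  rw [← map_normalSpan_sup hD] at ht
  have h := Subgroup.map_injective_of_ker_le (QuotientGroup.mk' D)
    ((QuotientGroup.ker_mk' D).le.trans le_sup_right) ((QuotientGroup.ker_mk' D).le.trans hDL) ht
  exact le_of_span_eq_top ((normalSpan_sup_eq_iff hD hL hDL c s).mp h).2

/-- If `D` lies in the commutator subgroup, then `n` relations are needed modulo `D` to define a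
finite group: with fewer relations, the abelianization would be infinite. -/
theorem le_of_le_closedCommutator (hDc : D ≤ closedCommutator (FreeProP p n))
    (hL : IsOpen (L : Set (FreeProP p n))) {s : Fin m → FreeProP p n}
    (hs : normalSpan s ⊔ D = L) : n ≤ m := by
  have := finite_quotient_of_isOpen L hL
  have : L.FiniteIndex := Subgroup.finiteIndex_of_finite_quotient
  by_contra! hmn
  -- a power of `p` that exceeds the index of `L`
  obtain ⟨q, hq⟩ : ∃ q, q = p ^ L.index := ⟨_, rfl⟩
  have hqL : L.index < q := hq ▸ Nat.lt_pow_self hp.out.one_lt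
  have hq0 : NeZero q := ⟨by omega⟩
  obtain ⟨f, hf, hfg⟩ := exists_exponents (n := n) hq
  have hfs := surjective_of_map_gen hfg
  let W := LinearMap.range (Fintype.linearCombination (ZMod q) fun j => (f (s j)).toAdd)
  let R : Subgroup (Multiplicative (Fin n → ZMod q)) := W.toAddSubgroup.toSubgroup
  have hcl : IsClosed (R.comap f : Set (FreeProP p n)) :=
    (Set.toFinite (R : Set (Multiplicative (Fin n → ZMod q)))).isClosed.preimage hf
  have hLR : L ≤ R.comap f := by
    rw [← hs]
    refine sup_le (normalSpan_le hcl fun j => ?_) ?_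
    · refine ⟨Pi.single j 1, ?_⟩
      rw [Fintype.linearCombination_apply_single, one_smul]
    · refine hDc.trans ?_
      refine Subgroup.topologicalClosure_minimal _ ?_ hcl
      refine (Abelianization.commutator_subset_ker f).trans ?_
      exact Subgroup.ker_le_comap f R
  -- `R` is generated by `m < n` elements, so its index in `(ℤ/q)^n` is at least `q`
  have hindex : R.index ≤ L.index := by
    rw [← Subgroup.index_comap_of_surjective R hfs]
    exact Nat.le_of_dvd (Nat.pos_of_ne_zero Subgroup.FiniteIndex.index_ne_zero)
      (Subgroup.index_dvd_of_le hLR)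
  have hcardR : Nat.card R ≤ q ^ m := by
    have h := Nat.card_le_card_of_surjective
      (Fintype.linearCombination (ZMod q) fun j => (f (s j)).toAdd).rangeRestrict
      (LinearMap.surjective_rangeRestrict _)
    rw [Nat.card_fun, Nat.card_zmod, Nat.card_fin] at h
    exact h
  have hcard : R.index * Nat.card R = q ^ n := by
    rw [Subgroup.index_mul_card]
    change Nat.card (Fin n → ZMod q) = _
    rw [Nat.card_fun, Nat.card_zmod, Nat.card_fin]
  have h1 : q ^ n ≤ L.index * q ^ m := hcard ▸ Nat.mul_le_mul hindex hcardR
  have h2 : L.index * q ^ m < q * q ^ m := Nat.mul_lt_mul_of_pos_right hqL (pow_pos (by omega) m)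
  have h3 : q * q ^ m ≤ q ^ n := by
    rw [← pow_succ']
    exact Nat.pow_le_pow_right (by omega) hmn
  omega

end FreeProP

/-! ### The measure of the set of groups with a given quotient -/

section Measure

variable {p n m : ℕ} [hp : Fact p.Prime] {D : Subgroup (FreeProP p n)} [D.Normal]
  [IsSigmaInvariant D] {G : Type u} [Group G] [TopologicalSpace G] [IsTopologicalGroup G]
  [SigmaGroup G]

/-- The measure of `U_{D,G}`, where `m` is the dimension of `L / D L^p [L, F]` for the kernel `L` of
`F_n → G_D`. -/
theorem schMeasureInf_setUDG (hp2 : p ≠ 2) [T2Space G] (hD : IsClosed (D : Set (FreeProP p n)))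
    (hDf : D ≤ proFrattini p (FreeProP p n))
    (hDaut : ∀ α : SigmaAut (FreeProP p n), ∀ x ∈ D, α.toContinuousMulEquiv x ∈ D)
    (hd : minGens G = n) (π : SigmaEpi (FreeProP p n) G) [Finite (quotD D π)]
    {r₀ : Fin n → OddPart (FreeProP p n)}
    (hr₀ : relSubgroup r₀ ⊔ D = (quotEpi D π).toMonoidHom.ker)
    (c : Coordinates p (quotEpi D π).toMonoidHom.ker
      (D ⊔ centralFrattini p (quotEpi D π).toMonoidHom.ker) m) (hmn : m ≤ n) :
    schMeasureInf p (setUDG D π) = ENNReal.ofReal (constCInf p /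
      (constC p (n - m) * (Nat.card (SigmaAut (quotD D π)) : ℝ))) := by
  have := t2Space_quotD hD π
  have hU : MeasurableSet (setUDG D π) := (isClopen_setUDG hp2 hD π).isOpen.measurableSet
  have hset : theta p n ⁻¹' setUDG D π = {r | ∃ φ : SigmaEpi (FreeProP p n) (quotD D π),
      relSubgroup r ⊔ D = φ.toMonoidHom.ker} :=
    Set.ext fun r => theta_mem_setUDG_iff hp2 hD hDf hDaut hd π
  have hmul := FreeProP.card_sigmaAut_mul_measure hp2 (minGens_quotD hD hDf hd π) hD hDaut
    (quotEpi D π) hr₀ c hmn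
  rw [← hset, ← Measure.map_apply measurable_theta hU] at hmul
  have := FreeProP.finite_sigmaAut (quotEpi D π)
  have : Nonempty (SigmaAut (quotD D π)) := ⟨SigmaIso.refl _⟩
  have hcard : 0 < Nat.card (SigmaAut (quotD D π)) := Nat.card_pos
  have h1 := constC_pos hp2 n
  have h2 := constC_pos hp2 (n - m)
  have h3 : 0 < constCInf p := lt_of_lt_of_le (by norm_num) (half_le_constCInf hp2)
  set a := Nat.card (SigmaAut (quotD D π))
  have ha : (0 : ℝ) < a := by exact_mod_cast hcard
  have hn : schMeasure p n (setUDG D π) =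
      ENNReal.ofReal (constC p n * (constC p n / constC p (n - m)) / a) := by
    rw [ENNReal.ofReal_div_of_pos ha, ENNReal.ofReal_natCast,
      ENNReal.eq_div_iff (by exact_mod_cast hcard.ne') (ENNReal.natCast_ne_top a)]
    exact hmul
  rw [schMeasureInf_eq hp2 hU n fun d hdn => mixedLaw_setUDG_eq_zero hp2 hD π hU hdn, hn,
    ← ENNReal.ofReal_mul (by positivity)]
  congr 1
  field_simp

theorem t2Space_of_isWeakSchur (hG : IsWeakSchur p G) : T2Space G := by
  obtain ⟨k, r, ⟨e⟩⟩ := hG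
  exact e.toContinuousMulEquiv.toHomeomorph.symm.t2Space

end Measure

end SchurSigma

theorem mainTheorem6 (p : ℕ) [Fact p.Prime] (hp : p ≠ 2) (n : ℕ)
    (D : Subgroup (SchurSigma.FreeProP p n)) [D.Normal] [SchurSigma.IsSigmaInvariant D]
    (hDclosed : IsClosed (D : Set (SchurSigma.FreeProP p n)))
    (hDfrattini : D ≤ SchurSigma.proFrattini p (SchurSigma.FreeProP p n))
    (hDaut : ∀ α : SchurSigma.SigmaAut (SchurSigma.FreeProP p n),
      ∀ x ∈ D, α.toContinuousMulEquiv x ∈ D)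
    {G : Type*} [Group G] [TopologicalSpace G] [IsTopologicalGroup G] [SchurSigma.SigmaGroup G]
    (hG : SchurSigma.IsWeakSchur p G) (hd : SchurSigma.minGens G = n)
    (π : SchurSigma.SigmaEpi (SchurSigma.FreeProP p n) G)
    (hfin : Finite (SchurSigma.quotD D π)) :
    IsClopen (SchurSigma.setUDG D π) ∧
    SchurSigma.relRank D π ≤ n ∧
    SchurSigma.schMeasureInf p (SchurSigma.setUDG D π) =
      ENNReal.ofReal (SchurSigma.constCInf p /
        (SchurSigma.constC p (n - SchurSigma.relRank D π) *
          (Nat.card (SchurSigma.SigmaAut (SchurSigma.quotD D π)) : ℝ))) ∧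
    (D ≤ SchurSigma.closedCommutator (SchurSigma.FreeProP p n) →
      SchurSigma.schMeasureInf p (SchurSigma.setUDG D π) =
        ENNReal.ofReal (SchurSigma.constCInf p /
          (Nat.card (SchurSigma.SigmaAut (SchurSigma.quotD D π)) : ℝ))) := by
  have := SchurSigma.t2Space_of_isWeakSchur hG
  have := SchurSigma.t2Space_quotD hDclosed π
  obtain ⟨r, hr⟩ := SchurSigma.exists_relSubgroup_eq_ker hp hG hd π
  have hL := SchurSigma.FreeProP.isOpen_ker (SchurSigma.quotEpi D π)
  have hker := SchurSigma.ker_quotEpi (D := D) π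
  have hDL : D ≤ (SchurSigma.quotEpi D π).toMonoidHom.ker := hker ▸ le_sup_right
  have hr₀ : SchurSigma.relSubgroup r ⊔ D = (SchurSigma.quotEpi D π).toMonoidHom.ker := by
    rw [hr, hker]
  obtain ⟨m, ⟨c⟩⟩ := SchurSigma.FreeProP.exists_coordinates_sup D hL
  have hm := SchurSigma.FreeProP.relRank_eq π hDclosed hL hker c
  have hmn : m ≤ n := SchurSigma.FreeProP.le_of_span_eq_top
    ((SchurSigma.FreeProP.normalSpan_sup_eq_iff hDclosed hL hDL c _).mp hr₀).2
  have hμ := SchurSigma.schMeasureInf_setUDG hp hDclosed hDfrattini hDaut hd π hr₀ c hmn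
  rw [hm]
  refine ⟨SchurSigma.isClopen_setUDG hp hDclosed π, hmn, hμ, fun hDc => ?_⟩
  obtain ⟨s, hs⟩ := SchurSigma.FreeProP.exists_normalSpan_sup_eq hDclosed hL hDL c
  have hnm := SchurSigma.FreeProP.le_of_le_closedCommutator hDc hL hs
  rw [hμ, show n - m = 0 by omega, SchurSigma.constC_zero, one_mul]
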